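/- **Setting.** Let $\eta_0:\mathbb R\to[0,1]$ be a smooth even function with $\eta_0=0$ for $|\mu|>2$ and $\eta_0=1$ for $|\mu|\le 1/2$; put $\eta_j(\mu)=\eta_0(\mu/2^j)-\eta_0(\mu/2^{j-1})$ for $j\ge1$, and $\chi_{k,l}(r)=1-\eta_0(r/2^{k-l})$ if $k\ge100$, $\chi_{k,l}\equiv1$ if $0\le k\le 99$. For $\xi\in\mathbb R^2$, $\tau\in\mathbb R$ let $P(\tau,\xi)=\tau+\xi_1^2-\xi_2^2$, and for $\mathbf e=(\cos\theta,\sin\theta)\in\mathbb S^1$ let $\overline{\mathbf e}=(\cos\theta,-\sin\theta)$, $\mathbf e^\perp=(-\sin\theta,\cos\theta)$. Let $$\|F\|_{L^{p,q}_{\mathbf e}}=\Big\|\,\big\|F(r\mathbf e+v\mathbf e^\perp,t)\big\|_{L^q_{v,t}(\mathbb R^2)}\Big\|_{L^p_r(\mathbb R)},$$ the space $L^{p,q}_{\mathbf e}$ consisting of the $F\in L^2(\mathbb R^2\times\mathbb R)$ for which this is finite, and let $\mathcal F^{-1}f(x,t)=(2\pi)^{-3}\int e^{i(x\cdot\xi+t\tau)}f(\xi,\tau)\,d\xi\,d\tau$,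 extended to $L^2(\mathbb R^2\times\mathbb R)$. Let $D_{k,\infty}$ be the set of $(\xi,\tau)$ with $|\xi|\in[2^{k-1},2^{k+1}]$ if $k\ge1$, and with $|\xi|\le2$ if $k=0$; let $D^{\mathbf e}_{k,\infty}$ be its subset where $|\xi\cdot\overline{\mathbf e}|\ge|\xi|/2$. For $k\in\mathbb Z_+=\{0,1,2,\dots\}$, $X_k$ is the space of $f\in L^2(\mathbb R^2\times\mathbb R)$ supported in $D_{k,\infty}$ with $$\|f\|_{X_k}=\sum_{j\ge0}2^{j/2}\|\eta_j(P(\tau,\xi))f\|_{L^2}<\infty .$$ For $k\ge100$, $Y_k^{\mathbf e}$ is the space of $f\in L^2(\mathbb R^2\times\mathbb R)$ supported in $D^{\mathbf e}_{k,\infty}$ with $\mathcal F^{-1}[(P+i)f]\in L^{1,2}_{\mathbf e}$, with the norm $\|f\|_{Y_k^{\mathbf e}}=2^{-k/2}\|\mathcal F^{-1}[(P+i)f]\|_{L^{1,2}_{\mathbf e}}$; for $k\le99$, $Y_k^{\mathbf e}=\{0\}$. Fix finitely many distinct $\mathbf e_1,\dots,\mathbf e_L\in\mathbb S^1$ such that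 every point of $\mathbb S^1$ is within distance $2^{-50}$ of some $\mathbf e_l$ and such that the set $\{\mathbf e_l\}$ is invariant under $\mathbf e\mapsto-\mathbf e$. Let $Z_k=X_k+Y_k^{\mathbf e_1}+\dots+Y_k^{\mathbf e_L}$ with the norm $$\|f\|_{Z_k}=\inf\Big\{\|g\|_{X_k}+\sum_{l=1}^L\|h_l\|_{Y_k^{\mathbf e_l}}:\ f=g+\sum_{l=1}^L h_l,\ g\in X_k,\ h_l\in Y_k^{\mathbf e_l}\Big\}.$$ **Lemma (local smoothing).** There is a constant $C>0$, depending only on the fixed $\eta_0$ and $\mathbf e_1,\dots,\mathbf e_L$, such that for all $k\in\mathbb Z_+$, $\mathbf e'\in\mathbb S^1$ and $f\in Z_k$, $$\big\|\mathcal F^{-1}[f\cdot\chi_{k,30}(\xi\cdot\overline{\mathbf e'})]\big\|_{L^{\infty,2}_{\mathbf e'}}\le C\,2^{-k/2}\|f\|_{Z_k}.$$ The cutoff cannot be removed: there is $\mathbf e'\in\mathbb S^1$ such that for every $C$ there are $k\in\mathbb Z_+$ and $f\in Z_k$ with $$\|\mathcal F^{-1}f\|_{L^{\infty,2}_{\mathbf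 e'}}>C\,2^{-k/2}\|f\|_{Z_k}.$$ -/

import Mathlib

open MeasureTheory
open scoped FourierTransform ENNReal ContDiff

noncomputable section

namespace LocalSmoothing

/-- The plane `ℝ²` with its Euclidean norm. -/
abbrev Plane : Type := EuclideanSpace ℝ (Fin 2)

/-- Space-time `ℝ² × ℝ`: the coordinates `0, 1` are the spatial ones, the coordinate `2` is time.
The same type carries the dual variables `(ξ₁, ξ₂, τ)`. -/
abbrev SpaceTime : Type := EuclideanSpace ℝ (Fin 3)

/-- The spatial part `ξ = (ξ₁, ξ₂)` of `(ξ, τ)`. -/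
def space (z : SpaceTime) : Plane := !₂[z 0, z 1]

/-- The conjugate vector `(ξ₁, -ξ₂)`. -/
def conjVec (e : Plane) : Plane := !₂[e 0, -e 1]

/-- The symbol `P(τ, ξ) = τ + ξ₁² - ξ₂²`. -/
def symbolP (z : SpaceTime) : ℝ := z 2 + z 0 ^ 2 - z 1 ^ 2

/-- A smooth even function `ℝ → [0, 1]`, supported in `[-2, 2]`, equal to `1` on `[-1/2, 1/2]`. -/
structure IsCutoff (η₀ : ℝ → ℝ) : Prop where
  smooth : ContDiff ℝ ∞ η₀
  even : ∀ μ, η₀ (-μ) = η₀ μ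
  mem_Icc : ∀ μ, η₀ μ ∈ Set.Icc (0 : ℝ) 1
  eq_zero : ∀ μ, 2 < |μ| → η₀ μ = 0
  eq_one : ∀ μ, |μ| ≤ 1 / 2 → η₀ μ = 1

/-- The dyadic pieces: `η_0 = η₀` and `η_k(μ) = η₀(μ/2^k) - η₀(μ/2^(k-1))` for `k ≥ 1`. -/
def eta (η₀ : ℝ → ℝ) : ℕ → ℝ → ℝ
  | 0, μ => η₀ μ
  | k + 1, μ => η₀ (μ / 2 ^ (k + 1)) - η₀ (μ / 2 ^ k)

/-- `χ_{k,l}(r) = 1 - η₀(r/2^(k-l))` if `k ≥ 100`, and `χ_{k,l} = 1` if `k ≤ 99`. -/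
def chi (η₀ : ℝ → ℝ) (k l : ℕ) (r : ℝ) : ℝ :=
  if 100 ≤ k then 1 - η₀ (r / (2 : ℝ) ^ ((k : ℤ) - (l : ℤ))) else 1

/-- The spatial frequency annulus `|ξ| ∈ [2^(k-1), 2^(k+1)]`, and the disc `|ξ| ≤ 2` for `k = 0`. -/
def annulus : ℕ → Set Plane
  | 0 => {ξ | ‖ξ‖ ≤ 2}
  | k + 1 => {ξ | ‖ξ‖ ∈ Set.Icc ((2 : ℝ) ^ k) (2 ^ (k + 2))}

/-- The set `D_{k,j}`. -/
def setD (k j : ℕ) : Set SpaceTime :=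
  {z | space z ∈ annulus k ∧ |symbolP z| ≤ 2 ^ (j + 1)}

/-- `D_{k,∞} = ⋃_j D_{k,j}`. -/
def setDInf (k : ℕ) : Set SpaceTime := ⋃ j, setD k j

/-- `D_{k,∞}^e`: the points of `D_{k,∞}` with `|ξ · ē| ≥ |ξ|/2`. -/
def setDInfDir (k : ℕ) (e : Plane) : Set SpaceTime :=
  {z | z ∈ setDInf k ∧ ‖space z‖ / 2 ≤ |inner ℝ (space z) (conjVec e)|}

/-- The inverse space-time Fourier transform on `L²`, normalised as
`𝓕⁻¹ f (x, t) = (2π)⁻³ ∫ exp (i (x·ξ + t τ)) f (ξ, τ) dξ dτ` (Mathlib's `𝓕⁻` has the phase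
`2 π i`, which accounts for the dilation). It is set to `0` off `L²`. -/
def invFourier (f : SpaceTime → ℂ) : SpaceTime → ℂ :=
  open Classical in
  if hf : MemLp f 2 volume then
    fun x => (((2 * Real.pi) ^ 3)⁻¹ : ℝ) • (𝓕⁻ (hf.toLp f)) ((2 * Real.pi)⁻¹ • x)
  else 0

/-- The point `(r e + v e^⊥, t)` of space-time, where `e^⊥ = (-e₂, e₁)`. -/
def framePoint (e : Plane) (r v t : ℝ) : SpaceTime :=
  !₂[r * e 0 - v * e 1, r * e 1 + v * e 0, t]

/-- The norm of `L^{p,q}_e`: the `L^q` norm in `(v, t)`, then the `L^p` norm in `r`,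
of `F (r e + v e^⊥, t)`. -/
def mixedNorm (p q : ℝ≥0∞) (e : Plane) (F : SpaceTime → ℂ) : ℝ≥0∞ :=
  eLpNorm (fun r : ℝ =>
    eLpNorm (fun w : ℝ × ℝ => F (framePoint e r w.1 w.2)) q volume) p volume

/-- The norm of `X_k`. -/
def xNorm (η₀ : ℝ → ℝ) (f : SpaceTime → ℂ) : ℝ≥0∞ :=
  ∑' j : ℕ, ENNReal.ofReal ((2 : ℝ) ^ ((j : ℝ) / 2)) *
    eLpNorm (fun z => (eta η₀ j (symbolP z) : ℂ) * f z) 2 volume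

/-- Membership in `X_k`. -/
structure MemX (η₀ : ℝ → ℝ) (k : ℕ) (f : SpaceTime → ℂ) : Prop where
  memLp : MemLp f 2 volume
  supp : ∀ᵐ z, z ∉ setDInf k → f z = 0
  norm_lt_top : xNorm η₀ f < ⊤

/-- The function `(P + i) f`. -/
def mulP (f : SpaceTime → ℂ) : SpaceTime → ℂ :=
  fun z => ((symbolP z : ℂ) + Complex.I) * f z

/-- The norm of `Y_k^e`. -/
def yNorm (k : ℕ) (e : Plane) (f : SpaceTime → ℂ) : ℝ≥0∞ :=
  ENNReal.ofReal ((2 : ℝ) ^ (-(k : ℝ) / 2)) * mixedNorm 1 2 e (invFourier (mulP f))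

/-- Membership in `Y_k^e`; the space is `{0}` for `k ≤ 99`. The space `L^{1,2}_e` consists of
`L²` functions, so `𝓕⁻¹[(P + i) f] ∈ L^{1,2}_e` includes `(P + i) f ∈ L²`. -/
structure MemY (k : ℕ) (e : Plane) (f : SpaceTime → ℂ) : Prop where
  memLp : MemLp f 2 volume
  supp : ∀ᵐ z, z ∉ setDInfDir k e → f z = 0
  memLp_mulP : MemLp (mulP f) 2 volume
  norm_lt_top : yNorm k e f < ⊤
  eq_zero : k < 100 → f =ᵐ[volume] 0

/-- The fixed finite family of directions: distinct unit vectors, a `2^(-50)`-net of the circle,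
symmetric under `e ↦ -e`. -/
structure IsDirectionFamily {L : ℕ} (e : Fin L → Plane) : Prop where
  unit : ∀ l, e l ∈ Metric.sphere (0 : Plane) 1
  injective : Function.Injective e
  net : ∀ v ∈ Metric.sphere (0 : Plane) 1, ∃ l, ‖e l - v‖ ≤ ((2 : ℝ) ^ 50)⁻¹
  neg_mem : ∀ l, ∃ l', e l' = -e l

/-- `f = g + h_1 + ... + h_L` with `g ∈ X_k` and `h_l ∈ Y_k^{e_l}`. -/
structure IsDecomp (η₀ : ℝ → ℝ) {L : ℕ} (e : Fin L → Plane) (k : ℕ) (f : SpaceTime → ℂ)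
    (g : SpaceTime → ℂ) (h : Fin L → SpaceTime → ℂ) : Prop where
  memX : MemX η₀ k g
  memY : ∀ l, MemY k (e l) (h l)
  eq : f =ᵐ[volume] fun z => g z + ∑ l, h l z

/-- Membership in `Z_k = X_k + Y_k^{e_1} + ... + Y_k^{e_L}`. -/
def MemZ (η₀ : ℝ → ℝ) {L : ℕ} (e : Fin L → Plane) (k : ℕ) (f : SpaceTime → ℂ) : Prop :=
  ∃ g h, IsDecomp η₀ e k f g h

/-- The norm of the sum space `Z_k`: the infimum of
`‖g‖_{X_k} + ‖h_1‖_{Y_k^{e_1}} + ... + ‖h_L‖_{Y_k^{e_L}}` over all decompositions. -/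
def zNorm (η₀ : ℝ → ℝ) {L : ℕ} (e : Fin L → Plane) (k : ℕ) (f : SpaceTime → ℂ) : ℝ≥0∞ :=
  ⨅ (g : SpaceTime → ℂ) (h : Fin L → SpaceTime → ℂ) (_ : IsDecomp η₀ e k f g h),
    xNorm η₀ g + ∑ l, yNorm k (e l) (h l)

end LocalSmoothing

end

/-! By duality it suffices to bound the pairing of `f χ` with the transform of a test function `Ψ`
by `2^(-k/2) ‖f‖_{Z_k} ‖Ψ‖_{L^{1,2}_{e'}}` (`mixedNorm_top_le_of_pairing`). On each line parallel to
`e'` the transform of `Ψ` is bounded by a number that does not depend on the position on the line.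
By Minkowski and Plancherel, these numbers have `L²` norm at most `‖Ψ‖_{L^{1,2}_{e'}}`
(`eLpNorm_majorant_le`).

For `X_k` with `k ≥ 100`: along such a line `P` is a polynomial of degree at most two with
derivative `2 ξ·ē'`, and `χ` keeps only `|ξ·ē'| ≳ 2^k`. The set `|P| ≤ 2^(j+1)` therefore meets the
line in length `O(2^(j-k))`. Cauchy-Schwarz on each dyadic piece and summation over `j` finish the
argument (`lintegral_memX_le`). For `k ≤ 99` the spatial frequencies are bounded and a ball replaces
the level sets.

For `h ∈ Y_k^e`, let `G` be the inverse transform of `(P+i)h`. The pairing is then a bilinear form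
in `G` and `Ψ` with multiplier `χ/(P+i)`. It must be `O(2^(-k))`, since half of this gain is already
in the norm of `Y_k^e`. On the support of `h`, `|ξ·ē| ≳ 2^k`, so along lines parallel to `e` the
multiplier is a sum over the two branches of roots of terms `A(y)/(s - M(y) + i 2^(-k))`. The error
is `O(2^(-2k))`, plus `O(1/(1+P²))` where `|ξ·ē'| ≳ 2^k` (`norm_sub_principal_le`), and
Cauchy-Schwarz with the majorants in the two directions absorbs it (`lintegral_errorMult_le`).

The resolvent `1/(s - M + iε)` is the transform of a damped half-line. The principal term thus
becomes a superposition over `r₀` of the slice of `G` at `x·e = r₀`, paired with the trace on `P =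
0` of the transform of `Ψ` cut off to `x·e < r₀`. The cut-off is a multiplication by a function
bounded by one, so it is harmless in `L^{1,2}_{e'}` even when `e ≠ e'`. The trace is controlled by
two changes of variables through the surface `P = 0`, with Jacobians `2|ξ·ē|` and `1/(2|ξ·ē'|)`
(`enorm_integral_mainMult_le`).

The cutoff is necessary: for `e' = (1,0)`, take the indicator of `|ξ₁| ≤ 1/2` times a tiny disc
around `(ξ₂,τ) = (2^k, 4^k)`. There both `P` and `ξ·ē'` are `O(1)`. The `X_k` norm equals the `L²`
norm of the disc and the left side is a fixed multiple of it, so nothing is gained as `k` grows. -/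

namespace LocalSmoothing

/-! ### The `L²` Fourier transform, Plancherel and Parseval. -/

section FourierL2

variable {V : Type*} [NormedAddCommGroup V] [InnerProductSpace ℝ V] [FiniteDimensional ℝ V]
  [MeasurableSpace V] [BorelSpace V]

/-- The Fourier integral of an integrable function is continuous. -/
theorem continuous_fourier_of_integrable {f : V → ℂ} (hf : Integrable f) : Continuous (𝓕 f) :=
  VectorFourier.fourierIntegral_continuous Real.continuous_fourierChar
    (by exact continuous_inner) hf

/-- On `L¹ ∩ L²` the `L²` Fourier transform is given by the Fourier integral. -/
theorem coeFn_fourier_toLp {f : V → ℂ} (hf : Integrable f) (hf2 : MemLp f 2 volume) :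
    (𝓕 (hf2.toLp f) : Lp ℂ 2 (volume : Measure V)) =ᵐ[volume] 𝓕 f := by
  refine ae_eq_of_integral_contDiff_smul_eq (μ := volume) ?_
    (continuous_fourier_of_integrable hf).locallyIntegrable ?_
  · exact (Lp.memLp _).locallyIntegrable (by norm_num)
  intro g hg hgc
  have hgc' : HasCompactSupport (fun x => (g x : ℂ)) := hgc.comp_left (g := Complex.ofReal) rfl
  have hg' : ContDiff ℝ ∞ (fun x => (g x : ℂ)) := Complex.ofRealCLM.contDiff.comp hg
  set φ := hgc'.toSchwartzMap hg' with hφ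
  have hφx : ∀ x, φ x = g x := fun x => rfl
  -- As a tempered distribution the `L²` transform moves the transform onto the test function; the
  -- Fourier integral does the same by self-adjointness (`h2`).
  have h1 := congrArg (fun T => T φ) (Lp.fourier_toTemperedDistribution_eq (hf2.toLp f))
  simp only [TemperedDistribution.fourier_apply, Lp.toTemperedDistribution_apply] at h1
  have h2 : ∫ x, g x • (𝓕 f) x = ∫ x, (𝓕 φ) x • f x := by
    have := VectorFourier.integral_fourierIntegral_smul_eq_flip (L := innerₗ V)
      (μ := volume) (ν := volume) (f := fun x => φ x) (g := f)
      Real.continuous_fourierChar continuous_inner φ.integrable hf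
    rw [flip_innerₗ] at this
    have h3 : ∀ x, (𝓕 φ) x = VectorFourier.fourierIntegral Real.fourierChar volume (innerₗ V)
      (fun x => φ x) x := fun x => by rw [SchwartzMap.fourier_coe]; rfl
    simp_rw [h3, this, hφx]
    simp [Real.fourier_eq, VectorFourier.fourierIntegral]
  have h4 : ∫ x, (𝓕 φ) x • (hf2.toLp f) x = ∫ x, (𝓕 φ) x • f x :=
    integral_congr_ae (by filter_upwards [hf2.coeFn_toLp] with x hx; rw [hx])
  rw [h2, ← h4, h1]
  simp [hφx]

theorem memLp_fourier {f : V → ℂ} (hf : Integrable f) (hf2 : MemLp f 2 volume) :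
    MemLp (𝓕 f) 2 volume :=
  (memLp_congr_ae (coeFn_fourier_toLp hf hf2)).1 (Lp.memLp _)

/-- Plancherel's identity for `L¹ ∩ L²`. -/
theorem eLpNorm_fourier {f : V → ℂ} (hf : Integrable f) (hf2 : MemLp f 2 volume) :
    eLpNorm (𝓕 f) 2 volume = eLpNorm f 2 volume := by
  have h := Lp.norm_fourier_eq (hf2.toLp f)
  rw [← eLpNorm_congr_ae (coeFn_fourier_toLp hf hf2), ← eLpNorm_congr_ae hf2.coeFn_toLp]
  rw [Lp.norm_def, Lp.norm_def] at h
  exact (ENNReal.toReal_eq_toReal_iff' (Lp.eLpNorm_ne_top _) (Lp.eLpNorm_ne_top _)).1 h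

/-- Parseval's identity: the `L²` inverse transform paired with a function in `L¹ ∩ L²`. -/
theorem integral_fourierInv_mul_conj {f g : V → ℂ} (hf2 : MemLp f 2 volume)
    (hg : Integrable g) (hg2 : MemLp g 2 volume) :
    ∫ x, (𝓕⁻ (hf2.toLp f) : Lp ℂ 2 (volume : Measure V)) x * (starRingEnd ℂ) (g x) =
      ∫ x, f x * (starRingEnd ℂ) (𝓕 g x) := by
  have h := Lp.inner_fourier_eq (hg2.toLp g) (𝓕⁻ (hf2.toLp f))
  rw [FourierTransform.fourier_fourierInv_eq, L2.inner_def, L2.inner_def] at h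
  have h1 : ∫ x, inner ℂ ((hg2.toLp g) x) ((𝓕⁻ (hf2.toLp f) : Lp ℂ 2 (volume : Measure V)) x) =
      ∫ x, (𝓕⁻ (hf2.toLp f) : Lp ℂ 2 (volume : Measure V)) x * (starRingEnd ℂ) (g x) := by
    refine integral_congr_ae ?_
    filter_upwards [hg2.coeFn_toLp] with x hx
    rw [hx]; simp
  rw [← h1, ← h]
  refine integral_congr_ae ?_
  filter_upwards [coeFn_fourier_toLp hg hg2, hf2.coeFn_toLp] with x hx hx'
  rw [hx, hx']; simp

/-- Parseval's identity for `L¹ ∩ L²`. -/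
theorem integral_fourier_mul_conj_fourier {f g : V → ℂ} (hf : Integrable f)
    (hf2 : MemLp f 2 volume) (hg : Integrable g) (hg2 : MemLp g 2 volume) :
    ∫ x, 𝓕 f x * (starRingEnd ℂ) (𝓕 g x) = ∫ x, f x * (starRingEnd ℂ) (g x) := by
  have h := Lp.inner_fourier_eq (hg2.toLp g) (hf2.toLp f)
  rw [L2.inner_def, L2.inner_def] at h
  have h1 : ∫ x, inner ℂ ((hg2.toLp g) x) ((hf2.toLp f) x) =
      ∫ x, f x * (starRingEnd ℂ) (g x) := by
    refine integral_congr_ae ?_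
    filter_upwards [hg2.coeFn_toLp, hf2.coeFn_toLp] with x hx hx'
    rw [hx, hx']; simp
  rw [← h1, ← h]
  refine integral_congr_ae ?_
  filter_upwards [coeFn_fourier_toLp hg hg2, coeFn_fourier_toLp hf hf2] with x hx hx'
  rw [hx, hx']; simp

end FourierL2

end LocalSmoothing

namespace LocalSmoothing

/-! ### Cauchy-Schwarz and Minkowski for nonnegative functions. -/

section Auxiliary

variable {α β : Type*} [MeasurableSpace α] [MeasurableSpace β] {μ : Measure α} {ν : Measure β}

theorem eLpNorm_two_sq {E : Type*} [TopologicalSpace E] [ContinuousENorm E] (f : α → E) :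
    eLpNorm f 2 μ ^ 2 = ∫⁻ x, ‖f x‖ₑ ^ 2 ∂μ := by
  have h := eLpNorm_nnreal_pow_eq_lintegral (μ := μ) (f := f) (p := 2) (by norm_num)
  simpa using h

/-- The Cauchy-Schwarz inequality. -/
theorem lintegral_mul_le_eLpNorm_mul_eLpNorm {f g : α → ℝ≥0∞} (hf : AEMeasurable f μ)
    (hg : AEMeasurable g μ) :
    ∫⁻ x, f x * g x ∂μ ≤ eLpNorm f 2 μ * eLpNorm g 2 μ := by
  have h := ENNReal.lintegral_mul_le_Lp_mul_Lq μ (p := 2) (q := 2) Real.HolderConjugate.two_two hf hg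
  refine h.trans (le_of_eq ?_)
  rw [eLpNorm_eq_lintegral_rpow_enorm_toReal (by norm_num) (by norm_num),
    eLpNorm_eq_lintegral_rpow_enorm_toReal (by norm_num) (by norm_num)]
  simp

/-- Minkowski's integral inequality in `L²`. -/
theorem eLpNorm_lintegral_le [SFinite μ] [SFinite ν] {f : α → β → ℝ≥0∞}
    (hf : Measurable (Function.uncurry f)) :
    eLpNorm (fun y => ∫⁻ x, f x y ∂μ) 2 ν ≤ ∫⁻ x, eLpNorm (f x) 2 ν ∂μ := by
  have hfx : ∀ x, Measurable (f x) := fun x => hf.comp measurable_prodMk_left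
  have hfy : ∀ y, Measurable (fun x => f x y) := fun y => hf.comp measurable_prodMk_right
  have hm : Measurable (fun x => eLpNorm (f x) 2 ν) := by
    simp_rw [eLpNorm_eq_lintegral_rpow_enorm_toReal (p := 2) (by norm_num) (by norm_num)]
    simp only [enorm_eq_self]
    exact (Measurable.lintegral_prod_right' (f := fun p : α × β => f p.1 p.2 ^ _)
      (hf.pow_const _)).pow_const _
  have h3 : Measurable (fun p : (α × α) × β => f p.1.1 p.2 * f p.1.2 p.2) :=
    (hf.comp (f := fun p : (α × α) × β => (p.1.1, p.2)) (by fun_prop)).mul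
      (hf.comp (f := fun p : (α × α) × β => (p.1.2, p.2)) (by fun_prop))
  rw [← ENNReal.pow_le_pow_left_iff (n := 2) (by norm_num), eLpNorm_two_sq]
  -- The square is a double integral over pairs of points `x`; Cauchy-Schwarz in `y` for each pair
  -- makes it factor again.
  calc ∫⁻ y, ‖∫⁻ x, f x y ∂μ‖ₑ ^ 2 ∂ν
      = ∫⁻ y, ∫⁻ p : α × α, f p.1 y * f p.2 y ∂(μ.prod μ) ∂ν := by
        refine lintegral_congr fun y => ?_
        rw [lintegral_prod_mul (hfy y).aemeasurable (hfy y).aemeasurable, enorm_eq_self, sq]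
    _ = ∫⁻ p : α × α, ∫⁻ y, f p.1 y * f p.2 y ∂ν ∂(μ.prod μ) := by
        rw [lintegral_lintegral_swap]
        exact (h3.comp measurable_swap).aemeasurable
    _ ≤ ∫⁻ p : α × α, eLpNorm (f p.1) 2 ν * eLpNorm (f p.2) 2 ν ∂(μ.prod μ) :=
        lintegral_mono fun p => lintegral_mul_le_eLpNorm_mul_eLpNorm
          (hfx _).aemeasurable (hfx _).aemeasurable
    _ = (∫⁻ x, eLpNorm (f x) 2 ν ∂μ) ^ 2 := by
        rw [lintegral_prod_mul hm.aemeasurable hm.aemeasurable, sq]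

end Auxiliary

/-! ### Rotated coordinates, slices, and the majorant of the Fourier transform on lines. -/

section Frame

/-- The point of space-time with coordinates `(r, y)` in the frame of `e`. -/
noncomputable def frame (e : Plane) (p : ℝ × Plane) : SpaceTime := framePoint e p.1 (p.2 0) (p.2 1)

theorem sq_add_sq_of_mem_sphere {e : Plane} (he : e ∈ Metric.sphere (0 : Plane) 1) :
    e 0 ^ 2 + e 1 ^ 2 = 1 := by
  have h : ‖e‖ = 1 := by simpa using he
  have h2 := EuclideanSpace.norm_sq_eq e
  simpa [h] using h2.symm

/-- The rotation of space-time that takes the coordinate frame to the frame of `e`. -/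
noncomputable def rotation (e : Plane) (he : e ∈ Metric.sphere (0 : Plane) 1) : SpaceTime ≃ₗᵢ[ℝ] SpaceTime :=
  LinearIsometry.toLinearIsometryEquiv
    { toFun := fun z => framePoint e (z 0) (z 1) (z 2)
      map_add' := fun x y => by
        ext i; fin_cases i <;> simp [framePoint] <;> ring
      map_smul' := fun c x => by
        ext i; fin_cases i <;> simp [framePoint] <;> ring
      norm_map' := fun x => by
        have h := sq_add_sq_of_mem_sphere he
        rw [EuclideanSpace.norm_eq, EuclideanSpace.norm_eq]
        congr 1
        simp only [framePoint, Fin.sum_univ_three, Real.norm_eq_abs, sq_abs, LinearMap.coe_mk,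
          AddHom.coe_mk]
        simp
        linear_combination (x 0 ^ 2 + x 1 ^ 2) * h } rfl

/-- The frame of `e` as a measurable equivalence. -/
noncomputable def frameEquiv (e : Plane) (he : e ∈ Metric.sphere (0 : Plane) 1) : (ℝ × Plane) ≃ᵐ SpaceTime :=
  (((MeasurableEquiv.refl ℝ).prodCongr (MeasurableEquiv.toLp 2 (Fin 2 → ℝ)).symm).trans
    (MeasurableEquiv.piFinSuccAbove (fun _ : Fin 3 => ℝ) 0).symm).trans
    ((MeasurableEquiv.toLp 2 (Fin 3 → ℝ)).trans
      (rotation e he).toHomeomorph.toMeasurableEquiv)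

theorem coe_frameEquiv (e : Plane) (he : e ∈ Metric.sphere (0 : Plane) 1) :
    ⇑(frameEquiv e he) = frame e := by
  ext p : 1
  rfl

theorem measurePreserving_frameEquiv (e : Plane) (he : e ∈ Metric.sphere (0 : Plane) 1) :
    MeasurePreserving (frameEquiv e he) volume volume := by
  have h1 : MeasurePreserving (((MeasurableEquiv.refl ℝ).prodCongr
      (MeasurableEquiv.toLp 2 (Fin 2 → ℝ)).symm)) (volume : Measure (ℝ × Plane)) volume :=
    (MeasurePreserving.id volume).prod (PiLp.volume_preserving_ofLp (Fin 2))
  have h2 := (volume_preserving_piFinSuccAbove (fun _ : Fin 3 => ℝ) 0).symm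
  exact (rotation e he).measurePreserving.comp
    ((PiLp.volume_preserving_toLp (Fin 3)).comp (h2.comp h1))

theorem measurePreserving_frame {e : Plane} (he : e ∈ Metric.sphere (0 : Plane) 1) :
    MeasurePreserving (frame e) volume volume := by
  rw [← coe_frameEquiv e he]; exact measurePreserving_frameEquiv e he

theorem continuous_frame (e : Plane) : Continuous (frame e) := by
  unfold frame framePoint
  fun_prop

theorem measurableEmbedding_frame {e : Plane} (he : e ∈ Metric.sphere (0 : Plane) 1) :
    MeasurableEmbedding (frame e) := by
  rw [← coe_frameEquiv e he]; exact (frameEquiv e he).measurableEmbedding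

theorem lintegral_frame {e : Plane} (he : e ∈ Metric.sphere (0 : Plane) 1) (g : SpaceTime → ℝ≥0∞) :
    ∫⁻ z, g z = ∫⁻ p : ℝ × Plane, g (frame e p) :=
  ((measurePreserving_frame he).lintegral_comp_emb (measurableEmbedding_frame he) g).symm

theorem inner_frame_frame {e : Plane} (he : e ∈ Metric.sphere (0 : Plane) 1) (p q : ℝ × Plane) :
    inner ℝ (frame e p) (frame e q) = p.1 * q.1 + inner ℝ p.2 q.2 := by
  have h := sq_add_sq_of_mem_sphere he
  simp [frame, framePoint, PiLp.inner_apply, Fin.sum_univ_three, Fin.sum_univ_two]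
  linear_combination (p.1 * q.1 + p.2 0 * q.2 0) * h

/-- The restriction of `F` to the plane `x · e = r`. -/
noncomputable def slice (e : Plane) (F : SpaceTime → ℂ) (r : ℝ) : Plane → ℂ := fun y => F (frame e (r, y))

/-- Trades the product `ℝ × ℝ` for the Euclidean plane, an inner product space, where the Fourier
transform of a slice makes sense. -/
theorem eLpNorm_framePoint (e : Plane) (F : SpaceTime → ℂ) (r : ℝ) (q : ℝ≥0∞) :
    eLpNorm (fun w : ℝ × ℝ => F (framePoint e r w.1 w.2)) q volume =
      eLpNorm (slice e F r) q volume := by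
  let E : Plane ≃ᵐ ℝ × ℝ := (MeasurableEquiv.toLp 2 (Fin 2 → ℝ)).symm.trans
    MeasurableEquiv.finTwoArrow
  have hE : MeasurePreserving E volume volume :=
    (PiLp.volume_preserving_ofLp (Fin 2)).trans (volume_preserving_finTwoArrow ℝ)
  have h : slice e F r = (fun w : ℝ × ℝ => F (framePoint e r w.1 w.2)) ∘ E := rfl
  rw [h, ← hE.map_eq, E.measurableEmbedding.eLpNorm_map_measure]

theorem mixedNorm_one (e : Plane) (F : SpaceTime → ℂ) :
    mixedNorm 1 2 e F = ∫⁻ r, eLpNorm (slice e F r) 2 volume := by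
  simp only [mixedNorm, eLpNorm_framePoint, eLpNorm_one_eq_lintegral_enorm, enorm_eq_self]

theorem mixedNorm_top (e : Plane) (F : SpaceTime → ℂ) :
    mixedNorm ⊤ 2 e F = essSup (fun r => eLpNorm (slice e F r) 2 volume) volume := by
  simp only [mixedNorm, eLpNorm_framePoint, eLpNorm_exponent_top, eLpNormEssSup_eq_essSup_enorm,
    enorm_eq_self]

theorem mixedNorm_mono {p : ℝ≥0∞} (e : Plane) {F G : SpaceTime → ℂ} (h : ∀ z, ‖F z‖ₑ ≤ ‖G z‖ₑ) :
    mixedNorm p 2 e F ≤ mixedNorm p 2 e G := by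
  refine eLpNorm_mono_enorm fun r => ?_
  simp only [enorm_eq_self]
  exact eLpNorm_mono_enorm fun w => h _

/-- Measurable functions in `L¹ ∩ L²`. -/
structure IsNice (F : SpaceTime → ℂ) : Prop where
  meas : StronglyMeasurable F
  int : Integrable F
  memLp : MemLp F 2 volume

variable {e : Plane} {F : SpaceTime → ℂ}

theorem stronglyMeasurable_fourier_slice (hF : StronglyMeasurable F) :
    StronglyMeasurable (fun p : ℝ × Plane => 𝓕 (slice e F p.1) p.2) := by
  have h : StronglyMeasurable (fun q : (ℝ × Plane) × Plane =>
      Real.fourierChar (-inner ℝ q.2 q.1.2) • F (frame e (q.1.1, q.2))) := by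
    refine StronglyMeasurable.smul ?_ ?_
    · have hc : Continuous (fun q : (ℝ × Plane) × Plane => -inner ℝ q.2 q.1.2) := by fun_prop
      exact (continuous_subtype_val.comp (Real.continuous_fourierChar.comp hc)).stronglyMeasurable
    · exact hF.comp_measurable ((continuous_frame e).comp (by fun_prop)).measurable
  simpa only [Real.fourier_eq, slice] using h.integral_prod_right

theorem integrable_frame (he : e ∈ Metric.sphere (0 : Plane) 1) (hF : Integrable F) :
    Integrable (fun p : ℝ × Plane => F (frame e p)) :=
  (measurePreserving_frame he).integrable_comp_of_integrable hF

theorem ae_integrable_slice (he : e ∈ Metric.sphere (0 : Plane) 1) (hF : Integrable F) :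
    ∀ᵐ r, Integrable (slice e F r) :=
  (integrable_frame he hF).prod_right_ae

theorem eLpNorm_sq_eq_lintegral_slice (he : e ∈ Metric.sphere (0 : Plane) 1)
    (hF : StronglyMeasurable F) :
    eLpNorm F 2 volume ^ 2 = ∫⁻ r, eLpNorm (slice e F r) 2 volume ^ 2 := by
  simp_rw [eLpNorm_two_sq]
  rw [lintegral_frame he, Measure.volume_eq_prod, lintegral_prod]
  · rfl
  · exact ((hF.comp_measurable (continuous_frame e).measurable).enorm.pow_const _).aemeasurable

theorem measurable_eLpNorm_slice (hF : StronglyMeasurable F) :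
    Measurable (fun r => eLpNorm (slice e F r) 2 volume) := by
  simp_rw [eLpNorm_eq_lintegral_rpow_enorm_toReal (p := 2) (by norm_num) (by norm_num)]
  exact (Measurable.lintegral_prod_right' (f := fun p : ℝ × Plane => ‖F (frame e p)‖ₑ ^ _)
    ((hF.comp_measurable (continuous_frame e).measurable).enorm.pow_const _)).pow_const _

theorem ae_eLpNorm_slice_lt_top (he : e ∈ Metric.sphere (0 : Plane) 1)
    (hF : StronglyMeasurable F) (hF2 : MemLp F 2 volume) :
    ∀ᵐ r, eLpNorm (slice e F r) 2 volume < ⊤ := by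
  have h := eLpNorm_sq_eq_lintegral_slice he hF
  have h2 : ∫⁻ r, eLpNorm (slice e F r) 2 volume ^ 2 ≠ ⊤ := by
    rw [← h]; exact ENNReal.pow_ne_top hF2.2.ne
  filter_upwards [ae_lt_top ((measurable_eLpNorm_slice hF).pow_const 2) h2] with r hr
  by_contra hcon
  rw [not_lt, top_le_iff] at hcon
  simp [hcon] at hr

theorem stronglyMeasurable_slice (hF : StronglyMeasurable F) (r : ℝ) :
    StronglyMeasurable (slice e F r) :=
  hF.comp_measurable ((continuous_frame e).comp (by fun_prop)).measurable

theorem IsNice.ae_memLp_slice (hF : IsNice F) (he : e ∈ Metric.sphere (0 : Plane) 1) :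
    ∀ᵐ r, MemLp (slice e F r) 2 volume := by
  filter_upwards [ae_eLpNorm_slice_lt_top he hF.meas hF.memLp] with r hr
  exact ⟨(stronglyMeasurable_slice hF.meas r).aestronglyMeasurable, hr⟩

theorem IsNice.ae_eLpNorm_fourier_slice (hF : IsNice F) (he : e ∈ Metric.sphere (0 : Plane) 1) :
    ∀ᵐ r, eLpNorm (𝓕 (slice e F r)) 2 volume = eLpNorm (slice e F r) 2 volume := by
  filter_upwards [hF.ae_memLp_slice he, ae_integrable_slice he hF.int] with r hr hr'
  exact eLpNorm_fourier hr' hr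

/-- The Fourier transform in the frame of `e`, computed by transforming first along the slices. -/
theorem fourier_frame (he : e ∈ Metric.sphere (0 : Plane) 1) (hF : Integrable F) (ξ : ℝ)
    (η : Plane) : 𝓕 F (frame e (ξ, η)) = 𝓕 (fun r => 𝓕 (slice e F r) η) ξ := by
  have hint : Integrable (fun z : SpaceTime => Real.fourierChar (-inner ℝ z (frame e (ξ, η))) • F z) :=
    (Real.fourierIntegral_convergent_iff _).2 hF
  rw [Real.fourier_eq, Real.fourier_eq,
    ← (measurePreserving_frame he).integral_comp (measurableEmbedding_frame he),
    Measure.volume_eq_prod, integral_prod _ (integrable_frame he hint)]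
  refine integral_congr_ae (Filter.Eventually.of_forall fun r => ?_)
  simp only [Real.fourier_eq, Circle.smul_def, smul_eq_mul]
  rw [← integral_const_mul]
  refine integral_congr_ae (Filter.Eventually.of_forall fun y => ?_)
  simp only [inner_frame_frame he, slice, ← mul_assoc, neg_add, AddChar.map_add_eq_mul,
    Circle.coe_mul]
  simp [mul_comm]

/-- The majorant of the Fourier transform of `F` along the lines parallel to `e`. -/
noncomputable def majorant (e : Plane) (F : SpaceTime → ℂ) (y : Plane) : ℝ≥0∞ :=
  ∫⁻ r, ‖𝓕 (slice e F r) y‖ₑ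

theorem measurable_majorant (hF : StronglyMeasurable F) : Measurable (majorant e F) :=
  Measurable.lintegral_prod_left' (f := fun p : ℝ × Plane => ‖𝓕 (slice e F p.1) p.2‖ₑ)
    (stronglyMeasurable_fourier_slice hF).enorm

/-- Taking absolute values inside the outer integral of `fourier_frame` removes the dependence on
`ξ`. Every level set estimate below rests on this uniformity. -/
theorem enorm_fourier_frame_le (he : e ∈ Metric.sphere (0 : Plane) 1) (hF : Integrable F) (ξ : ℝ)
    (η : Plane) : ‖𝓕 F (frame e (ξ, η))‖ₑ ≤ majorant e F η := by
  rw [fourier_frame he hF, Real.fourier_eq]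
  refine (enorm_integral_le_lintegral_enorm _).trans (le_of_eq ?_)
  refine lintegral_congr fun r => ?_
  rw [← ofReal_norm, Circle.norm_smul, ofReal_norm]

/-- Minkowski moves the `L²` norm inside the integral over `r`; Plancherel then acts on almost every
slice. -/
theorem eLpNorm_majorant_le (he : e ∈ Metric.sphere (0 : Plane) 1) (hF : IsNice F) :
    eLpNorm (majorant e F) 2 volume ≤ mixedNorm 1 2 e F := by
  refine (eLpNorm_lintegral_le (f := fun r y => ‖𝓕 (slice e F r) y‖ₑ)
    (stronglyMeasurable_fourier_slice hF.meas).enorm).trans (le_of_eq ?_)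
  rw [mixedNorm_one]
  refine lintegral_congr_ae ?_
  filter_upwards [hF.ae_eLpNorm_fourier_slice he] with r hr
  rw [← hr]
  exact eLpNorm_enorm _

end Frame

end LocalSmoothing

namespace LocalSmoothing

/-! ### Duality between `L^{∞,2}_e` and `L^{1,2}_e`. -/

section Duality

variable {e : Plane} {H : SpaceTime → ℂ}

theorem enorm_integral_mul_conj_indicator {T : Set SpaceTime} (hT : MeasurableSet T)
    (hH2 : MemLp H 2 volume) :
    ‖∫ z, H z * (starRingEnd ℂ) (T.indicator H z)‖ₑ = eLpNorm (T.indicator H) 2 volume ^ 2 := by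
  have h1 : ∀ z, H z * (starRingEnd ℂ) (T.indicator H z) = ((‖T.indicator H z‖ ^ 2 : ℝ) : ℂ) := by
    intro z
    by_cases hz : z ∈ T
    · simp [hz, Complex.mul_conj, Complex.normSq_eq_norm_sq]
    · simp [hz]
  simp_rw [h1]
  rw [eLpNorm_two_sq]
  have h2 : Integrable (fun z => ‖T.indicator H z‖ ^ 2) := (hH2.indicator hT).norm.integrable_sq
  have h3 : 0 ≤ ∫ z, ‖T.indicator H z‖ ^ 2 := integral_nonneg fun z => by positivity
  rw [integral_complex_ofReal, ← ofReal_norm, Complex.norm_real, Real.norm_of_nonneg h3,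
    ofReal_integral_eq_lintegral_ofReal h2 (Filter.Eventually.of_forall fun z => by positivity)]
  refine lintegral_congr fun z => ?_
  rw [ENNReal.ofReal_pow (norm_nonneg _), ofReal_norm]

/-- The norm of `L^{∞,2}_e` is controlled by the pairing with `L^{1,2}_e`. -/
theorem mixedNorm_top_le_of_pairing (he : e ∈ Metric.sphere (0 : Plane) 1)
    (hH : StronglyMeasurable H) (hH2 : MemLp H 2 volume) {C : ℝ≥0∞}
    (h : ∀ Ψ, IsNice Ψ → ‖∫ z, H z * (starRingEnd ℂ) (Ψ z)‖ₑ ≤ C * mixedNorm 1 2 e Ψ) :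
    mixedNorm ⊤ 2 e H ≤ C := by
  have hball : ∀ n : ℕ, MeasurableSet (Metric.closedBall (0 : Plane) n) := fun n =>
    Metric.isClosed_closedBall.measurableSet
  have key : ∀ n : ℕ, ∀ᵐ r : ℝ, |r| ≤ n →
      eLpNorm ((Metric.closedBall (0 : Plane) n).indicator (slice e H r)) 2 volume ≤ C := by
    intro n
    set B := Metric.closedBall (0 : Plane) n with hB
    let N : ℝ → ℝ≥0∞ := fun r => eLpNorm (B.indicator (slice e H r)) 2 volume
    have hN : Measurable N := by
      have : ∀ r, N r = (∫⁻ y, B.indicator (fun y => ‖H (frame e (r, y))‖ₑ ^ (2 : ℝ)) y) ^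
          (1 / 2 : ℝ) := by
        intro r
        simp only [N]
        rw [eLpNorm_eq_lintegral_rpow_enorm_toReal (by norm_num) (by norm_num)]
        congr 1
        · refine lintegral_congr fun y => ?_
          by_cases hy : y ∈ B <;> simp [hy, slice]
      simp_rw [funext this, lintegral_indicator (show MeasurableSet B from hball n)]
      exact (Measurable.lintegral_prod_right' (f := fun p : ℝ × Plane => ‖H (frame e p)‖ₑ ^ (2 : ℝ))
        ((hH.comp_measurable (continuous_frame e).measurable).enorm.pow_const _)).pow_const _
    -- The test function is `H` itself, restricted to the slices that violate the bound. The
    -- truncation by `n` gives the set `T` finite measure, so that this function is integrable.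
    let S : Set ℝ := {r | |r| ≤ n ∧ C < N r}
    have hS : MeasurableSet S :=
      (measurableSet_le (f := fun r : ℝ => |r|) (by fun_prop) measurable_const).inter (measurableSet_lt measurable_const hN)
    let T : Set SpaceTime := (frameEquiv e he).symm ⁻¹' (S ×ˢ B)
    have hT : MeasurableSet T := (frameEquiv e he).symm.measurable (hS.prod (hball n))
    have hmem : ∀ r y, frame e (r, y) ∈ T ↔ r ∈ S ∧ y ∈ B := by
      intro r y
      simp only [T, Set.mem_preimage, ← coe_frameEquiv e he, MeasurableEquiv.symm_apply_apply,
        Set.mem_prod]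
    have hTfin : volume T ≠ ⊤ := by
      have h1 : volume T = volume (S ×ˢ B) :=
        ((measurePreserving_frameEquiv e he).symm).measure_preimage_equiv _
      rw [h1, Measure.volume_eq_prod, Measure.prod_prod]
      refine ENNReal.mul_ne_top (ne_top_of_le_ne_top (b := volume (Set.Icc (-(n : ℝ)) n)) ?_ ?_) ?_
      · simp
      · exact measure_mono fun r hr => abs_le.1 hr.1
      · exact measure_closedBall_lt_top.ne
    have : IsFiniteMeasure (volume.restrict T) := ⟨by simpa using hTfin.lt_top⟩
    have hnice : IsNice (T.indicator H) :=
      ⟨hH.indicator hT, (integrable_indicator_iff hT).2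
        ((hH2.restrict T).integrable (by norm_num)), hH2.indicator hT⟩
    have hsl : ∀ r, eLpNorm (slice e (T.indicator H) r) 2 volume = S.indicator N r := by
      intro r
      by_cases hr : r ∈ S
      · rw [Set.indicator_of_mem hr]
        congr 1
        ext y
        by_cases hy : y ∈ B
        · simp [slice, Set.indicator, hmem, hr, hy]
        · simp [slice, Set.indicator, hmem, hy]
      · rw [Set.indicator_of_notMem hr]
        have : slice e (T.indicator H) r = 0 := by
          ext y; simp [slice, Set.indicator, hmem, hr]
        simp [this]
    have h1 := h _ hnice
    rw [enorm_integral_mul_conj_indicator hT hH2, eLpNorm_sq_eq_lintegral_slice he hnice.meas,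
      mixedNorm_one] at h1
    have hfin : ∫⁻ r, eLpNorm (slice e (T.indicator H) r) 2 volume ^ 2 ≠ ⊤ := by
      rw [← eLpNorm_sq_eq_lintegral_slice he hnice.meas]
      exact ENNReal.pow_ne_top hnice.memLp.2.ne
    simp_rw [hsl] at h1 hfin
    rw [← lintegral_const_mul _ (hN.indicator hS)] at h1
    -- The pairing gives `∫_S N² ≤ C ∫_S N`, while `C N ≤ N²` on `S`. As the integrals are finite,
    -- equality holds almost everywhere, against `C < N` on `S`.
    have hle : ∀ r, C * S.indicator N r ≤ S.indicator N r ^ 2 := by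
      intro r
      by_cases hr : r ∈ S
      · rw [Set.indicator_of_mem hr, sq]; gcongr; exact hr.2.le
      · simp [hr]
    have heq := ae_eq_of_ae_le_of_lintegral_le (Filter.Eventually.of_forall hle)
      (ne_top_of_le_ne_top hfin (lintegral_mono hle)) ((hN.indicator hS).pow_const 2).aemeasurable h1
    have hlt := ae_lt_top ((hN.indicator hS).pow_const 2) hfin
    filter_upwards [heq, hlt] with r hr hr' hrn
    by_contra hcon
    have hrS : r ∈ S := ⟨hrn, not_le.1 hcon⟩
    rw [Set.indicator_of_mem hrS] at hr hr'
    have hNt : N r ≠ ⊤ := fun h0 => by simp [h0] at hr'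
    have hN0 : N r ≠ 0 := (lt_of_le_of_lt bot_le hrS.2).ne'
    rw [sq, ENNReal.mul_left_inj hN0 hNt] at hr
    exact hrS.2.ne hr
  rw [mixedNorm_top]
  refine essSup_le_of_ae_le _ ?_
  filter_upwards [ae_all_iff.2 key] with r hr
  rw [← ENNReal.pow_le_pow_left_iff (n := 2) (by norm_num), eLpNorm_two_sq]
  have hU : (⋃ n : ℕ, Metric.closedBall (0 : Plane) n) = Set.univ := Metric.iUnion_closedBall_nat 0
  rw [← setLIntegral_univ, ← hU, setLIntegral_iUnion_of_directed]
  · refine iSup_le fun n => ?_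
    obtain ⟨m, hm⟩ := exists_nat_ge |r|
    have h1 := hr (max n m) (hm.trans (by exact_mod_cast le_max_right n m))
    have h2 : ∫⁻ y in Metric.closedBall (0 : Plane) n, ‖slice e H r y‖ₑ ^ 2 ≤
        ∫⁻ y in Metric.closedBall (0 : Plane) (max n m : ℕ), ‖slice e H r y‖ₑ ^ 2 :=
      lintegral_mono_set (Metric.closedBall_subset_closedBall (by exact_mod_cast le_max_left n m))
    refine h2.trans ?_
    rw [← lintegral_indicator (hball _)]
    calc
      _ = eLpNorm ((Metric.closedBall (0 : Plane) (max n m : ℕ)).indicator (slice e H r)) 2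
          volume ^ 2 := by
          rw [eLpNorm_two_sq]
          refine lintegral_congr fun y => ?_
          by_cases hy : y ∈ Metric.closedBall (0 : Plane) (max n m : ℕ)
          · rw [Set.indicator_of_mem hy, Set.indicator_of_mem hy]
          · rw [Set.indicator_of_notMem hy, Set.indicator_of_notMem hy]; simp
      _ ≤ C ^ 2 := by gcongr
  · exact (monotone_nat_of_le_succ fun n => Metric.closedBall_subset_closedBall
      (by exact_mod_cast n.le_succ)).directed_le

end Duality

/-! ### Comparison of the two normalisations of the inverse transform. -/

section Scaling

theorem eLpNorm_comp_smul {E F : Type*} [NormedAddCommGroup E] [NormedSpace ℝ E]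
    [FiniteDimensional ℝ E] [MeasureSpace E] [BorelSpace E]
    [(volume : Measure E).IsAddHaarMeasure] [TopologicalSpace F] [ContinuousENorm F]
    (f : E → F) {a : ℝ} (ha : a ≠ 0) (p : ℝ≥0∞) :
    eLpNorm (fun x => f (a • x)) p volume =
      ENNReal.ofReal |(a ^ Module.finrank ℝ E)⁻¹| ^ (1 / p).toReal * eLpNorm f p volume := by
  have h1 : MeasurableEmbedding (fun x : E => a • x) :=
    (Homeomorph.smulOfNeZero a ha).measurableEmbedding
  have h2 := h1.eLpNorm_map_measure (μ := volume) (g := f) (p := p)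
  rw [Measure.map_addHaar_smul _ ha, eLpNorm_smul_measure_of_ne_zero] at h2
  · exact h2.symm
  · have := pow_ne_zero (Module.finrank ℝ E) ha
    simpa using! abs_pos.2 this

/-- The constant that relates `invFourier` to Mathlib's normalisation, for the inner `L²` norm. -/
noncomputable def scaleConst : ℝ≥0∞ :=
  ‖(((2 * Real.pi) ^ 3)⁻¹ : ℝ)‖ₑ * (ENNReal.ofReal |((2 * Real.pi)⁻¹ ^ 2)⁻¹| ^ (1 / (2 : ℝ≥0∞)).toReal)

theorem scaleConst_ne_zero : scaleConst ≠ 0 := by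
  have : (0 : ℝ) < 2 * Real.pi := by positivity
  refine mul_ne_zero (by rw [Ne, enorm_eq_zero]; positivity) ?_
  rw [Ne, ENNReal.rpow_eq_zero_iff]
  simp [Real.pi_ne_zero]

theorem scaleConst_ne_top : scaleConst ≠ ⊤ :=
  ENNReal.mul_ne_top (by simp) (ENNReal.rpow_ne_top_of_nonneg (by positivity) (by simp))

variable {f : SpaceTime → ℂ}

/-- The dilation by `(2π)⁻¹` acts on the two slice variables, which gives the constant, and on `r`,
which is only rescaled. -/
theorem eLpNorm_slice_invFourier (e : Plane) (hf : MemLp f 2 volume) (r : ℝ) :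
    eLpNorm (slice e (invFourier f) r) 2 volume = scaleConst *
      eLpNorm (slice e (⇑(𝓕⁻ (hf.toLp f) : Lp ℂ 2 (volume : Measure SpaceTime)))
        ((2 * Real.pi)⁻¹ • r)) 2 volume := by
  have hpi : (2 * Real.pi)⁻¹ ≠ 0 := by simp [Real.pi_ne_zero]
  set G : SpaceTime → ℂ := ⇑(𝓕⁻ (hf.toLp f) : Lp ℂ 2 (volume : Measure SpaceTime)) with hG
  have h1 : slice e (invFourier f) r = (((2 * Real.pi) ^ 3)⁻¹ : ℝ) •
      fun y => slice e G ((2 * Real.pi)⁻¹ • r) ((2 * Real.pi)⁻¹ • y) := by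
    ext y
    simp only [slice, invFourier, dif_pos hf, Pi.smul_apply, ← hG]
    congr 2
    ext i
    fin_cases i <;> simp [frame, framePoint] <;> ring
  rw [h1, eLpNorm_const_smul, eLpNorm_comp_smul _ hpi, scaleConst]
  simp [mul_assoc]

theorem mixedNorm_top_invFourier (e : Plane) (hf : MemLp f 2 volume) :
    mixedNorm ⊤ 2 e (invFourier f) = scaleConst *
      mixedNorm ⊤ 2 e (⇑(𝓕⁻ (hf.toLp f) : Lp ℂ 2 (volume : Measure SpaceTime))) := by
  have hpi : (2 * Real.pi)⁻¹ ≠ 0 := by simp [Real.pi_ne_zero]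
  have h := eLpNorm_comp_smul (fun r => eLpNorm (slice e
    (⇑(𝓕⁻ (hf.toLp f) : Lp ℂ 2 (volume : Measure SpaceTime))) r) 2 volume) hpi ⊤
  simp only [eLpNorm_exponent_top, eLpNormEssSup_eq_essSup_enorm, enorm_eq_self] at h
  simp_rw [mixedNorm_top, eLpNorm_slice_invFourier e hf]
  rw [ENNReal.essSup_const_mul, h]
  simp

theorem mixedNorm_one_invFourier (e : Plane) (hf : MemLp f 2 volume) :
    mixedNorm 1 2 e (invFourier f) = scaleConst * (ENNReal.ofReal (2 * Real.pi) *
      mixedNorm 1 2 e (⇑(𝓕⁻ (hf.toLp f) : Lp ℂ 2 (volume : Measure SpaceTime)))) := by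
  have hpi : (2 * Real.pi)⁻¹ ≠ 0 := by simp [Real.pi_ne_zero]
  have h := eLpNorm_comp_smul (fun r => eLpNorm (slice e
    (⇑(𝓕⁻ (hf.toLp f) : Lp ℂ 2 (volume : Measure SpaceTime))) r) 2 volume) hpi 1
  simp only [eLpNorm_one_eq_lintegral_enorm, enorm_eq_self] at h
  simp_rw [mixedNorm_one, eLpNorm_slice_invFourier e hf]
  rw [lintegral_const_mul' _ _ scaleConst_ne_top, h]
  simp [abs_of_pos Real.pi_pos]

end Scaling

end LocalSmoothing

namespace LocalSmoothing

/-! ### The symbol on lines and the surface `P = 0`. -/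

section Slope

/-- `ξ · ē`, half of the derivative of the symbol `P` in the direction `e`. -/
noncomputable def slope (e : Plane) (z : SpaceTime) : ℝ := inner ℝ (space z) (conjVec e)

/-- `cos 2θ` for `e = (cos θ, sin θ)`. -/
noncomputable def cosTwo (e : Plane) : ℝ := e 0 ^ 2 - e 1 ^ 2

/-- `-sin 2θ` for `e = (cos θ, sin θ)`. -/
noncomputable def negSinTwo (e : Plane) : ℝ := -(2 * e 0 * e 1)

variable {e : Plane}

theorem cosTwo_sq_add (he : e ∈ Metric.sphere (0 : Plane) 1) :
    cosTwo e ^ 2 + negSinTwo e ^ 2 = 1 := by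
  have h := sq_add_sq_of_mem_sphere he
  simp only [cosTwo, negSinTwo]
  linear_combination (e 0 ^ 2 + e 1 ^ 2 + 1) * h

theorem abs_cosTwo_le (he : e ∈ Metric.sphere (0 : Plane) 1) : |cosTwo e| ≤ 1 := by
  have h := cosTwo_sq_add he
  exact abs_le_one_iff_mul_self_le_one.2 (by nlinarith [sq_nonneg (negSinTwo e)])

theorem slope_eq (e : Plane) (z : SpaceTime) : slope e z = z 0 * e 0 - z 1 * e 1 := by
  simp [slope, space, conjVec, PiLp.inner_apply, Fin.sum_univ_two]
  ring

theorem continuous_slope (e : Plane) : Continuous (slope e) := by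
  simp_rw [funext (slope_eq e)]; fun_prop

theorem continuous_symbolP : Continuous symbolP := by
  unfold symbolP; fun_prop

theorem slope_frame (e : Plane) (p : ℝ × Plane) :
    slope e (frame e p) = cosTwo e * p.1 + negSinTwo e * p.2 0 := by
  simp [slope_eq, frame, framePoint, cosTwo, negSinTwo]; ring

/-- Arranged so that the derivative in `p.1` is visibly twice the value in `slope_frame`: the slope
measures how fast a line in direction `e` crosses the level sets of `P`. -/
theorem symbolP_frame (e : Plane) (p : ℝ × Plane) :
    symbolP (frame e p) = cosTwo e * p.1 ^ 2 + 2 * (negSinTwo e * p.2 0) * p.1 +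
      (p.2 1 - cosTwo e * p.2 0 ^ 2) := by
  simp [symbolP, frame, framePoint, cosTwo, negSinTwo]; ring

theorem norm_space_sq (z : SpaceTime) : ‖space z‖ ^ 2 = z 0 ^ 2 + z 1 ^ 2 := by
  rw [EuclideanSpace.norm_sq_eq]; simp [space, Fin.sum_univ_two]

theorem norm_space_frame_sq (he : e ∈ Metric.sphere (0 : Plane) 1) (p : ℝ × Plane) :
    ‖space (frame e p)‖ ^ 2 = p.1 ^ 2 + p.2 0 ^ 2 := by
  have h := sq_add_sq_of_mem_sphere he
  rw [norm_space_sq]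
  simp [frame, framePoint]
  linear_combination (p.1 ^ 2 + p.2 0 ^ 2) * h

/-- The point of the characteristic surface `P = 0` above `ξ`. -/
noncomputable def surf (ξ : Plane) : SpaceTime := !₂[ξ 0, ξ 1, ξ 1 ^ 2 - ξ 0 ^ 2]

theorem continuous_surf : Continuous surf := by
  unfold surf; fun_prop

theorem continuous_space : Continuous space := by
  unfold space; fun_prop

end Slope

section PlaneFrame

theorem lintegral_plane {g : Plane → ℝ≥0∞} (hg : Measurable g) :
    ∫⁻ y, g y = ∫⁻ v : ℝ, ∫⁻ τ : ℝ, g !₂[v, τ] := by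
  let E : Plane ≃ᵐ ℝ × ℝ := (MeasurableEquiv.toLp 2 (Fin 2 → ℝ)).symm.trans
    MeasurableEquiv.finTwoArrow
  have hE : MeasurePreserving E volume volume :=
    (PiLp.volume_preserving_ofLp (Fin 2)).trans (volume_preserving_finTwoArrow ℝ)
  rw [← hE.symm.lintegral_comp_emb E.symm.measurableEmbedding, Measure.volume_eq_prod,
    lintegral_prod (fun p => g (E.symm p)) (hg.comp E.symm.measurable).aemeasurable]
  rfl

theorem lintegral_frame_swap {e : Plane} (he : e ∈ Metric.sphere (0 : Plane) 1)
    {g : SpaceTime → ℝ≥0∞} (hg : Measurable g) :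
    ∫⁻ z, g z = ∫⁻ y : Plane, ∫⁻ m : ℝ, g (frame e (m, y)) := by
  rw [lintegral_frame he, Measure.volume_eq_prod, lintegral_prod_symm (fun p => g (frame e p))
    (hg.comp (continuous_frame e).measurable).aemeasurable]

/-- The rotation of the plane that takes the coordinate frame to `(e, e^⊥)`. -/
noncomputable def planeRotation (e : Plane) (he : e ∈ Metric.sphere (0 : Plane) 1) :
    Plane ≃ₗᵢ[ℝ] Plane :=
  LinearIsometry.toLinearIsometryEquiv
    { toFun := fun z => !₂[z 0 * e 0 - z 1 * e 1, z 0 * e 1 + z 1 * e 0]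
      map_add' := fun x y => by
        ext i; fin_cases i <;> simp <;> ring
      map_smul' := fun c x => by
        ext i; fin_cases i <;> simp <;> ring
      norm_map' := fun x => by
        have h := sq_add_sq_of_mem_sphere he
        rw [EuclideanSpace.norm_eq, EuclideanSpace.norm_eq]
        congr 1
        simp only [Fin.sum_univ_two, Real.norm_eq_abs, sq_abs, LinearMap.coe_mk,
          AddHom.coe_mk]
        simp
        linear_combination (x 0 ^ 2 + x 1 ^ 2) * h } rfl

/-- Integration over the plane in the frame `(e, e^⊥)`, for functions on the surface `P = 0`. -/
theorem lintegral_surf {e : Plane} (he : e ∈ Metric.sphere (0 : Plane) 1)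
    {g : SpaceTime → ℝ≥0∞} (hg : Measurable g) :
    ∫⁻ ξ, g (surf ξ) = ∫⁻ v : ℝ, ∫⁻ m : ℝ, g (frame e (m, !₂[v,
      -(cosTwo e * m ^ 2 + 2 * (negSinTwo e * v) * m + (0 - cosTwo e * v ^ 2))])) := by
  have hgs : Measurable (fun ξ => g (surf ξ)) := hg.comp continuous_surf.measurable
  have h1 := (planeRotation e he).measurePreserving.lintegral_comp_emb
    (planeRotation e he).toHomeomorph.toMeasurableEquiv.measurableEmbedding (fun ξ => g (surf ξ))
  rw [← h1, lintegral_plane (g := fun ξ => g (surf (planeRotation e he ξ)))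
    (hgs.comp (planeRotation e he).continuous.measurable), lintegral_lintegral_swap]
  · refine lintegral_congr fun v => lintegral_congr fun m => ?_
    congr 1
    ext i
    fin_cases i <;> simp [planeRotation, surf, frame, framePoint, cosTwo, negSinTwo]
    ring
  · refine Measurable.aemeasurable ?_
    refine (hgs.comp (planeRotation e he).continuous.measurable).comp
      (f := fun q : ℝ × ℝ => (!₂[q.1, q.2] : Plane)) ?_
    have : Continuous (fun q : ℝ × ℝ => (!₂[q.1, q.2] : Plane)) := by fun_prop
    exact this.measurable

end PlaneFrame

/-! ### Level sets of quadratic polynomials and restriction of transforms to `P = 0`. -/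

section LevelSets

/-- The difference of two values is `x - y` times the sum of the two half-derivatives, both positive
here. -/
theorem injOn_quadratic {α β γ l : ℝ} (hl : 0 < l) :
    Set.InjOn (fun x : ℝ => α * x ^ 2 + 2 * β * x + γ) {x | l ≤ α * x + β} := by
  intro x hx y hy h
  simp only [Set.mem_ofPred_eq] at hx hy h
  have h1 : (x - y) * ((α * x + β) + (α * y + β)) = 0 := by linear_combination h
  rcases mul_eq_zero.1 h1 with h2 | h2
  · linarith
  · linarith

theorem hasDerivAt_quadratic (α β γ x : ℝ) :
    HasDerivAt (fun x : ℝ => α * x ^ 2 + 2 * β * x + γ) (2 * (α * x + β)) x := by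
  have h := (((hasDerivAt_id x).pow 2).const_mul α).add ((hasDerivAt_id x).const_mul (2 * β))
  convert! h.add_const γ using 1
  simp; ring

theorem lintegral_quadratic_half_le {α β γ l : ℝ} (hl : 0 < l) (w : ℝ → ℝ≥0∞) :
    ∫⁻ x in {x | l ≤ α * x + β}, w (α * x ^ 2 + 2 * β * x + γ) ≤
      ENNReal.ofReal (1 / (2 * l)) * ∫⁻ x, w x := by
  have hs : MeasurableSet {x : ℝ | l ≤ α * x + β} :=
    measurableSet_le measurable_const (by fun_prop)
  have h := lintegral_image_eq_lintegral_abs_deriv_mul hs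
    (fun x _ => (hasDerivAt_quadratic α β γ x).hasDerivWithinAt) (injOn_quadratic hl) w
  have h2 : ENNReal.ofReal (2 * l) * ∫⁻ x in {x | l ≤ α * x + β}, w (α * x ^ 2 + 2 * β * x + γ) ≤
      ∫⁻ x, w x := by
    rw [← lintegral_const_mul' _ _ ENNReal.ofReal_ne_top]
    refine le_trans ?_ ((le_of_eq h.symm).trans (setLIntegral_le_lintegral _ _))
    refine setLIntegral_mono' hs fun x hx => ?_
    gcongr
    exact le_trans (by linarith [hx.out]) (le_abs_self _)
  calc _ = ENNReal.ofReal (1 / (2 * l)) * (ENNReal.ofReal (2 * l) *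
        ∫⁻ x in {x | l ≤ α * x + β}, w (α * x ^ 2 + 2 * β * x + γ)) := by
          rw [← mul_assoc, ← ENNReal.ofReal_mul (by positivity), one_div,
            inv_mul_cancel₀ (by positivity), ENNReal.ofReal_one, one_mul]
    _ ≤ _ := by gcongr

/-- Where the derivative of a quadratic polynomial is bounded below, its level sets are small. -/
theorem lintegral_quadratic_le {α β γ l : ℝ} (hl : 0 < l) (w : ℝ → ℝ≥0∞) :
    ∫⁻ x in {x | l ≤ |α * x + β|}, w (α * x ^ 2 + 2 * β * x + γ) ≤
      ENNReal.ofReal (1 / l) * ∫⁻ x, w x := by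
  have h1 := lintegral_quadratic_half_le (α := α) (β := β) (γ := γ) hl w
  -- The region of negative derivative reduces to the first one by changing the sign of the
  -- polynomial and reflecting the weight.
  have h2 := lintegral_quadratic_half_le (α := -α) (β := -β) (γ := -γ) hl (fun x => w (-x))
  have h3 : ∀ x : ℝ, -(-α * x ^ 2 + 2 * -β * x + -γ) = α * x ^ 2 + 2 * β * x + γ := fun x => by ring
  simp only [h3] at h2
  rw [lintegral_neg_eq_self (fun x => w x)] at h2
  have hsub : {x : ℝ | l ≤ |α * x + β|} ⊆ {x | l ≤ α * x + β} ∪ {x | l ≤ -α * x + -β} := by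
    intro x hx
    rcases le_abs.1 hx.out with h | h
    · exact Or.inl h
    · exact Or.inr (by simp only [Set.mem_ofPred_eq]; linarith)
  refine (lintegral_mono_set hsub).trans ((lintegral_union_le _ _ _).trans ?_)
  refine (add_le_add h1 h2).trans (le_of_eq ?_)
  rw [← add_mul, ← ENNReal.ofReal_add (by positivity) (by positivity)]
  congr 2
  field_simp
  norm_num

variable {e : Plane}

/-- Change of variables between the plane and the characteristic surface. -/
theorem lintegral_surf_majorant_le (he : e ∈ Metric.sphere (0 : Plane) 1) {l : ℝ} (hl : 0 < l)
    {Γ : Plane → ℝ≥0∞} (hΓ : Measurable Γ) {g : SpaceTime → ℝ≥0∞} (hg : Measurable g)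
    (hgΓ : ∀ m y, g (frame e (m, y)) ≤ Γ y) :
    ∫⁻ ξ, {z | l ≤ |slope e z|}.indicator g (surf ξ) ≤ ENNReal.ofReal (1 / l) * ∫⁻ y, Γ y := by
  have hs : MeasurableSet {z | l ≤ |slope e z|} :=
    measurableSet_le measurable_const (continuous_slope e).abs.measurable
  rw [lintegral_surf he (hg.indicator hs), lintegral_plane hΓ,
    ← lintegral_const_mul' _ _ ENNReal.ofReal_ne_top]
  refine lintegral_mono fun v => ?_
  -- For fixed `v`, the surface expresses `τ` as minus the quadratic taken at `τ = 0`. This accounts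
  -- for the `0 -` in the constant term and the reflected weight.
  have h := lintegral_quadratic_le (α := cosTwo e) (β := negSinTwo e * v)
    (γ := 0 - cosTwo e * v ^ 2) hl (fun τ => Γ !₂[v, -τ])
  rw [lintegral_neg_eq_self (fun τ => Γ !₂[v, τ])] at h
  refine le_trans ?_ h
  rw [← lintegral_indicator (measurableSet_le measurable_const (by fun_prop))]
  refine lintegral_mono fun m => ?_
  by_cases hm : l ≤ |cosTwo e * m + negSinTwo e * v|
  · rw [Set.indicator_of_mem (s := {x | l ≤ |cosTwo e * x + negSinTwo e * v|}) hm]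
    exact (Set.indicator_le_self _ _ _).trans (hgΓ _ _)
  · rw [Set.indicator_of_notMem]
    · exact bot_le
    · simp only [Set.mem_ofPred_eq, slope_frame]
      exact hm

/-- The converse change of variables, from `(ξ · e^⊥, τ)` to the characteristic surface. -/
theorem lintegral_root_le (he : e ∈ Metric.sphere (0 : Plane) 1) {l Λ σ : ℝ} (hl : 0 < l)
    (hσ : |σ| = 1)
    {M : Plane → ℝ} (hM : Measurable M) {G : Set Plane} (hG : MeasurableSet G)
    (hroot : ∀ y ∈ G, symbolP (frame e (M y, y)) = 0)
    (hlow : ∀ y ∈ G, l ≤ σ * slope e (frame e (M y, y)))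
    (hup : ∀ y ∈ G, σ * slope e (frame e (M y, y)) ≤ Λ)
    {u : SpaceTime → ℝ≥0∞} (hu : Measurable u) :
    ∫⁻ y in G, u (frame e (M y, y)) ≤ ENNReal.ofReal (2 * Λ) * ∫⁻ ξ, u (surf ξ) := by
  have hσ2 : σ * σ = 1 := by rw [← abs_mul_abs_self, hσ, one_mul]
  have hmeas : Measurable (fun y => G.indicator (fun y => u (frame e (M y, y))) y) := by
    refine Measurable.indicator (hu.comp ((continuous_frame e).measurable.comp ?_)) hG
    exact hM.prodMk measurable_id
  rw [← lintegral_indicator hG, lintegral_plane hmeas, lintegral_surf he hu,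
    ← lintegral_const_mul' _ _ ENNReal.ofReal_ne_top]
  refine lintegral_mono fun v => ?_
  set f : ℝ → ℝ := fun m => -(cosTwo e * m ^ 2 + 2 * (negSinTwo e * v) * m +
    (0 - cosTwo e * v ^ 2)) with hf
  set s : Set ℝ := {m | l ≤ σ * (cosTwo e * m + negSinTwo e * v) ∧
    σ * (cosTwo e * m + negSinTwo e * v) ≤ Λ} with hs
  have hsm : MeasurableSet s :=
    (measurableSet_le (g := fun m => σ * (cosTwo e * m + negSinTwo e * v))
      measurable_const (by fun_prop)).inter
      (measurableSet_le (f := fun m => σ * (cosTwo e * m + negSinTwo e * v)) (by fun_prop)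
        measurable_const)
  -- The sign `σ` selects one branch, on which `τ` determines `m`. Hence `M` inverts `f` there, and
  -- the Jacobian of `f` is at most `2 Λ`; the lower bound `l` serves only injectivity.
  have hinj : Set.InjOn f s := by
    intro x hx y hy h
    have h1 := injOn_quadratic (α := σ * cosTwo e) (β := σ * (negSinTwo e * v))
      (γ := σ * (0 - cosTwo e * v ^ 2)) hl
    refine h1 (x₁ := x) (x₂ := y) ?_ ?_ ?_
    · simp only [Set.mem_ofPred_eq]; linarith [hx.1]
    · simp only [Set.mem_ofPred_eq]; linarith [hy.1]
    · simp only [hf] at h ⊢; linear_combination -σ * h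
  have hder : ∀ x ∈ s, HasDerivWithinAt f (-(2 * (cosTwo e * x + negSinTwo e * v))) s x :=
    fun x _ => (hasDerivAt_quadratic _ _ _ x).neg.hasDerivWithinAt
  have himg := lintegral_image_eq_lintegral_abs_deriv_mul hsm hder hinj
    (fun τ => G.indicator (fun y => u (frame e (M y, y))) !₂[v, τ])
  have hMs : ∀ τ, (!₂[v, τ] : Plane) ∈ G → M !₂[v, τ] ∈ s ∧ f (M !₂[v, τ]) = τ := by
    intro τ hτ
    have h1 := hroot _ hτ
    have h2 := hlow _ hτ
    have h3 := hup _ hτ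
    rw [symbolP_frame] at h1
    rw [slope_frame] at h2 h3
    change cosTwo e * M !₂[v, τ] ^ 2 + 2 * (negSinTwo e * v) * M !₂[v, τ] +
      (τ - cosTwo e * v ^ 2) = 0 at h1
    exact ⟨⟨h2, h3⟩, by simp only [hf]; linarith⟩
  calc ∫⁻ τ, G.indicator (fun y => u (frame e (M y, y))) !₂[v, τ]
      ≤ ∫⁻ τ, (f '' s).indicator
          (fun τ => G.indicator (fun y => u (frame e (M y, y))) !₂[v, τ]) τ := by
        refine lintegral_mono fun τ => ?_
        by_cases hτ : (!₂[v, τ] : Plane) ∈ G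
        · rw [Set.indicator_of_mem (s := f '' s) ⟨_, hMs τ hτ⟩]
        · simp [hτ]
    _ ≤ ∫⁻ τ in f '' s, G.indicator (fun y => u (frame e (M y, y))) !₂[v, τ] :=
        lintegral_indicator_le _ _
    _ = _ := himg
    _ ≤ ∫⁻ m in s, ENNReal.ofReal (2 * Λ) * u (frame e (m, !₂[v, f m])) := by
        refine setLIntegral_mono' hsm fun m hm => ?_
        gcongr ?_ * ?_
        · refine ENNReal.ofReal_le_ofReal ?_
          have : |cosTwo e * m + negSinTwo e * v| = |σ * (cosTwo e * m + negSinTwo e * v)| := by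
            rw [abs_mul, hσ, one_mul]
          rw [abs_neg, abs_mul, this, abs_of_pos (hl.trans_le hm.1), abs_two]
          linarith [hm.2]
        · by_cases hτ : (!₂[v, f m] : Plane) ∈ G
          · rw [Set.indicator_of_mem hτ]
            have := hinj (hMs _ hτ).1 hm (hMs _ hτ).2
            rw [this]
          · simp [hτ]
    _ ≤ ∫⁻ m, ENNReal.ofReal (2 * Λ) * u (frame e (m, !₂[v, f m])) := setLIntegral_le_lintegral _ _
    _ = _ := lintegral_const_mul' _ _ ENNReal.ofReal_ne_top

variable {Ψ : SpaceTime → ℂ}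

theorem measurable_enorm_fourier_sq (hΨ : Integrable Ψ) :
    Measurable (fun z => ‖𝓕 Ψ z‖ₑ ^ 2) :=
  (continuous_fourier_of_integrable hΨ).measurable.enorm.pow_const _

theorem lintegral_majorant_sq_le (he : e ∈ Metric.sphere (0 : Plane) 1) (hΨ : IsNice Ψ) :
    ∫⁻ y, majorant e Ψ y ^ 2 ≤ mixedNorm 1 2 e Ψ ^ 2 := by
  have h := eLpNorm_two_sq (μ := volume) (majorant e Ψ)
  simp only [enorm_eq_self] at h
  rw [← h]
  gcongr
  exact eLpNorm_majorant_le he hΨ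

/-- The Fourier transform of a function in `L^{1,2}_e`, restricted to `P = 0`. -/
theorem lintegral_surf_fourier_le (he : e ∈ Metric.sphere (0 : Plane) 1) {l : ℝ} (hl : 0 < l)
    (hΨ : IsNice Ψ) :
    ∫⁻ ξ, {z | l ≤ |slope e z|}.indicator (fun z => ‖𝓕 Ψ z‖ₑ ^ 2) (surf ξ) ≤
      ENNReal.ofReal (1 / l) * mixedNorm 1 2 e Ψ ^ 2 := by
  refine (lintegral_surf_majorant_le he hl ((measurable_majorant (e := e) hΨ.meas).pow_const 2)
    (measurable_enorm_fourier_sq hΨ.int) fun m y => ?_).trans ?_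
  · gcongr; exact enorm_fourier_frame_le he hΨ.int m y
  · gcongr; exact lintegral_majorant_sq_le he hΨ

/-- The Fourier transform of a function in `L^{1,2}_e`, weighted by the distance to `P = 0`. -/
theorem lintegral_symbolP_fourier_le (he : e ∈ Metric.sphere (0 : Plane) 1) {l : ℝ} (hl : 0 < l)
    (hΨ : IsNice Ψ) {w : ℝ → ℝ≥0∞} (hw : Measurable w) :
    ∫⁻ z, {z | l ≤ |slope e z|}.indicator (fun z => w (symbolP z) * ‖𝓕 Ψ z‖ₑ ^ 2) z ≤
      ENNReal.ofReal (1 / l) * (∫⁻ x, w x) * mixedNorm 1 2 e Ψ ^ 2 := by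
  have hs : MeasurableSet {z | l ≤ |slope e z|} :=
    measurableSet_le measurable_const (continuous_slope e).abs.measurable
  have hm : Measurable ({z | l ≤ |slope e z|}.indicator
      (fun z => w (symbolP z) * ‖𝓕 Ψ z‖ₑ ^ 2)) :=
    ((hw.comp continuous_symbolP.measurable).mul (measurable_enorm_fourier_sq hΨ.int)).indicator hs
  rw [lintegral_frame_swap he hm]
  calc _ ≤ ∫⁻ y : Plane, ENNReal.ofReal (1 / l) * (∫⁻ x, w x) * majorant e Ψ y ^ 2 := by
        refine lintegral_mono fun y => ?_
        have h := lintegral_quadratic_le (α := cosTwo e) (β := negSinTwo e * y 0)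
          (γ := y 1 - cosTwo e * y 0 ^ 2) hl w
        refine le_trans ?_ (mul_le_mul_left h _)
        have hs' : MeasurableSet {x : ℝ | l ≤ |cosTwo e * x + negSinTwo e * y 0|} :=
          measurableSet_le measurable_const (by fun_prop)
        have hw' : Measurable (fun x : ℝ => w (cosTwo e * x ^ 2 + 2 * (negSinTwo e * y 0) * x +
          (y 1 - cosTwo e * y 0 ^ 2))) := hw.comp (by fun_prop)
        rw [← lintegral_indicator hs', ← lintegral_mul_const _ (hw'.indicator hs')]
        refine lintegral_mono fun m => ?_
        simp only [Set.indicator, Set.mem_ofPred_eq, slope_frame, symbolP_frame]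
        split_ifs
        · gcongr; exact enorm_fourier_frame_le he hΨ.int m y
        · simp
    _ = ENNReal.ofReal (1 / l) * (∫⁻ x, w x) * ∫⁻ y, majorant e Ψ y ^ 2 :=
        lintegral_const_mul _ ((measurable_majorant hΨ.meas).pow_const 2)
    _ ≤ _ := by gcongr; exact lintegral_majorant_sq_le he hΨ

/-- The Fourier transform of a function in `L^{1,2}_e` over a ball of spatial frequencies. -/
theorem lintegral_ball_fourier_le (he : e ∈ Metric.sphere (0 : Plane) 1) {R : ℝ} (hR : 0 ≤ R)
    (hΨ : IsNice Ψ) :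
    ∫⁻ z, {z | ‖space z‖ ≤ R}.indicator (fun z => ‖𝓕 Ψ z‖ₑ ^ 2) z ≤
      ENNReal.ofReal (2 * R) * mixedNorm 1 2 e Ψ ^ 2 := by
  have hs : MeasurableSet {z | ‖space z‖ ≤ R} :=
    measurableSet_le continuous_space.norm.measurable measurable_const
  have hm : Measurable ({z | ‖space z‖ ≤ R}.indicator (fun z => ‖𝓕 Ψ z‖ₑ ^ 2)) :=
    (measurable_enorm_fourier_sq hΨ.int).indicator hs
  rw [lintegral_frame_swap he hm]
  calc _ ≤ ∫⁻ y : Plane, ENNReal.ofReal (2 * R) * majorant e Ψ y ^ 2 := by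
        refine lintegral_mono fun y => ?_
        have h : volume (Set.Icc (-R) R) = ENNReal.ofReal (2 * R) := by
          rw [Real.volume_Icc]; congr 1; ring
        rw [← h, mul_comm, ← setLIntegral_const, ← lintegral_indicator measurableSet_Icc]
        refine lintegral_mono fun m => ?_
        simp only [Set.indicator, Set.mem_ofPred_eq]
        split_ifs with h1 h2 h2
        · gcongr; exact enorm_fourier_frame_le he hΨ.int m y
        · refine absurd ?_ h2
          have h3 := norm_space_frame_sq he (m, y)
          have h4 : m ^ 2 ≤ R ^ 2 := by
            have : ‖space (frame e (m, y))‖ ^ 2 ≤ R ^ 2 := by gcongr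
            nlinarith [sq_nonneg (y 0)]
          exact abs_le.1 (abs_le_of_sq_le_sq h4 hR)
        · exact bot_le
        · exact le_rfl
    _ = ENNReal.ofReal (2 * R) * ∫⁻ y, majorant e Ψ y ^ 2 :=
        lintegral_const_mul _ ((measurable_majorant hΨ.meas).pow_const 2)
    _ ≤ _ := by gcongr; exact lintegral_majorant_sq_le he hΨ

end LevelSets

end LocalSmoothing

namespace LocalSmoothing

/-! ### Dyadic decomposition and the support of the cutoff `χ`. -/

section Cutoffs

variable {η₀ : ℝ → ℝ}

theorem IsCutoff.continuous_eta (hη : IsCutoff η₀) (j : ℕ) : Continuous (eta η₀ j) := by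
  have h := hη.smooth.continuous
  cases j with
  | zero => exact h
  | succ j =>
    change Continuous (fun μ => η₀ (μ / 2 ^ (j + 1)) - η₀ (μ / 2 ^ j))
    fun_prop

theorem IsCutoff.sum_eta (η₀ : ℝ → ℝ) (J : ℕ) (μ : ℝ) :
    ∑ j ∈ Finset.range (J + 1), eta η₀ j μ = η₀ (μ / 2 ^ J) := by
  induction J with
  | zero => simp [eta]
  | succ J ih => rw [Finset.sum_range_succ, ih]; simp [eta]

theorem IsCutoff.eta_eq_zero (hη : IsCutoff η₀) {j : ℕ} {μ : ℝ} (h : 2 ^ (j + 1) < |μ|) :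
    eta η₀ j μ = 0 := by
  cases j with
  | zero => exact hη.eq_zero _ (by simpa using h)
  | succ j =>
    have h1 : η₀ (μ / 2 ^ (j + 1)) = 0 := by
      refine hη.eq_zero _ ?_
      rw [abs_div, abs_of_pos (a := (2 : ℝ) ^ (j + 1)) (by positivity), lt_div_iff₀ (by positivity)]
      calc (2 : ℝ) * 2 ^ (j + 1) = 2 ^ (j + 1 + 1) := by ring
        _ < _ := h
    have h2 : η₀ (μ / 2 ^ j) = 0 := by
      refine hη.eq_zero _ ?_
      rw [abs_div, abs_of_pos (a := (2 : ℝ) ^ j) (by positivity), lt_div_iff₀ (by positivity)]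
      calc (2 : ℝ) * 2 ^ j ≤ 2 ^ (j + 1 + 1) := by
            rw [pow_succ, pow_succ]; nlinarith [pow_pos (two_pos (α := ℝ)) j]
        _ < _ := h
    simp [eta, h1, h2]

/-- The partial sums telescope to `η₀(P/2^J)`, which is `1` as soon as `2^J ≥ 2|P|`. -/
theorem IsCutoff.enorm_le_tsum (hη : IsCutoff η₀) (g : SpaceTime → ℂ) (z : SpaceTime) :
    ‖g z‖ₑ ≤ ∑' j, ‖(eta η₀ j (symbolP z) : ℂ) * g z‖ₑ := by
  obtain ⟨J, hJ⟩ := pow_unbounded_of_one_lt (2 * |symbolP z|) (one_lt_two (α := ℝ))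
  have h1 : η₀ (symbolP z / 2 ^ J) = 1 := by
    refine hη.eq_one _ ?_
    rw [abs_div, abs_of_pos (a := (2 : ℝ) ^ J) (by positivity), div_le_iff₀ (by positivity)]
    linarith
  have h2 : g z = ∑ j ∈ Finset.range (J + 1), (eta η₀ j (symbolP z) : ℂ) * g z := by
    rw [← Finset.sum_mul, ← Complex.ofReal_sum, IsCutoff.sum_eta, h1]; simp
  calc ‖g z‖ₑ = ‖∑ j ∈ Finset.range (J + 1), (eta η₀ j (symbolP z) : ℂ) * g z‖ₑ := by rw [← h2]
    _ ≤ ∑ j ∈ Finset.range (J + 1), ‖(eta η₀ j (symbolP z) : ℂ) * g z‖ₑ := enorm_sum_le _ _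
    _ ≤ _ := ENNReal.sum_le_tsum _

theorem IsCutoff.continuous_chi (hη : IsCutoff η₀) (k l : ℕ) : Continuous (chi η₀ k l) := by
  have h := hη.smooth.continuous
  unfold chi
  split_ifs
  · fun_prop
  · fun_prop

theorem IsCutoff.chi_mem (hη : IsCutoff η₀) (k l : ℕ) (r : ℝ) :
    chi η₀ k l r ∈ Set.Icc (0 : ℝ) 1 := by
  unfold chi
  split_ifs
  · have h := hη.mem_Icc (r / (2 : ℝ) ^ ((k : ℤ) - (l : ℤ)))
    exact ⟨by linarith [h.2], by linarith [h.1]⟩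
  · simp

theorem IsCutoff.abs_chi_le (hη : IsCutoff η₀) (k l : ℕ) (r : ℝ) : |chi η₀ k l r| ≤ 1 := by
  have h := hη.chi_mem k l r
  rw [abs_of_nonneg h.1]; exact h.2

theorem two_zpow_sub (k l : ℕ) : (2 : ℝ) ^ ((k : ℤ) - (l : ℤ)) = 2 ^ k / 2 ^ l := by
  rw [zpow_sub₀ (by norm_num)]; simp

/-- Since `η₀ = 1` up to `1/2`, one more power of two is lost: `l = 30` produces the threshold
`2^k/2^31` used below. -/
theorem IsCutoff.lt_of_chi_ne_zero (hη : IsCutoff η₀) {k l : ℕ} (hk : 100 ≤ k) {r : ℝ}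
    (h : chi η₀ k l r ≠ 0) : 2 ^ k / 2 ^ (l + 1) < |r| := by
  by_contra hcon
  refine h ?_
  rw [chi, if_pos hk, two_zpow_sub, hη.eq_one, sub_self]
  rw [abs_div, abs_of_pos (a := (2 : ℝ) ^ k / 2 ^ l) (by positivity), div_le_iff₀ (by positivity)]
  rw [not_lt] at hcon
  refine hcon.trans (le_of_eq ?_)
  rw [pow_succ]; field_simp

theorem norm_space_le_of_mem_setDInf {k : ℕ} {z : SpaceTime} (hz : z ∈ setDInf k) :
    ‖space z‖ ≤ 2 ^ (k + 1) := by
  obtain ⟨j, hj⟩ := Set.mem_iUnion.1 hz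
  have h := hj.1
  cases k with
  | zero => simpa [annulus] using h
  | succ k => exact h.2

end Cutoffs

/-! ### The estimate for `X_k`. -/

section XEstimate

variable {η₀ : ℝ → ℝ} {e : Plane} {Ψ g : SpaceTime → ℂ}

theorem eLpNorm_le_of_lintegral_sq_le {α E : Type*} [MeasurableSpace α] {μ : Measure α}
    [TopologicalSpace E] [ContinuousENorm E] {f : α → E} {c : ℝ} (hc : 0 ≤ c) {N : ℝ≥0∞}
    (h : ∫⁻ x, ‖f x‖ₑ ^ 2 ∂μ ≤ ENNReal.ofReal (c ^ 2) * N ^ 2) :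
    eLpNorm f 2 μ ≤ ENNReal.ofReal c * N := by
  rw [← ENNReal.pow_le_pow_left_iff (n := 2) (by norm_num), eLpNorm_two_sq, mul_pow,
    ← ENNReal.ofReal_pow hc]
  exact h

theorem measurable_enorm_fourier (hΨ : Integrable Ψ) : Measurable (fun z => ‖𝓕 Ψ z‖ₑ) :=
  (continuous_fourier_of_integrable hΨ).measurable.enorm

theorem indicator_sq {α : Type*} (s : Set α) (f : α → ℝ≥0∞) (x : α) :
    s.indicator f x ^ 2 = s.indicator (fun x => f x ^ 2) x := by
  by_cases h : x ∈ s <;> simp [h]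

/-- The `L²` norm of the transform of a function in `L^{1,2}_e` over a ball of frequencies. -/
theorem eLpNorm_ball_fourier_le (he : e ∈ Metric.sphere (0 : Plane) 1) {c : ℝ} (hc : 0 ≤ c)
    (hΨ : IsNice Ψ) :
    eLpNorm ({z | ‖space z‖ ≤ c ^ 2 / 2}.indicator (fun z => ‖𝓕 Ψ z‖ₑ)) 2 volume ≤
      ENNReal.ofReal c * mixedNorm 1 2 e Ψ := by
  refine eLpNorm_le_of_lintegral_sq_le hc ?_
  -- The radius is written as `c²/2` so that the constant `2R` is the perfect square `c²`.
  have h := lintegral_ball_fourier_le he (R := c ^ 2 / 2) (by positivity) hΨ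
  rw [mul_div_cancel₀ _ (two_ne_zero)] at h
  refine le_trans (le_of_eq (lintegral_congr fun z => ?_)) h
  rw [enorm_eq_self, indicator_sq]

theorem rpow_half_sq (j : ℕ) : ((2 : ℝ) ^ ((j : ℝ) / 2)) ^ 2 = 2 ^ j := by
  rw [← Real.rpow_natCast, ← Real.rpow_mul (by norm_num)]
  push_cast
  rw [div_mul_cancel₀ _ (by norm_num), Real.rpow_natCast]

theorem rpow_neg_half_sq (k : ℕ) : ((2 : ℝ) ^ (-(k : ℝ) / 2)) ^ 2 = (2 ^ k)⁻¹ := by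
  rw [← Real.rpow_natCast, ← Real.rpow_mul (by norm_num)]
  push_cast
  rw [div_mul_cancel₀ _ (by norm_num), Real.rpow_neg (by norm_num), Real.rpow_natCast]

/-- The `L²` norm of the transform of a function in `L^{1,2}_e` near `P = 0`. -/
theorem eLpNorm_level_fourier_le (he : e ∈ Metric.sphere (0 : Plane) 1) (k j : ℕ) (hΨ : IsNice Ψ) :
    eLpNorm ({z | 2 ^ k / 2 ^ 31 ≤ |slope e z| ∧ |symbolP z| ≤ 2 ^ (j + 1)}.indicator
      (fun z => ‖𝓕 Ψ z‖ₑ)) 2 volume ≤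
      ENNReal.ofReal (2 ^ 17 * 2 ^ (-(k : ℝ) / 2) * 2 ^ ((j : ℝ) / 2)) * mixedNorm 1 2 e Ψ := by
  refine eLpNorm_le_of_lintegral_sq_le (by positivity) ?_
  have hw : Measurable ((Set.Icc (-(2 : ℝ) ^ (j + 1)) (2 ^ (j + 1))).indicator
    (fun _ => (1 : ℝ≥0∞))) := measurable_const.indicator measurableSet_Icc
  have h := lintegral_symbolP_fourier_le he (l := 2 ^ k / 2 ^ 31) (by positivity) hΨ hw
  rw [lintegral_indicator_const measurableSet_Icc, Real.volume_Icc, one_mul,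
    ← ENNReal.ofReal_mul (by positivity)] at h
  refine le_trans (le_of_eq (lintegral_congr fun z => ?_)) (h.trans ?_)
  · rw [enorm_eq_self, indicator_sq]
    simp only [Set.indicator, Set.mem_ofPred_eq, Set.mem_Icc, ← abs_le]
    split_ifs <;> simp_all
  · gcongr
    -- The constant obtained is `(2^31/2^k) · 2^(j+2) = 2^33 · 2^(j-k)`, below the square `2^34 ·
    -- 2^(j-k)` on the right.
    rw [mul_pow, mul_pow, rpow_half_sq, rpow_neg_half_sq]
    have h1 : (0 : ℝ) < 2 ^ k := by positivity
    have h2 : (0 : ℝ) < 2 ^ j := by positivity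
    rw [pow_succ (2 : ℝ) j, one_div_div, sub_neg_eq_add]
    field_simp
    norm_num

theorem lintegral_mul_indicator_le {f : SpaceTime → ℂ} (hf : AEStronglyMeasurable f volume)
    {s : Set SpaceTime} (hs : MeasurableSet s) (hΨ : IsNice Ψ) {u : SpaceTime → ℝ≥0∞}
    (hu : ∀ᵐ z, u z ≤ ‖f z‖ₑ * s.indicator (fun z => ‖𝓕 Ψ z‖ₑ) z) :
    ∫⁻ z, u z ≤ eLpNorm f 2 volume * eLpNorm (s.indicator (fun z => ‖𝓕 Ψ z‖ₑ)) 2 volume := by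
  refine (lintegral_mono_ae hu).trans ((lintegral_mul_le_eLpNorm_mul_eLpNorm hf.enorm
    ((measurable_enorm_fourier hΨ.int).indicator hs).aemeasurable).trans (le_of_eq ?_))
  rw [eLpNorm_enorm]

theorem ofReal_half_le_of_lt {k : ℕ} (hk : k < 100) : 1 ≤ 2 ^ 50 * (2 : ℝ) ^ (-(k : ℝ) / 2) := by
  have h : (2 : ℝ) ^ (-50 : ℝ) ≤ (2 : ℝ) ^ (-(k : ℝ) / 2) := by
    refine Real.rpow_le_rpow_of_exponent_le (by norm_num) ?_
    have : (k : ℝ) ≤ 100 := by exact_mod_cast hk.le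
    linarith
  have h2 : (2 : ℝ) ^ (-50 : ℝ) = (2 ^ 50)⁻¹ := by
    rw [Real.rpow_neg (by norm_num)]; norm_cast
  rw [h2] at h
  calc (1 : ℝ) = 2 ^ 50 * (2 ^ 50)⁻¹ := by norm_num
    _ ≤ _ := by gcongr

/-- Local smoothing for `X_k`, in dual form. -/
theorem lintegral_memX_le (hη : IsCutoff η₀) {k : ℕ} (he : e ∈ Metric.sphere (0 : Plane) 1)
    (hg : MemX η₀ k g) (hΨ : IsNice Ψ) :
    ∫⁻ z, ‖g z * (chi η₀ k 30 (slope e z) : ℂ)‖ₑ * ‖𝓕 Ψ z‖ₑ ≤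
      ENNReal.ofReal (2 ^ 101 * 2 ^ (-(k : ℝ) / 2)) * xNorm η₀ g * mixedNorm 1 2 e Ψ := by
  have hmeas : ∀ j, AEStronglyMeasurable (fun z => (eta η₀ j (symbolP z) : ℂ) * g z) volume :=
    fun j => ((Complex.continuous_ofReal.comp ((hη.continuous_eta j).comp
      continuous_symbolP)).aestronglyMeasurable).mul hg.memLp.1
  have hchim : Measurable (fun z => ‖(chi η₀ k 30 (slope e z) : ℂ)‖ₑ * ‖𝓕 Ψ z‖ₑ) :=
    ((Complex.continuous_ofReal.comp ((hη.continuous_chi k 30).comp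
      (continuous_slope e))).measurable.enorm).mul (measurable_enorm_fourier hΨ.int)
  have hchi1 : ∀ z, ‖(chi η₀ k 30 (slope e z) : ℂ)‖ₑ ≤ 1 := by
    intro z
    rw [← ofReal_norm, Complex.norm_real, Real.norm_eq_abs]
    exact ENNReal.ofReal_le_one.2 (hη.abs_chi_le _ _ _)
  have hpiece : ∀ j : ℕ, ∫⁻ z, ‖(eta η₀ j (symbolP z) : ℂ) * g z‖ₑ *
      (‖(chi η₀ k 30 (slope e z) : ℂ)‖ₑ * ‖𝓕 Ψ z‖ₑ) ≤
      ENNReal.ofReal (2 ^ 101 * 2 ^ (-(k : ℝ) / 2)) * mixedNorm 1 2 e Ψ *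
        (ENNReal.ofReal ((2 : ℝ) ^ ((j : ℝ) / 2)) *
          eLpNorm (fun z => (eta η₀ j (symbolP z) : ℂ) * g z) 2 volume) := by
    intro j
    rcases lt_or_ge k 100 with hk | hk
    · have hs : MeasurableSet {z : SpaceTime | ‖space z‖ ≤ ((2 : ℝ) ^ 51) ^ 2 / 2} :=
        measurableSet_le continuous_space.norm.measurable measurable_const
      have h1 := lintegral_mul_indicator_le (hmeas j) hs hΨ
        (u := fun z => ‖(eta η₀ j (symbolP z) : ℂ) * g z‖ₑ *
          (‖(chi η₀ k 30 (slope e z) : ℂ)‖ₑ * ‖𝓕 Ψ z‖ₑ)) ?_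
      · refine h1.trans ?_
        -- The ball of radius `2^101` contains all frequencies `|ξ| ≤ 2^(k+1) ≤ 2^100`. The missing
        -- factor `2^(-k/2)` costs at most `2^50`, whence the final constant `2^51 · 2^50 = 2^101`.
        have h2 := eLpNorm_ball_fourier_le he (c := 2 ^ 51) (by positivity) hΨ
        calc _ ≤ _ := mul_le_mul_right h2 _
          _ = ENNReal.ofReal (2 ^ 51) * mixedNorm 1 2 e Ψ * (1 *
            eLpNorm (fun z => (eta η₀ j (symbolP z) : ℂ) * g z) 2 volume) := by ring
          _ ≤ _ := by
            gcongr ENNReal.ofReal ?_ * _ * (?_ * _)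
            · have := ofReal_half_le_of_lt hk
              calc (2 : ℝ) ^ 51 = 2 ^ 51 * 1 := by ring
                _ ≤ 2 ^ 51 * (2 ^ 50 * (2 : ℝ) ^ (-(k : ℝ) / 2)) := by gcongr
                _ = _ := by ring
            · exact ENNReal.one_le_ofReal.2 (Real.one_le_rpow (by norm_num) (by positivity))
      · filter_upwards [hg.supp] with z hz
        by_cases hzD : z ∈ setDInf k
        · rw [Set.indicator_of_mem]
          · gcongr
            calc _ ≤ 1 * ‖𝓕 Ψ z‖ₑ := by gcongr; exact hchi1 z
              _ = _ := one_mul _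
          · refine (norm_space_le_of_mem_setDInf hzD).trans ?_
            calc (2 : ℝ) ^ (k + 1) ≤ 2 ^ 100 := pow_le_pow_right₀ (by norm_num) (by omega)
              _ ≤ _ := by norm_num
        · simp [hz hzD]
    · have hs : MeasurableSet {z : SpaceTime | 2 ^ k / 2 ^ 31 ≤ |slope e z| ∧
          |symbolP z| ≤ 2 ^ (j + 1)} :=
        (measurableSet_le measurable_const (continuous_slope e).abs.measurable).inter
          (measurableSet_le continuous_symbolP.abs.measurable measurable_const)
      have h1 := lintegral_mul_indicator_le (hmeas j) hs hΨ
        (u := fun z => ‖(eta η₀ j (symbolP z) : ℂ) * g z‖ₑ *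
          (‖(chi η₀ k 30 (slope e z) : ℂ)‖ₑ * ‖𝓕 Ψ z‖ₑ)) ?_
      · refine h1.trans ?_
        have h2 := eLpNorm_level_fourier_le he k j hΨ
        calc _ ≤ _ := mul_le_mul_right h2 _
          _ = ENNReal.ofReal (2 ^ 17 * 2 ^ (-(k : ℝ) / 2)) * mixedNorm 1 2 e Ψ *
            (ENNReal.ofReal ((2 : ℝ) ^ ((j : ℝ) / 2)) *
            eLpNorm (fun z => (eta η₀ j (symbolP z) : ℂ) * g z) 2 volume) := by
              rw [ENNReal.ofReal_mul (by positivity)]; ring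
          _ ≤ _ := by
            gcongr
            · norm_num
            · norm_num
      · refine Filter.Eventually.of_forall fun z => ?_
        by_cases hc : chi η₀ k 30 (slope e z) = 0
        · simp [hc]
        by_cases hP : |symbolP z| ≤ 2 ^ (j + 1)
        · rw [Set.indicator_of_mem (show z ∈ {z : SpaceTime | 2 ^ k / 2 ^ 31 ≤ |slope e z| ∧
            |symbolP z| ≤ 2 ^ (j + 1)} from ⟨(hη.lt_of_chi_ne_zero hk hc).le, hP⟩)]
          gcongr
          calc _ ≤ 1 * ‖𝓕 Ψ z‖ₑ := by gcongr; exact hchi1 z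
            _ = _ := one_mul _
        · simp [hη.eta_eq_zero (not_le.1 hP)]
  calc ∫⁻ z, ‖g z * (chi η₀ k 30 (slope e z) : ℂ)‖ₑ * ‖𝓕 Ψ z‖ₑ
      ≤ ∫⁻ z, ∑' j, ‖(eta η₀ j (symbolP z) : ℂ) * g z‖ₑ *
          (‖(chi η₀ k 30 (slope e z) : ℂ)‖ₑ * ‖𝓕 Ψ z‖ₑ) := by
        refine lintegral_mono fun z => ?_
        rw [ENNReal.tsum_mul_right, enorm_mul, mul_assoc]
        gcongr
        exact hη.enorm_le_tsum g z
    _ = ∑' j, ∫⁻ z, ‖(eta η₀ j (symbolP z) : ℂ) * g z‖ₑ *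
          (‖(chi η₀ k 30 (slope e z) : ℂ)‖ₑ * ‖𝓕 Ψ z‖ₑ) :=
        lintegral_tsum fun j => (hmeas j).enorm.mul hchim.aemeasurable
    _ ≤ ∑' j : ℕ, ENNReal.ofReal (2 ^ 101 * 2 ^ (-(k : ℝ) / 2)) * mixedNorm 1 2 e Ψ *
        (ENNReal.ofReal ((2 : ℝ) ^ ((j : ℝ) / 2)) *
          eLpNorm (fun z => (eta η₀ j (symbolP z) : ℂ) * g z) 2 volume) :=
        ENNReal.tsum_le_tsum hpiece
    _ = _ := by rw [ENNReal.tsum_mul_left, xNorm]; ring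

end XEstimate

end LocalSmoothing

namespace LocalSmoothing

/-! ### The one-dimensional resolvent as a superposition of half-line cut-offs. -/

section Resolvent

/-- The damped Heaviside cut-off `1_{r < r₀} exp (-2πε(r₀ - r))`. -/
noncomputable def cut (ε r₀ r : ℝ) : ℝ :=
  (Set.Iio r₀).indicator (fun r => Real.exp (-(2 * Real.pi * ε * (r₀ - r)))) r

/-- `cut ε r₀ r * exp (2πi M (r - r₀))`, the fundamental solution of a first order operator. -/
noncomputable def halfWave (ε M r₀ r : ℝ) : ℂ :=
  (Set.Iio r₀).indicator
    (fun r => Complex.exp ((2 * Real.pi * (ε + M * Complex.I)) * ((r : ℂ) - r₀))) r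

variable {ε : ℝ} (M r₀ : ℝ)

theorem abs_cut_le (hε : 0 < ε) (r : ℝ) : |cut ε r₀ r| ≤ 1 := by
  unfold cut
  by_cases h : r ∈ Set.Iio r₀
  · rw [Set.indicator_of_mem h, abs_of_pos (Real.exp_pos _)]
    refine Real.exp_le_one_iff.2 ?_
    have h1 : 0 ≤ r₀ - r := by linarith [Set.mem_Iio.1 h]
    have := Real.pi_pos
    exact neg_nonpos.2 (by positivity)
  · rw [Set.indicator_of_notMem h]; simp

theorem measurable_cut (ε : ℝ) : Measurable (fun p : ℝ × ℝ => cut ε p.1 p.2) := by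
  have h : (fun p : ℝ × ℝ => cut ε p.1 p.2) = {p : ℝ × ℝ | p.2 < p.1}.indicator
      (fun p => Real.exp (-(2 * Real.pi * ε * (p.1 - p.2)))) := by
    ext p; simp [cut, Set.indicator]
  rw [h]
  exact Measurable.indicator (by fun_prop) (measurableSet_lt measurable_snd measurable_fst)

theorem halfWave_eq (ε M r₀ r : ℝ) : halfWave ε M r₀ r =
    (cut ε r₀ r : ℂ) * Complex.exp (2 * Real.pi * M * Complex.I * ((r : ℂ) - r₀)) := by
  unfold halfWave cut
  by_cases h : r ∈ Set.Iio r₀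
  · simp only [Set.indicator_of_mem h, Complex.ofReal_exp, ← Complex.exp_add]
    congr 1; push_cast; ring
  · simp [Set.indicator_of_notMem h]

theorem norm_halfWave (ε M r₀ r : ℝ) : ‖halfWave ε M r₀ r‖ = |cut ε r₀ r| := by
  rw [halfWave_eq, norm_mul, Complex.norm_real, Real.norm_eq_abs]
  have h : (2 * Real.pi * M * Complex.I * ((r : ℂ) - r₀)) =
      ((2 * Real.pi * M * (r - r₀) : ℝ) : ℂ) * Complex.I := by push_cast; ring
  rw [h, Complex.norm_exp_ofReal_mul_I, mul_one]

theorem integrable_halfWave (hε : 0 < ε) : Integrable (halfWave ε M r₀) := by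
  have hre : 0 < ((2 * Real.pi * (ε + M * Complex.I) : ℂ)).re := by
    have : ((2 * Real.pi * (ε + M * Complex.I) : ℂ)).re = 2 * Real.pi * ε := by simp
    rw [this]; have := Real.pi_pos; positivity
  have h := integrableOn_exp_mul_complex_Iic hre r₀
  have h2 : IntegrableOn (fun r : ℝ => Complex.exp ((2 * Real.pi * (ε + M * Complex.I)) *
      ((r : ℂ) - r₀))) (Set.Iio r₀) := by
    refine ((h.mono_set Set.Iio_subset_Iic_self).mul_const
      (Complex.exp (-(2 * Real.pi * (ε + M * Complex.I)) * r₀))).congr ?_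
    refine Filter.Eventually.of_forall fun r => ?_
    simp only [← Complex.exp_add]
    congr 1; ring
  exact (integrable_indicator_iff measurableSet_Iio).2 h2

theorem memLp_halfWave (hε : 0 < ε) : MemLp (halfWave ε M r₀) 2 volume := by
  have h := integrable_halfWave M r₀ hε
  refine (memLp_two_iff_integrable_sq_norm h.1).2 ?_
  refine h.norm.mono ((h.1.norm).pow 2) (Filter.Eventually.of_forall fun r => ?_)
  have h1 : ‖halfWave ε M r₀ r‖ ≤ 1 := by rw [norm_halfWave]; exact abs_cut_le r₀ hε r
  rw [norm_pow, norm_norm]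
  nlinarith [norm_nonneg (halfWave ε M r₀ r)]

theorem fourier_halfWave (hε : 0 < ε) (ξ : ℝ) : (1 / (((ξ - M : ℝ) : ℂ) + ε * Complex.I)) *
    (Real.fourierChar (-(r₀ * ξ)) : ℂ) = -(2 * Real.pi * Complex.I) * 𝓕 (halfWave ε M r₀) ξ := by
  have hpi := Real.pi_pos
  have hpi' : (Real.pi : ℂ) ≠ 0 := by exact_mod_cast hpi.ne'
  set c : ℂ := 2 * Real.pi * (ε + (M - ξ) * Complex.I) with hc
  have hre : 0 < c.re := by
    have : c.re = 2 * Real.pi * ε := by simp [hc]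
    rw [this]; positivity
  have hc0 : c ≠ 0 := fun h => by simp [h] at hre
  have hd0 : (((ξ - M : ℝ) : ℂ) + ε * Complex.I) ≠ 0 := by
    intro h
    have := congrArg Complex.im h
    simp at this
    exact hε.ne' this
  have h1 : 𝓕 (halfWave ε M r₀) ξ = ∫ r in Set.Iic r₀, Complex.exp (c * r) *
      Complex.exp (-(2 * Real.pi * (ε + M * Complex.I)) * r₀) := by
    rw [Real.fourier_real_eq, integral_Iic_eq_integral_Iio, ← integral_indicator measurableSet_Iio]
    refine integral_congr_ae (Filter.Eventually.of_forall fun r => ?_)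
    simp only [halfWave]
    by_cases h : r ∈ Set.Iio r₀
    · simp only [Set.indicator_of_mem h, Circle.smul_def, Real.fourierChar_apply, smul_eq_mul,
        ← Complex.exp_add]
      congr 1
      simp only [hc]; push_cast; ring
    · simp [Set.indicator_of_notMem h]
  rw [h1, integral_mul_const, integral_exp_mul_complex_Iic hre, Real.fourierChar_apply]
  have h2 : Complex.exp (c * r₀) / c * Complex.exp (-(2 * Real.pi * (ε + M * Complex.I)) * r₀) =
      Complex.exp (((2 * Real.pi * -(r₀ * ξ) : ℝ) : ℂ) * Complex.I) / c := by
    rw [div_mul_eq_mul_div, ← Complex.exp_add]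
    congr 2
    simp only [hc]; push_cast; ring
  rw [h2]
  have h3 : -(2 * Real.pi * Complex.I) * (((ξ - M : ℝ) : ℂ) + ε * Complex.I) = c := by
    simp only [hc]; push_cast; linear_combination (-2 * Real.pi * ε : ℂ) * Complex.I_sq
  rw [mul_div_assoc', ← h3, div_mul_eq_mul_div, one_mul, mul_div_mul_left]
  exact neg_ne_zero.2 (by simp [hpi'])

/-- The resolvent decays only like `1/|ξ|`, so it is square integrable without being integrable;
Plancherel gives this from `fourier_halfWave`. -/
theorem memLp_resolvent (hε : 0 < ε) :
    MemLp (fun ξ : ℝ => 1 / (((ξ - M : ℝ) : ℂ) + ε * Complex.I)) 2 volume := by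
  have h : (fun ξ : ℝ => 1 / (((ξ - M : ℝ) : ℂ) + ε * Complex.I)) =
      fun ξ => -(2 * Real.pi * Complex.I) * 𝓕 (halfWave ε M 0) ξ := by
    ext ξ
    rw [← fourier_halfWave M 0 hε]; simp
  rw [h]
  exact (memLp_fourier (integrable_halfWave M 0 hε) (memLp_halfWave M 0 hε)).const_mul _

/-- The resolvent of a first order operator as a superposition of half-line cut-offs. -/
theorem enorm_integral_resolvent_le (hε : 0 < ε) {f ψ : ℝ → ℂ} (hf : Integrable f)
    (hψ : Integrable ψ) (hψ2 : MemLp ψ 2 volume) :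
    ‖∫ ξ : ℝ, (1 / (((ξ - M : ℝ) : ℂ) + ε * Complex.I)) * (𝓕 f ξ * (starRingEnd ℂ) (𝓕 ψ ξ))‖ₑ ≤
      ENNReal.ofReal (2 * Real.pi) *
        ∫⁻ r₀, ‖f r₀‖ₑ * ‖𝓕 (fun r => (cut ε r₀ r : ℂ) * ψ r) M‖ₑ := by
  set b : ℝ → ℂ := fun ξ => 1 / (((ξ - M : ℝ) : ℂ) + ε * Complex.I) with hb
  -- Fubini is available because the resolvent and the transform of `ψ` are both in `L²`, so that
  -- their product is integrable.
  have hB : Integrable (fun ξ => b ξ * (starRingEnd ℂ) (𝓕 ψ ξ)) :=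
    (memLp_resolvent M hε).integrable_mul (memLp_fourier hψ hψ2).star
  have hprod : Integrable (fun p : ℝ × ℝ => (Real.fourierChar (-(p.2 * p.1)) : ℂ) *
      ((b p.1 * (starRingEnd ℂ) (𝓕 ψ p.1)) * f p.2)) := by
    refine (hB.mul_prod hf).bdd_mul (c := 1) ?_ ?_
    · exact (continuous_subtype_val.comp (Real.continuous_fourierChar.comp
        (by fun_prop : Continuous fun p : ℝ × ℝ => -(p.2 * p.1)))).aestronglyMeasurable
    · exact Filter.Eventually.of_forall fun p => (Circle.norm_coe _).le
  -- After the Fourier integral of `f` is inserted, its phase at `r₀` turns the resolvent into the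
  -- transform of `halfWave`, and Parseval evaluates the integral in `ξ`.
  have h1 : ∫ ξ, b ξ * (𝓕 f ξ * (starRingEnd ℂ) (𝓕 ψ ξ)) =
      ∫ r₀, f r₀ * (-(2 * Real.pi * Complex.I) *
        ∫ r, halfWave ε M r₀ r * (starRingEnd ℂ) (ψ r)) := by
    calc ∫ ξ, b ξ * (𝓕 f ξ * (starRingEnd ℂ) (𝓕 ψ ξ))
        = ∫ ξ, ∫ r₀, (Real.fourierChar (-(r₀ * ξ)) : ℂ) *
            ((b ξ * (starRingEnd ℂ) (𝓕 ψ ξ)) * f r₀) := by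
          refine integral_congr_ae (Filter.Eventually.of_forall fun ξ => ?_)
          simp only
          rw [Real.fourier_real_eq f, ← mul_assoc, mul_right_comm, ← integral_const_mul]
          refine integral_congr_ae (Filter.Eventually.of_forall fun r => ?_)
          simp only [Circle.smul_def, smul_eq_mul]; ring
      _ = ∫ r₀, ∫ ξ, (Real.fourierChar (-(r₀ * ξ)) : ℂ) *
            ((b ξ * (starRingEnd ℂ) (𝓕 ψ ξ)) * f r₀) := integral_integral_swap hprod
      _ = _ := by
          refine integral_congr_ae (Filter.Eventually.of_forall fun r₀ => ?_)
          simp only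
          rw [← integral_fourier_mul_conj_fourier (integrable_halfWave M r₀ hε)
            (memLp_halfWave M r₀ hε) hψ hψ2, ← integral_const_mul, ← integral_const_mul]
          refine integral_congr_ae (Filter.Eventually.of_forall fun ξ => ?_)
          simp only
          rw [← mul_assoc (-(2 * Real.pi * Complex.I)), ← fourier_halfWave M r₀ hε]
          simp only [hb]; ring
  -- The two sides differ by a conjugation and the unimodular phase at `r₀`. Only the modulus
  -- matters, so the oscillation of `halfWave` becomes evaluation at the frequency `M`.
  have h2 : ∀ r₀, ‖∫ r, halfWave ε M r₀ r * (starRingEnd ℂ) (ψ r)‖ₑ =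
      ‖𝓕 (fun r => (cut ε r₀ r : ℂ) * ψ r) M‖ₑ := by
    intro r₀
    have h3 : 𝓕 (fun r => (cut ε r₀ r : ℂ) * ψ r) M =
        (Real.fourierChar (-(r₀ * M)) : ℂ) *
        (starRingEnd ℂ) (∫ r, halfWave ε M r₀ r * (starRingEnd ℂ) (ψ r)) := by
      rw [← integral_conj, ← integral_const_mul, Real.fourier_real_eq]
      refine integral_congr_ae (Filter.Eventually.of_forall fun r => ?_)
      simp only [halfWave_eq, Circle.smul_def, Real.fourierChar_apply, smul_eq_mul, map_mul,
        Complex.conj_conj, Complex.conj_ofReal, ← Complex.exp_conj, map_sub, Complex.conj_I,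
        map_ofNat]
      have h4 : Complex.exp (((2 * Real.pi * -(r * M) : ℝ) : ℂ) * Complex.I) =
          Complex.exp (((2 * Real.pi * -(r₀ * M) : ℝ) : ℂ) * Complex.I) *
          Complex.exp (2 * Real.pi * M * -Complex.I * ((r : ℂ) - r₀)) := by
        rw [← Complex.exp_add]
        congr 1
        push_cast; ring
      rw [h4]; ring
    rw [h3, ← ofReal_norm, ← ofReal_norm, norm_mul, RCLike.norm_conj, Circle.norm_coe, one_mul]
  rw [h1]
  refine (enorm_integral_le_lintegral_enorm _).trans (le_of_eq ?_)
  rw [← lintegral_const_mul' _ _ ENNReal.ofReal_ne_top]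
  refine lintegral_congr fun r₀ => ?_
  rw [enorm_mul, enorm_mul, h2, ← ofReal_norm (-(2 * Real.pi * Complex.I))]
  have h4 : ‖(-(2 * Real.pi * Complex.I) : ℂ)‖ = 2 * Real.pi := by
    simp [abs_of_pos Real.pi_pos]
  rw [h4]; ring

end Resolvent

end LocalSmoothing

namespace LocalSmoothing

section Coordinates

/-- The coordinates of a point of space-time in the frame of `e`. -/
noncomputable def coords (e : Plane) (z : SpaceTime) : ℝ × Plane :=
  (z 0 * e 0 + z 1 * e 1, !₂[z 1 * e 0 - z 0 * e 1, z 2])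

variable {e : Plane}

theorem continuous_coords (e : Plane) : Continuous (coords e) := by
  unfold coords; fun_prop

theorem coords_frame (he : e ∈ Metric.sphere (0 : Plane) 1) (p : ℝ × Plane) :
    coords e (frame e p) = p := by
  have h := sq_add_sq_of_mem_sphere he
  refine Prod.ext ?_ ?_
  · simp [coords, frame, framePoint]; linear_combination p.1 * h
  · ext i
    fin_cases i
    · simp [coords, frame, framePoint]; linear_combination p.2 0 * h
    · simp [coords, frame, framePoint]

theorem frame_coords (he : e ∈ Metric.sphere (0 : Plane) 1) (z : SpaceTime) :
    frame e (coords e z) = z := by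
  have h := sq_add_sq_of_mem_sphere he
  ext i
  fin_cases i
  · simp [coords, frame, framePoint]; linear_combination z 0 * h
  · simp [coords, frame, framePoint]; linear_combination z 1 * h
  · simp [coords, frame, framePoint]

end Coordinates

/-! ### Cutting a function off to a half-space. -/

section CutFunctions

variable {e e' : Plane} {Ψ : SpaceTime → ℂ} {ε : ℝ}

/-- The function `Ψ` cut off to the half-space `x · e < r₀`. -/
noncomputable def cutFun (e : Plane) (ε r₀ : ℝ) (Ψ : SpaceTime → ℂ) (z : SpaceTime) : ℂ :=
  (cut ε r₀ (coords e z).1 : ℂ) * Ψ z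

/-- This pointwise bound makes the cut-off in direction `e` compatible with the norm of
`L^{1,2}_{e'}` for every other direction `e'`. -/
theorem enorm_cutFun_le (hε : 0 < ε) (r₀ : ℝ) (z : SpaceTime) :
    ‖cutFun e ε r₀ Ψ z‖ₑ ≤ ‖Ψ z‖ₑ := by
  rw [cutFun, enorm_mul]
  refine mul_le_of_le_one_left bot_le ?_
  rw [← ofReal_norm, Complex.norm_real, Real.norm_eq_abs]
  exact ENNReal.ofReal_le_one.2 (abs_cut_le _ hε _)

theorem stronglyMeasurable_cutFun_uncurry (hΨ : StronglyMeasurable Ψ) :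
    StronglyMeasurable (fun p : ℝ × SpaceTime => cutFun e ε p.1 Ψ p.2) := by
  refine StronglyMeasurable.mul ?_ (hΨ.comp_measurable measurable_snd)
  have h : Measurable (fun p : ℝ × SpaceTime => cut ε p.1 (coords e p.2).1) :=
    (measurable_cut ε).comp (measurable_fst.prodMk
      ((continuous_coords e).measurable.fst.comp measurable_snd))
  exact (Complex.measurable_ofReal.comp h).stronglyMeasurable

theorem IsNice.cutFun (hΨ : IsNice Ψ) (hε : 0 < ε) (r₀ : ℝ) :
    IsNice (cutFun e ε r₀ Ψ) := by
  have hm : StronglyMeasurable (LocalSmoothing.cutFun e ε r₀ Ψ) :=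
    (stronglyMeasurable_cutFun_uncurry hΨ.meas).comp_measurable measurable_prodMk_left
  have hle : ∀ z, ‖LocalSmoothing.cutFun e ε r₀ Ψ z‖ ≤ ‖Ψ z‖ := fun z => by
    have := enorm_cutFun_le (e := e) (Ψ := Ψ) hε r₀ z
    rwa [enorm_le_iff_norm_le] at this
  exact ⟨hm, hΨ.int.mono hm.aestronglyMeasurable (Filter.Eventually.of_forall hle),
    hΨ.memLp.mono hm.aestronglyMeasurable (Filter.Eventually.of_forall hle)⟩

theorem stronglyMeasurable_fourier_cutFun (hΨ : StronglyMeasurable Ψ) :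
    StronglyMeasurable (fun p : ℝ × SpaceTime => 𝓕 (cutFun e ε p.1 Ψ) p.2) := by
  have h : StronglyMeasurable (fun q : (ℝ × SpaceTime) × SpaceTime =>
      Real.fourierChar (-inner ℝ q.2 q.1.2) • cutFun e ε q.1.1 Ψ q.2) := by
    refine StronglyMeasurable.smul ?_ ?_
    · have hc : Continuous (fun q : (ℝ × SpaceTime) × SpaceTime => -inner ℝ q.2 q.1.2) := by
        fun_prop
      exact (continuous_subtype_val.comp (Real.continuous_fourierChar.comp hc)).stronglyMeasurable
    · exact (stronglyMeasurable_cutFun_uncurry hΨ).comp_measurable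
        (g := fun q : (ℝ × SpaceTime) × SpaceTime => (q.1.1, q.2)) (by fun_prop)
  simpa only [Real.fourier_eq] using h.integral_prod_right

/-- The cut-off depends only on `x·e`, hence is constant on each slice and commutes with the
transform along slices. -/
theorem fourier_cutFun_frame (he : e ∈ Metric.sphere (0 : Plane) 1) (hΨ : IsNice Ψ) (hε : 0 < ε)
    (r₀ m : ℝ) (y : Plane) :
    𝓕 (cutFun e ε r₀ Ψ) (frame e (m, y)) =
      𝓕 (fun r => (cut ε r₀ r : ℂ) * 𝓕 (slice e Ψ r) y) m := by
  rw [fourier_frame he (hΨ.cutFun hε r₀).int]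
  have h : (fun r => 𝓕 (slice e (cutFun e ε r₀ Ψ) r) y) =
      fun r => (cut ε r₀ r : ℂ) * 𝓕 (slice e Ψ r) y := by
    funext r
    simp only [Real.fourier_eq]
    rw [← integral_const_mul]
    refine integral_congr_ae (Filter.Eventually.of_forall fun v => ?_)
    simp only [slice, cutFun, coords_frame he, Circle.smul_def, smul_eq_mul]
    ring
  rw [h]

theorem integrable_fourier_slice (he : e ∈ Metric.sphere (0 : Plane) 1) (hΨ : IsNice Ψ)
    (y : Plane) : Integrable (fun r => 𝓕 (slice e Ψ r) y) := by
  have h := (integrable_frame he hΨ.int).norm.integral_prod_left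
  refine h.mono ((stronglyMeasurable_fourier_slice hΨ.meas).comp_measurable
    measurable_prodMk_right).aestronglyMeasurable (Filter.Eventually.of_forall fun r => ?_)
  rw [Real.norm_of_nonneg (integral_nonneg fun v => norm_nonneg _)]
  rw [Real.fourier_eq]
  refine (norm_integral_le_integral_norm _).trans (le_of_eq ?_)
  refine integral_congr_ae (Filter.Eventually.of_forall fun v => ?_)
  simp [slice, Circle.norm_smul]

theorem ae_memLp_fourier_slice (he : e ∈ Metric.sphere (0 : Plane) 1) (hΨ : IsNice Ψ) :
    ∀ᵐ y, MemLp (fun r => 𝓕 (slice e Ψ r) y) 2 volume := by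
  have hm := (stronglyMeasurable_fourier_slice (e := e) hΨ.meas).enorm.pow_const 2
  have h1 : ∫⁻ y, ∫⁻ r, ‖𝓕 (slice e Ψ r) y‖ₑ ^ 2 = eLpNorm Ψ 2 volume ^ 2 := by
    rw [eLpNorm_sq_eq_lintegral_slice he hΨ.meas, lintegral_lintegral_swap]
    · refine lintegral_congr_ae ?_
      filter_upwards [hΨ.ae_eLpNorm_fourier_slice he] with r hr
      rw [← hr, eLpNorm_two_sq]
    · exact (hm.comp measurable_swap).aemeasurable
  have h2 : ∫⁻ y, ∫⁻ r, ‖𝓕 (slice e Ψ r) y‖ₑ ^ 2 ≠ ⊤ := by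
    rw [h1]; exact ENNReal.pow_ne_top hΨ.memLp.2.ne
  filter_upwards [ae_lt_top (Measurable.lintegral_prod_left' hm) h2] with y hy
  refine ⟨((stronglyMeasurable_fourier_slice hΨ.meas).comp_measurable
    measurable_prodMk_right).aestronglyMeasurable, ?_⟩
  have h3 : eLpNorm (fun r => 𝓕 (slice e Ψ r) y) 2 volume ^ 2 < ⊤ := by
    rw [eLpNorm_two_sq]; exact hy
  simpa [ENNReal.pow_lt_top_iff] using h3

end CutFunctions

/-! ### The bilinear estimate for the principal part. -/

section MainTerm

/-- The principal part `A(y) / (ξ - M(y) + iε)` of the multiplier in the frame of `e`. -/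
noncomputable def mainMult (e : Plane) (A : Plane → ℂ) (M : Plane → ℝ) (ε : ℝ) (z : SpaceTime) :
    ℂ :=
  A (coords e z).2 * (1 / ((((coords e z).1 - M (coords e z).2 : ℝ) : ℂ) + ε * Complex.I))

theorem norm_resolvent_le {ε : ℝ} (hε : 0 < ε) (x : ℝ) :
    ‖1 / ((x : ℂ) + ε * Complex.I)‖ ≤ 1 / ε := by
  rw [norm_div, norm_one]
  refine one_div_le_one_div_of_le hε ?_
  have h := Complex.abs_im_le_norm ((x : ℂ) + ε * Complex.I)
  simpa [abs_of_pos hε] using h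

variable {e e' : Plane} {F Ψ : SpaceTime → ℂ} {ε : ℝ} {A : Plane → ℂ} {M : Plane → ℝ}

theorem measurable_mainMult (hA : Measurable A) (hM : Measurable M) (ε : ℝ) :
    Measurable (mainMult e A M ε) := by
  have h1 : Measurable (fun z => (coords e z).1) := (continuous_coords e).measurable.fst
  have h2 : Measurable (fun z => (coords e z).2) := (continuous_coords e).measurable.snd
  have h3 := hA.comp h2
  have h4 := hM.comp h2
  unfold mainMult
  refine h3.mul (measurable_const.div (Measurable.add ?_ measurable_const))
  exact Complex.measurable_ofReal.comp (h1.sub h4)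

theorem norm_mainMult_le (hε : 0 < ε) {a : ℝ} (ha : ∀ y, ‖A y‖ ≤ a) (z : SpaceTime) :
    ‖mainMult e A M ε z‖ ≤ a * (1 / ε) := by
  rw [mainMult, norm_mul]
  exact mul_le_mul (ha _) (norm_resolvent_le hε _) (norm_nonneg _) ((norm_nonneg _).trans (ha 0))

/-- The bilinear estimate for the principal part of the multiplier. -/
theorem enorm_integral_mainMult_le (he : e ∈ Metric.sphere (0 : Plane) 1)
    (he' : e' ∈ Metric.sphere (0 : Plane) 1) (hε : 0 < ε) (hA : Measurable A) (hM : Measurable M)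
    {l l' Λ σ c : ℝ} (hl : 0 < l) (hl' : 0 < l') (hσ : |σ| = 1) (hc : 0 ≤ c) (hΛ : 0 ≤ Λ)
    (hcl : (1 / (2 * l)) ^ 2 * (2 * Λ) * (1 / l') ≤ c ^ 2)
    (hroot : ∀ y, A y ≠ 0 → symbolP (frame e (M y, y)) = 0)
    (hlow : ∀ y, A y ≠ 0 → l ≤ σ * slope e (frame e (M y, y)))
    (hup : ∀ y, A y ≠ 0 → σ * slope e (frame e (M y, y)) ≤ Λ)
    (hslope : ∀ y, A y ≠ 0 → l' ≤ |slope e' (frame e (M y, y))|)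
    (hAle : ∀ y, ‖A y‖ ≤ 1 / (2 * l))
    (hF : IsNice F) (hΨ : IsNice Ψ) :
    ‖∫ z, mainMult e A M ε z * (𝓕 F z * (starRingEnd ℂ) (𝓕 Ψ z))‖ₑ ≤
      ENNReal.ofReal (2 * Real.pi * c) * mixedNorm 1 2 e F * mixedNorm 1 2 e' Ψ := by
  have hFΨ : Integrable (fun z => 𝓕 F z * (starRingEnd ℂ) (𝓕 Ψ z)) :=
    (memLp_fourier hF.int hF.memLp).integrable_mul (memLp_fourier hΨ.int hΨ.memLp).star
  have hint : Integrable (fun z => mainMult e A M ε z * (𝓕 F z * (starRingEnd ℂ) (𝓕 Ψ z))) :=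
    hFΨ.bdd_mul (measurable_mainMult hA hM ε).aestronglyMeasurable
      (Filter.Eventually.of_forall (norm_mainMult_le hε hAle))
  -- The amplitude times the trace on `P = 0` of the transform of the cut function. The claim
  -- reduces to an `L²` bound for `K r₀` uniform in `r₀`.
  let K : ℝ → Plane → ℝ≥0∞ := fun r₀ y => ‖A y‖ₑ * ‖𝓕 (cutFun e ε r₀ Ψ) (frame e (M y, y))‖ₑ
  have hKm : Measurable (Function.uncurry K) := by
    refine (hA.enorm.comp measurable_snd).mul ?_
    refine ((stronglyMeasurable_fourier_cutFun hΨ.meas).comp_measurable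
      (g := fun p : ℝ × Plane => (p.1, frame e (M p.2, p.2))) ?_).enorm
    refine measurable_fst.prodMk ((continuous_frame e).measurable.comp ?_)
    exact (hM.comp measurable_snd).prodMk measurable_snd
  have hKy : ∀ r₀, Measurable (K r₀) := fun r₀ => hKm.comp measurable_prodMk_left
  have hFm : Measurable (fun p : ℝ × Plane => ‖𝓕 (slice e F p.1) p.2‖ₑ) :=
    (stronglyMeasurable_fourier_slice hF.meas).enorm
  have hK2 : ∀ r₀, eLpNorm (K r₀) 2 volume ≤ ENNReal.ofReal c * mixedNorm 1 2 e' Ψ := by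
    intro r₀
    refine eLpNorm_le_of_lintegral_sq_le hc ?_
    have hG : MeasurableSet {y | A y ≠ 0} := hA (measurableSet_singleton (0 : ℂ)).compl
    have hs : MeasurableSet {z : SpaceTime | l' ≤ |slope e' z|} :=
      measurableSet_le measurable_const (continuous_slope e').abs.measurable
    have hnice := hΨ.cutFun (e := e) hε r₀
    calc ∫⁻ y, ‖K r₀ y‖ₑ ^ 2
        ≤ ∫⁻ y, {y | A y ≠ 0}.indicator (fun y => ENNReal.ofReal ((1 / (2 * l)) ^ 2) *
          {z | l' ≤ |slope e' z|}.indicator (fun z => ‖𝓕 (cutFun e ε r₀ Ψ) z‖ₑ ^ 2)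
            (frame e (M y, y))) y := by
          refine lintegral_mono fun y => ?_
          by_cases hy : A y = 0
          · simp [K, hy]
          · rw [Set.indicator_of_mem (show y ∈ {y | A y ≠ 0} from hy),
              Set.indicator_of_mem (show frame e (M y, y) ∈ {z | l' ≤ |slope e' z|} from
                hslope y hy)]
            simp only [K, enorm_eq_self, mul_pow]
            gcongr
            rw [ENNReal.ofReal_pow (by positivity)]
            gcongr
            rw [← ofReal_norm]
            exact ENNReal.ofReal_le_ofReal (hAle y)
      _ = ENNReal.ofReal ((1 / (2 * l)) ^ 2) * ∫⁻ y in {y | A y ≠ 0},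
          {z | l' ≤ |slope e' z|}.indicator (fun z => ‖𝓕 (cutFun e ε r₀ Ψ) z‖ₑ ^ 2)
            (frame e (M y, y)) := by
          rw [lintegral_indicator hG, lintegral_const_mul' _ _ ENNReal.ofReal_ne_top]
      _ ≤ ENNReal.ofReal ((1 / (2 * l)) ^ 2) * (ENNReal.ofReal (2 * Λ) * (ENNReal.ofReal (1 / l') *
          mixedNorm 1 2 e' Ψ ^ 2)) := by
          gcongr
          -- The frame of `e` is left for the surface at the cost `2Λ`, and the surface for the
          -- frame of `e'` at the cost `1/l'`. With `‖A‖² ≤ (1/(2l))²` this is the left side of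
          -- `hcl`.
          refine (lintegral_root_le he hl hσ hM hG hroot hlow hup
            ((measurable_enorm_fourier_sq hnice.int).indicator hs)).trans ?_
          gcongr
          refine (lintegral_surf_fourier_le he' hl' hnice).trans ?_
          gcongr
          exact mixedNorm_mono e' (enorm_cutFun_le hε r₀)
      _ = ENNReal.ofReal ((1 / (2 * l)) ^ 2 * (2 * Λ) * (1 / l')) * mixedNorm 1 2 e' Ψ ^ 2 := by
          rw [ENNReal.ofReal_mul (q := 1 / l') (by positivity),
            ENNReal.ofReal_mul (q := 2 * Λ) (by positivity)]
          ring
      _ ≤ _ := by gcongr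
  have hfrint := (measurePreserving_frame he).integral_comp (measurableEmbedding_frame he)
    (fun z => mainMult e A M ε z * (𝓕 F z * (starRingEnd ℂ) (𝓕 Ψ z)))
  rw [← hfrint, Measure.volume_eq_prod, integral_prod_symm _ (integrable_frame he hint)]
  calc _ ≤ ∫⁻ y : Plane, ‖∫ ξ : ℝ, mainMult e A M ε (frame e (ξ, y)) *
        (𝓕 F (frame e (ξ, y)) * (starRingEnd ℂ) (𝓕 Ψ (frame e (ξ, y))))‖ₑ :=
        enorm_integral_le_lintegral_enorm _
    _ ≤ ∫⁻ y : Plane, ENNReal.ofReal (2 * Real.pi) *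
        ∫⁻ r₀, ‖𝓕 (slice e F r₀) y‖ₑ * K r₀ y := by
        refine lintegral_mono_ae ?_
        filter_upwards [ae_memLp_fourier_slice he hΨ] with y hy
        have h1 := enorm_integral_resolvent_le (M y) hε (integrable_fourier_slice he hF y)
          (integrable_fourier_slice he hΨ y) hy
        have h2 : ∫ ξ : ℝ, mainMult e A M ε (frame e (ξ, y)) *
            (𝓕 F (frame e (ξ, y)) * (starRingEnd ℂ) (𝓕 Ψ (frame e (ξ, y)))) =
            A y * ∫ ξ : ℝ, (1 / (((ξ - M y : ℝ) : ℂ) + ε * Complex.I)) *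
              (𝓕 (fun r => 𝓕 (slice e F r) y) ξ *
                (starRingEnd ℂ) (𝓕 (fun r => 𝓕 (slice e Ψ r) y) ξ)) := by
          rw [← integral_const_mul]
          refine integral_congr_ae (Filter.Eventually.of_forall fun ξ => ?_)
          simp only [mainMult, coords_frame he, fourier_frame he hF.int, fourier_frame he hΨ.int]
          ring
        rw [h2, enorm_mul]
        refine (mul_le_mul_right h1 _).trans (le_of_eq ?_)
        rw [mul_left_comm, ← lintegral_const_mul' _ _ enorm_ne_top]
        congr 1
        refine lintegral_congr fun r₀ => ?_
        simp only [K, fourier_cutFun_frame he hΨ hε]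
        ring
    _ = ENNReal.ofReal (2 * Real.pi) * ∫⁻ r₀, ∫⁻ y, ‖𝓕 (slice e F r₀) y‖ₑ * K r₀ y := by
        rw [lintegral_const_mul' _ _ ENNReal.ofReal_ne_top, lintegral_lintegral_swap]
        exact ((hFm.mul hKm).comp measurable_swap).aemeasurable
    _ ≤ ENNReal.ofReal (2 * Real.pi) * ∫⁻ r₀, eLpNorm (slice e F r₀) 2 volume *
        (ENNReal.ofReal c * mixedNorm 1 2 e' Ψ) := by
        gcongr ENNReal.ofReal _ * ?_
        refine lintegral_mono_ae ?_
        filter_upwards [hF.ae_eLpNorm_fourier_slice he] with r₀ hr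
        have h1 := lintegral_mul_le_eLpNorm_mul_eLpNorm (μ := volume)
          (f := fun y => ‖𝓕 (slice e F r₀) y‖ₑ) (g := K r₀)
          (hFm.comp measurable_prodMk_left).aemeasurable (hKy r₀).aemeasurable
        rw [eLpNorm_enorm, hr] at h1
        exact h1.trans (mul_le_mul_right (hK2 r₀) _)
    _ = _ := by
        rw [lintegral_mul_const _ (measurable_eLpNorm_slice hF.meas), ← mixedNorm_one,
          ENNReal.ofReal_mul (q := c) (by positivity)]
        ring

end MainTerm

end LocalSmoothing

namespace LocalSmoothing

/-! ### Exact expansion of `P` along lines, its roots, and the residues at the roots. -/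

section Expansion

variable {e e' : Plane}

theorem slope_frame_sub (e : Plane) (ξ m : ℝ) (y : Plane) :
    slope e (frame e (ξ, y)) = slope e (frame e (m, y)) + cosTwo e * (ξ - m) := by
  simp only [slope_frame]; ring

theorem symbolP_frame_sub (e : Plane) (ξ m : ℝ) (y : Plane) :
    symbolP (frame e (ξ, y)) = symbolP (frame e (m, y)) +
      2 * slope e (frame e (m, y)) * (ξ - m) + cosTwo e * (ξ - m) ^ 2 := by
  simp only [slope_frame, symbolP_frame]; ring

/-- Along `e` the slope for `e'` grows at the rate `e·ē'`, of absolute value at most one. -/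
theorem abs_slope_frame_sub_le (he : e ∈ Metric.sphere (0 : Plane) 1)
    (he' : e' ∈ Metric.sphere (0 : Plane) 1) (ξ m : ℝ) (y : Plane) :
    |slope e' (frame e (ξ, y)) - slope e' (frame e (m, y))| ≤ |ξ - m| := by
  have h : slope e' (frame e (ξ, y)) - slope e' (frame e (m, y)) =
      (e 0 * e' 0 - e 1 * e' 1) * (ξ - m) := by
    simp [slope_eq, frame, framePoint]; ring
  have h1 := sq_add_sq_of_mem_sphere he
  have h2 := sq_add_sq_of_mem_sphere he'
  have h3 : |e 0 * e' 0 - e 1 * e' 1| ≤ 1 := by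
    refine abs_le_one_iff_mul_self_le_one.2 ?_
    nlinarith [sq_nonneg (e 0 * e' 1 + e 1 * e' 0)]
  rw [h, abs_mul]
  exact mul_le_of_le_one_left (abs_nonneg _) h3

theorem abs_slope_le (he : e ∈ Metric.sphere (0 : Plane) 1) (z : SpaceTime) :
    |slope e z| ≤ ‖space z‖ := by
  refine abs_le_of_sq_le_sq ?_ (norm_nonneg _)
  have h := sq_add_sq_of_mem_sphere he
  rw [norm_space_sq, slope_eq]
  nlinarith [sq_nonneg (z 0 * e 1 + z 1 * e 0)]

theorem abs_fst_le_norm_space (he : e ∈ Metric.sphere (0 : Plane) 1) (p : ℝ × Plane) :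
    |p.1| ≤ ‖space (frame e p)‖ :=
  abs_le_of_sq_le_sq (by rw [norm_space_frame_sq he]; nlinarith [sq_nonneg (p.2 0)])
    (norm_nonneg _)

end Expansion

section Root

/-- The root of `P` along the line through `y` in the direction `e`, on the branch where the slope
has the sign `σ`. -/
noncomputable def branch (e : Plane) (σ : ℝ) (y : Plane) : ℝ :=
  if cosTwo e = 0 then -y 1 / (2 * negSinTwo e * y 0)
  else (σ * √(y 0 ^ 2 - cosTwo e * y 1) - negSinTwo e * y 0) / cosTwo e

variable {e e' : Plane} {σ : ℝ}

theorem measurable_branch (e : Plane) (σ : ℝ) : Measurable (branch e σ) := by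
  unfold branch
  split_ifs
  · fun_prop
  · fun_prop

/-- The sign of the slope tells the two roots apart, so the explicit formula recovers any root with
slope of sign `σ`. -/
theorem branch_eq (he : e ∈ Metric.sphere (0 : Plane) 1) (hσ : |σ| = 1) {m : ℝ} {y : Plane}
    (hroot : symbolP (frame e (m, y)) = 0) (hs : 0 < σ * slope e (frame e (m, y))) :
    branch e σ y = m := by
  have hab := cosTwo_sq_add he
  have hσ2 : σ * σ = 1 := by rw [← abs_mul_abs_self, hσ, one_mul]
  rw [symbolP_frame] at hroot
  rw [slope_frame] at hs
  simp only at hroot hs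
  unfold branch
  split_ifs with h
  · rw [h] at hroot hs
    have h0 : 2 * negSinTwo e * y 0 ≠ 0 := by
      intro h0
      have : negSinTwo e * y 0 = 0 := by linarith
      simp [this] at hs
    rw [div_eq_iff h0]
    linarith
  -- At a root the radicand is the square of the slope, by `cos² + sin² = 1`.
  · have h1 : y 0 ^ 2 - cosTwo e * y 1 = (σ * (cosTwo e * m + negSinTwo e * y 0)) ^ 2 := by
      have : (σ * (cosTwo e * m + negSinTwo e * y 0)) ^ 2 =
        (cosTwo e * m + negSinTwo e * y 0) ^ 2 := by
          linear_combination ((cosTwo e * m + negSinTwo e * y 0) ^ 2) * hσ2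
      rw [this]
      linear_combination (-(y 0 ^ 2)) * hab - cosTwo e * hroot
    rw [h1, Real.sqrt_sq hs.le, div_eq_iff h]
    linear_combination (cosTwo e * m + negSinTwo e * y 0) * hσ2

/-- A point near the surface `P = 0` is close to a root along the direction `e`. -/
theorem exists_root (he : e ∈ Metric.sphere (0 : Plane) 1) {ξ : ℝ} {y : Plane}
    (hs : slope e (frame e (ξ, y)) ≠ 0)
    (hP : |symbolP (frame e (ξ, y))| ≤ slope e (frame e (ξ, y)) ^ 2) :
    ∃ m, symbolP (frame e (m, y)) = 0 ∧
      |m - ξ| ≤ |symbolP (frame e (ξ, y))| / |slope e (frame e (ξ, y))| := by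
  set s := slope e (frame e (ξ, y)) with hsdef
  set P := symbolP (frame e (ξ, y)) with hPdef
  have hs' : 0 < |s| := abs_pos.2 hs
  set t := |P| / |s| with ht
  have ht0 : 0 ≤ t := by positivity
  have hts : t * |s| = |P| := by rw [ht]; field_simp
  have ht2 : t ^ 2 ≤ |P| := by
    have h1 : t ≤ |s| := by
      rw [ht, div_le_iff₀ hs']; rw [← sq_abs] at hP; linarith [sq (|s|)]
    nlinarith
  have hexp : ∀ m, symbolP (frame e (m, y)) = P + 2 * s * (m - ξ) + cosTwo e * (m - ξ) ^ 2 :=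
    fun m => symbolP_frame_sub e m ξ y
  have ha := abs_le.1 (abs_cosTwo_le he)
  have hcont : Continuous (fun m => symbolP (frame e (m, y))) := by
    simp_rw [hexp]; fun_prop
  have hat : |cosTwo e * t ^ 2| ≤ |P| := by
    rw [abs_mul, abs_of_nonneg (sq_nonneg t)]
    exact (mul_le_of_le_one_left (sq_nonneg t) (abs_cosTwo_le he)).trans ht2
  have hat' := abs_le.1 hat
  have hP' := abs_le.1 (le_refl |P|)
  -- At `ξ ± t` the linear term is `±2|P|` up to a common sign. It dominates the constant term and
  -- the quadratic term, each of size at most `|P|`, so `P` changes sign in between.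
  have h1 : ∃ m ∈ Set.uIcc (ξ - t) (ξ + t), symbolP (frame e (m, y)) = 0 := by
    have h0 : (0 : ℝ) ∈ Set.uIcc (symbolP (frame e (ξ - t, y))) (symbolP (frame e (ξ + t, y))) := by
      rw [hexp, hexp]
      rcases abs_cases s with ⟨h, _⟩ | ⟨h, _⟩
      · rw [h] at hts
        refine Set.mem_uIcc.2 (Or.inl ⟨?_, ?_⟩) <;> ring_nf <;> ring_nf at hts hat' <;> nlinarith
      · rw [h] at hts
        refine Set.mem_uIcc.2 (Or.inr ⟨?_, ?_⟩) <;> ring_nf <;> ring_nf at hts hat' <;> nlinarith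
    obtain ⟨m, hm, hm'⟩ := intermediate_value_uIcc hcont.continuousOn h0
    exact ⟨m, hm, hm'⟩
  obtain ⟨m, hm, hm0⟩ := h1
  rw [Set.uIcc_of_le (by linarith)] at hm
  exact ⟨m, hm0, abs_le.2 ⟨by linarith [hm.1], by linarith [hm.2]⟩⟩

end Root

section Amplitude

/-- The residue of the multiplier at the root `branch e σ y`, at the frequency scale `2 ^ k`. -/
noncomputable def amp (η₀ : ℝ → ℝ) (k : ℕ) (e e' : Plane) (σ : ℝ) (y : Plane) : ℂ :=
  -- The first condition discards the values of `branch` that are not roots, where the radicand is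
  -- negative or the denominator vanishes.
  {y | symbolP (frame e (branch e σ y, y)) = 0 ∧
      2 ^ k / 8 ≤ σ * slope e (frame e (branch e σ y, y)) ∧
      ‖space (frame e (branch e σ y, y))‖ ≤ 8 * 2 ^ k}.indicator
    (fun y => ((chi η₀ k 30 (slope e' (frame e (branch e σ y, y))) /
      (2 * slope e (frame e (branch e σ y, y))) : ℝ) : ℂ)) y

variable {η₀ : ℝ → ℝ} {k : ℕ} {e e' : Plane} {σ : ℝ}

theorem measurable_amp (hη : IsCutoff η₀) : Measurable (amp η₀ k e e' σ) := by
  have hfr : Measurable (fun y => frame e (branch e σ y, y)) :=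
    (continuous_frame e).measurable.comp ((measurable_branch e σ).prodMk measurable_id)
  have h1 := continuous_symbolP.measurable.comp hfr
  have h2 := (continuous_slope e).measurable.comp hfr
  have h3 := continuous_space.norm.measurable.comp hfr
  have h4 := ((hη.continuous_chi k 30).comp (continuous_slope e')).measurable.comp hfr
  refine Measurable.indicator ?_ ?_
  · exact Complex.measurable_ofReal.comp (h4.div (h2.const_mul 2))
  · exact (measurableSet_eq_fun h1 measurable_const).inter
      ((measurableSet_le measurable_const (h2.const_mul σ)).inter
        (measurableSet_le h3 measurable_const))

theorem amp_ne_zero {y : Plane} (h : amp η₀ k e e' σ y ≠ 0) :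
    (symbolP (frame e (branch e σ y, y)) = 0 ∧
      2 ^ k / 8 ≤ σ * slope e (frame e (branch e σ y, y)) ∧
      ‖space (frame e (branch e σ y, y))‖ ≤ 8 * 2 ^ k) ∧
    chi η₀ k 30 (slope e' (frame e (branch e σ y, y))) ≠ 0 := by
  unfold amp at h
  have h1 := Set.mem_of_indicator_ne_zero h
  refine ⟨h1, fun h2 => h ?_⟩
  rw [Set.indicator_of_mem h1, h2]; simp

theorem norm_amp_le (hη : IsCutoff η₀) (hσ : |σ| = 1) (y : Plane) :
    ‖amp η₀ k e e' σ y‖ ≤ 1 / (2 * (2 ^ k / 8)) := by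
  by_cases h : amp η₀ k e e' σ y = 0
  · rw [h, norm_zero]; positivity
  have h1 := (amp_ne_zero h).1
  unfold amp
  rw [Set.indicator_of_mem (show y ∈ _ from h1), Complex.norm_real, Real.norm_eq_abs, abs_div]
  have h2 : |slope e (frame e (branch e σ y, y))| = |σ * slope e (frame e (branch e σ y, y))| := by
    rw [abs_mul, hσ, one_mul]
  have h3 : 2 * (2 ^ k / 8) ≤ |2 * slope e (frame e (branch e σ y, y))| := by
    rw [abs_mul, h2, abs_two]
    gcongr
    exact h1.2.1.trans (le_abs_self _)
  exact div_le_div₀ zero_le_one (hη.abs_chi_le _ _ _) (by positivity) h3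

/-- The bilinear estimate for the principal part of the multiplier `χ / (P + i)`. -/
theorem enorm_integral_amp_le (hη : IsCutoff η₀) (hk : 100 ≤ k)
    (he : e ∈ Metric.sphere (0 : Plane) 1) (he' : e' ∈ Metric.sphere (0 : Plane) 1) (hσ : |σ| = 1)
    {F Ψ : SpaceTime → ℂ} (hF : IsNice F) (hΨ : IsNice Ψ) :
    ‖∫ z, mainMult e (amp η₀ k e e' σ) (branch e σ) (1 / 2 ^ k) z *
        (𝓕 F z * (starRingEnd ℂ) (𝓕 Ψ z))‖ₑ ≤
      ENNReal.ofReal (2 * Real.pi * (2 ^ 20 / 2 ^ k)) * mixedNorm 1 2 e F *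
        mixedNorm 1 2 e' Ψ := by
  have hN : (0 : ℝ) < 2 ^ k := by positivity
  refine enorm_integral_mainMult_le he he' (l := 2 ^ k / 8) (l' := 2 ^ k / 2 ^ 31)
    (Λ := 8 * 2 ^ k) (σ := σ) (by positivity) (measurable_amp hη)
    (measurable_branch e σ) (by positivity) (by positivity) hσ (by positivity) (by positivity) ?_
    (fun y h => (amp_ne_zero h).1.1) (fun y h => (amp_ne_zero h).1.2.1) (fun y h => ?_)
    (fun y h => (hη.lt_of_chi_ne_zero hk (amp_ne_zero h).2).le) (norm_amp_le hη hσ) hF hΨ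
  -- With `N = 2^k` the product is `(16/N²) · (16 N) · (2^31/N) = 2^39/N²`, below `(2^20/N)²`.
  · field_simp
    norm_num
  · refine (le_abs_self _).trans ?_
    rw [abs_mul, hσ, one_mul]
    exact (abs_slope_le he _).trans (amp_ne_zero h).1.2.2

end Amplitude

end LocalSmoothing

namespace LocalSmoothing

/-! ### Pointwise comparison of `χ/(P+i)` with its principal part. -/

section ErrorTerm

theorem abs_le_norm_add_I (P : ℝ) : |P| ≤ ‖(P : ℂ) + Complex.I‖ := by
  simpa using Complex.abs_re_le_norm ((P : ℂ) + Complex.I)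

theorem one_le_norm_add_I (P : ℝ) : 1 ≤ ‖(P : ℂ) + Complex.I‖ := by
  simpa using Complex.abs_im_le_norm ((P : ℂ) + Complex.I)

theorem norm_add_I_sq (P : ℝ) : ‖(P : ℂ) + Complex.I‖ ^ 2 = 1 + P ^ 2 := by
  rw [← Complex.normSq_eq_norm_sq, Complex.normSq_apply]; simp; ring

/-- Comparison of `1 / (P + i)` with the resolvent of the linearisation of `P` at a root. -/
theorem norm_resolvent_sub_le {N P ζ s a : ℝ} (hN : 0 < N) (hP : P = 2 * s * ζ + a * ζ ^ 2)
    (ha : |a| ≤ 1) (hs : N / 8 ≤ |s|) (hs' : |s| ≤ 8 * N) (hζ : |ζ| ≤ 16 * N)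
    (hPζ : N * |ζ| ≤ 8 * |P|) :
    ‖1 / ((P : ℂ) + Complex.I) - 1 / (2 * s * ((ζ : ℂ) + (1 / N : ℝ) * Complex.I))‖ ≤
      32 / N ^ 2 + 4352 / (1 + P ^ 2) := by
  set X : ℂ := (P : ℂ) + Complex.I with hX
  set Y : ℂ := 2 * s * ((ζ : ℂ) + (1 / N : ℝ) * Complex.I) with hY
  have hX1 := one_le_norm_add_I P
  have hXP := abs_le_norm_add_I P
  have hX2 := norm_add_I_sq P
  rw [← hX] at hX1 hXP hX2
  have hYn : ‖Y‖ = 2 * |s| * ‖(ζ : ℂ) + (1 / N : ℝ) * Complex.I‖ := by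
    rw [hY, norm_mul, norm_mul, Complex.norm_real, Real.norm_eq_abs]; simp
  have hY1 : N / 4 * |ζ| ≤ ‖Y‖ := by
    have h : |ζ| ≤ ‖(ζ : ℂ) + (1 / N : ℝ) * Complex.I‖ := by
      simpa using Complex.abs_re_le_norm ((ζ : ℂ) + (1 / N : ℝ) * Complex.I)
    rw [hYn]
    exact mul_le_mul (by linarith) h (abs_nonneg _) (by positivity)
  have hY2 : 1 / 4 ≤ ‖Y‖ := by
    have h : 1 / N ≤ ‖(ζ : ℂ) + (1 / N : ℝ) * Complex.I‖ := by
      simpa [abs_of_pos hN] using Complex.abs_im_le_norm ((ζ : ℂ) + (1 / N : ℝ) * Complex.I)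
    rw [hYn]
    calc (1 : ℝ) / 4 = N / 4 * (1 / N) := by field_simp
      _ ≤ _ := mul_le_mul (by linarith) h (by positivity) (by positivity)
  have hX0 : X ≠ 0 := fun h => by rw [h, norm_zero] at hX1; linarith
  have hY0 : Y ≠ 0 := fun h => by rw [h, norm_zero] at hY2; linarith
  -- With the regularisation `1/N` the imaginary part `2s/N` is bounded, like that of `P + i`. In
  -- `(Y - X)/(X Y)` the part `ζ²` is then absorbed by `N|ζ| ≲ |X|, |Y|`, and the bounded part by
  -- `|X| ≲ |Y|`.
  have hXY : ‖Y - X‖ ≤ |ζ| ^ 2 + 17 := by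
    have h : Y - X = ((-(a * ζ ^ 2) : ℝ) : ℂ) + ((2 * s / N - 1 : ℝ) : ℂ) * Complex.I := by
      rw [hX, hY, hP]; push_cast; ring
    rw [h]
    refine (norm_add_le _ _).trans (add_le_add ?_ ?_)
    · rw [Complex.norm_real, Real.norm_eq_abs, abs_neg, abs_mul, abs_pow]
      exact mul_le_of_le_one_left (by positivity) ha
    · rw [norm_mul, Complex.norm_real, Real.norm_eq_abs, Complex.norm_I, mul_one]
      have h2 : |2 * s / N| ≤ 16 := by
        rw [abs_div, abs_mul, abs_two, abs_of_pos hN, div_le_iff₀ hN]; linarith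
      have := abs_le.1 h2
      exact abs_le.2 ⟨by linarith, by linarith⟩
  have hXle : ‖X‖ ≤ 256 * ‖Y‖ := by
    have h1 : ‖X‖ ≤ |P| + 1 := by
      refine (norm_add_le _ _).trans ?_
      simp
    have h2 : |P| ≤ 32 * N * |ζ| := by
      rw [hP]
      refine (abs_add_le _ _).trans ?_
      rw [abs_mul, abs_mul, abs_two, abs_mul, abs_pow]
      have h3 : 2 * |s| * |ζ| ≤ 16 * N * |ζ| := by
        have := mul_le_mul_of_nonneg_right hs' (abs_nonneg ζ)
        linarith
      have h4 : |a| * |ζ| ^ 2 ≤ 16 * N * |ζ| := by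
        calc |a| * |ζ| ^ 2 ≤ 1 * |ζ| ^ 2 := by gcongr
          _ = |ζ| * |ζ| := by ring
          _ ≤ 16 * N * |ζ| := by gcongr
      linarith
    linarith
  have hdiff : 1 / X - 1 / Y = (Y - X) / (X * Y) := by field_simp
  have hXpos : 0 < ‖X‖ := by linarith
  have hYpos : 0 < ‖Y‖ := by linarith
  rw [hdiff, norm_div, norm_mul, ← hX2]
  calc ‖Y - X‖ / (‖X‖ * ‖Y‖) ≤ (|ζ| ^ 2 + 17) / (‖X‖ * ‖Y‖) := by gcongr
    _ = |ζ| ^ 2 / (‖X‖ * ‖Y‖) + 17 / (‖X‖ * ‖Y‖) := add_div _ _ _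
    _ ≤ _ := by
        refine add_le_add ?_ ?_
        · rw [div_le_div_iff₀ (by positivity) (by positivity)]
          have h1 : N * |ζ| ≤ 8 * ‖X‖ := hPζ.trans (by linarith)
          have h2 : N * |ζ| ≤ 4 * ‖Y‖ := by linarith
          calc |ζ| ^ 2 * N ^ 2 = (N * |ζ|) * (N * |ζ|) := by ring
            _ ≤ (8 * ‖X‖) * (4 * ‖Y‖) := mul_le_mul h1 h2 (by positivity) (by positivity)
            _ = _ := by ring
        · rw [div_le_div_iff₀ (by positivity) (by positivity)]
          nlinarith

variable {η₀ : ℝ → ℝ} {k : ℕ} {e e' : Plane} {σ : ℝ}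

theorem IsCutoff.exists_lipschitz (hη : IsCutoff η₀) :
    ∃ K : ℝ, 0 ≤ K ∧ ∀ x y, |η₀ x - η₀ y| ≤ K * |x - y| := by
  have hc : HasCompactSupport η₀ := HasCompactSupport.of_support_subset_isCompact
    (isCompact_Icc (a := (-2 : ℝ)) (b := 2)) (fun x hx => by
      by_contra h
      refine hx (hη.eq_zero x ?_)
      rw [Set.mem_Icc, ← abs_le] at h
      exact not_le.1 h)
  obtain ⟨K, hK⟩ := ContDiff.lipschitzWith_of_hasCompactSupport hc
    hη.smooth (by simp)
  exact ⟨K, K.2, fun x y => by simpa [Real.dist_eq] using hK.dist_le_mul x y⟩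

theorem abs_chi_sub_le (hk : 100 ≤ k) {K : ℝ}
    (hK : ∀ x y, |η₀ x - η₀ y| ≤ K * |x - y|) (x y : ℝ) :
    |chi η₀ k 30 x - chi η₀ k 30 y| ≤ K * 2 ^ 30 / 2 ^ k * |x - y| := by
  have hN : (0 : ℝ) < 2 ^ k := by positivity
  simp only [chi, if_pos hk, two_zpow_sub]
  have h := hK (y / (2 ^ k / 2 ^ 30)) (x / (2 ^ k / 2 ^ 30))
  rw [← sub_div, abs_div, abs_of_pos (a := (2 : ℝ) ^ k / 2 ^ 30) (by positivity)] at h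
  calc _ = |η₀ (y / (2 ^ k / 2 ^ 30)) - η₀ (x / (2 ^ k / 2 ^ 30))| := by congr 1; ring
    _ ≤ _ := h
    _ = _ := by rw [abs_sub_comm]; field_simp

theorem mainMult_frame (he : e ∈ Metric.sphere (0 : Plane) 1) (A : Plane → ℂ) (M : Plane → ℝ)
    (ε ξ : ℝ) (y : Plane) :
    mainMult e A M ε (frame e (ξ, y)) = A y * (1 / (((ξ - M y : ℝ) : ℂ) + ε * Complex.I)) := by
  simp only [mainMult, coords_frame he]

theorem norm_mainMult_amp_le (hη : IsCutoff η₀) (he : e ∈ Metric.sphere (0 : Plane) 1)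
    (hσ : |σ| = 1) {ξ : ℝ} {y : Plane} {d : ℝ} (hd : 0 < d)
    (h : amp η₀ k e e' σ y ≠ 0 → d ≤ |ξ - branch e σ y|) :
    ‖mainMult e (amp η₀ k e e' σ) (branch e σ) (1 / 2 ^ k) (frame e (ξ, y))‖ ≤
      4 / (2 ^ k * d) := by
  rw [mainMult_frame he]
  by_cases h0 : amp η₀ k e e' σ y = 0
  · rw [h0, zero_mul, norm_zero]; positivity
  have h1 := norm_amp_le (k := k) (e := e) (e' := e') hη hσ y
  have h2 : ‖1 / (((ξ - branch e σ y : ℝ) : ℂ) + (1 / 2 ^ k : ℝ) * Complex.I)‖ ≤ 1 / d := by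
    rw [norm_div, norm_one]
    refine one_div_le_one_div_of_le hd ((h h0).trans ?_)
    have h3 := Complex.abs_re_le_norm (((ξ - branch e σ y : ℝ) : ℂ) + (1 / 2 ^ k : ℝ) * Complex.I)
    rw [Complex.add_re, Complex.ofReal_re, Complex.re_ofReal_mul, Complex.I_re, mul_zero,
      add_zero] at h3
    exact h3
  rw [norm_mul]
  refine (mul_le_mul h1 h2 (norm_nonneg _) (by positivity)).trans (le_of_eq ?_)
  field_simp
  norm_num

/-- Far from the surface `P = 0` the principal part of the multiplier is small. -/
theorem norm_mainMult_amp_le_symbolP (hη : IsCutoff η₀) (he : e ∈ Metric.sphere (0 : Plane) 1)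
    (hσ : |σ| = 1) {ξ : ℝ} {y : Plane} (hz : ‖space (frame e (ξ, y))‖ ≤ 2 * 2 ^ k)
    (hP : 0 < |symbolP (frame e (ξ, y))|) :
    ‖mainMult e (amp η₀ k e e' σ) (branch e σ) (1 / 2 ^ k) (frame e (ξ, y))‖ ≤
      128 / |symbolP (frame e (ξ, y))| := by
  have hN : (0 : ℝ) < 2 ^ k := by positivity
  -- As `P` vanishes at the root, the expansion there gives `|P| ≤ 32 · 2^k · |ξ - m|`, so a large
  -- `|P|` forces a large distance to the root.
  refine (norm_mainMult_amp_le hη he hσ (d := |symbolP (frame e (ξ, y))| / (32 * 2 ^ k))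
    (by positivity) fun h => ?_).trans (le_of_eq ?_)
  · obtain ⟨⟨h1, h2, h3⟩, _⟩ := amp_ne_zero h
    set m := branch e σ y with hm
    have h4 := abs_slope_le he (frame e (m, y))
    have h5 := abs_fst_le_norm_space he (m, y)
    have h6 := abs_fst_le_norm_space he (ξ, y)
    have h7 : |ξ - m| ≤ 16 * 2 ^ k := (abs_sub _ _).trans (by simp only at h5 h6; linarith)
    rw [div_le_iff₀ (by positivity), symbolP_frame_sub e ξ m y, h1, zero_add]
    refine (abs_add_le _ _).trans ?_
    rw [abs_mul, abs_mul, abs_two, abs_mul, abs_pow]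
    have h8 : 2 * |slope e (frame e (m, y))| * |ξ - m| ≤ 16 * 2 ^ k * |ξ - m| :=
      mul_le_mul_of_nonneg_right (by linarith) (abs_nonneg _)
    have h9 : |cosTwo e| * |ξ - m| ^ 2 ≤ 16 * 2 ^ k * |ξ - m| := by
      calc |cosTwo e| * |ξ - m| ^ 2 ≤ 1 * |ξ - m| ^ 2 := by gcongr; exact abs_cosTwo_le he
        _ = |ξ - m| * |ξ - m| := by ring
        _ ≤ _ := by gcongr
    linarith
  · field_simp
    norm_num

/-- The sum of the principal parts on the two branches. -/
noncomputable def principal (η₀ : ℝ → ℝ) (k : ℕ) (e e' : Plane) (z : SpaceTime) : ℂ :=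
  mainMult e (amp η₀ k e e' 1) (branch e 1) (1 / 2 ^ k) z +
    mainMult e (amp η₀ k e e' (-1)) (branch e (-1)) (1 / 2 ^ k) z

/-- Near the surface a root `m` lies within `2^k/2^78` of `ξ`, and `branch` finds it. Replacing
`χ(ξ)` by `χ(m)` costs `O(2^(-2k))`, since `χ` has Lipschitz constant `O(2^(-k))` and `2^k |ξ - m| ≤
8|P|`. What remains is the comparison of two resolvents in `norm_resolvent_sub_le`. -/
theorem norm_sub_mainMult_le (hη : IsCutoff η₀) (hk : 100 ≤ k)
    (he : e ∈ Metric.sphere (0 : Plane) 1) (he' : e' ∈ Metric.sphere (0 : Plane) 1)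
    {K : ℝ} (hK0 : 0 ≤ K) (hK : ∀ x y, |η₀ x - η₀ y| ≤ K * |x - y|) (hσ : |σ| = 1)
    {ξ : ℝ} {y : Plane} (hz : ‖space (frame e (ξ, y))‖ ≤ 2 * 2 ^ k)
    (hs : 2 ^ k / 4 ≤ σ * slope e (frame e (ξ, y)))
    (hP : |symbolP (frame e (ξ, y))| ≤ (2 ^ k) ^ 2 / 2 ^ 80) :
    ‖(chi η₀ k 30 (slope e' (frame e (ξ, y))) : ℂ) / ((symbolP (frame e (ξ, y)) : ℂ) + Complex.I) -
      mainMult e (amp η₀ k e e' σ) (branch e σ) (1 / 2 ^ k) (frame e (ξ, y))‖ ≤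
      (32 + 2 ^ 33 * K) / (2 ^ k) ^ 2 + {z | 2 ^ k / 2 ^ 32 ≤ |slope e' z|}.indicator
        (fun z => 4352 / (1 + symbolP z ^ 2)) (frame e (ξ, y)) := by
  set N : ℝ := 2 ^ k with hNdef
  have hN : 0 < N := by positivity
  set s := slope e (frame e (ξ, y)) with hsdef
  set P := symbolP (frame e (ξ, y)) with hPdef
  have hsabs : |s| = |σ * s| := by rw [abs_mul, hσ, one_mul]
  have hslow : N / 4 ≤ |s| := by rw [hsabs]; exact hs.trans (le_abs_self _)
  have hs0 : s ≠ 0 := fun h => by rw [h, abs_zero] at hslow; linarith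
  have hP2 : |P| ≤ s ^ 2 := by
    rw [← sq_abs s]
    calc |P| ≤ N ^ 2 / 2 ^ 80 := hP
      _ ≤ (N / 4) ^ 2 := by rw [div_pow]; gcongr; norm_num
      _ ≤ _ := by gcongr
  obtain ⟨m, hm0, hmξ⟩ := exists_root he hs0 hP2
  have hmξ' : |ξ - m| ≤ N / 2 ^ 78 := by
    rw [abs_sub_comm]
    refine hmξ.trans ?_
    rw [div_le_iff₀ (by positivity)]
    calc |P| ≤ N ^ 2 / 2 ^ 80 := hP
      _ = N / 2 ^ 78 * (N / 4) := by ring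
      _ ≤ _ := by gcongr
  have hsmall : N / 2 ^ 78 ≤ N / 64 := by gcongr; norm_num
  have ha := abs_cosTwo_le he
  have hsm := slope_frame_sub e ξ m y
  have haζ : |cosTwo e * (ξ - m)| ≤ N / 2 ^ 78 := by
    rw [abs_mul]; exact (mul_le_of_le_one_left (abs_nonneg _) ha).trans hmξ'
  set sm := slope e (frame e (m, y)) with hsmdef
  have hσsm : N / 8 ≤ σ * sm := by
    have h1 : σ * sm = σ * s - σ * (cosTwo e * (ξ - m)) := by rw [hsdef, hsm]; ring
    have h2 : |σ * (cosTwo e * (ξ - m))| ≤ N / 2 ^ 78 := by rw [abs_mul, hσ, one_mul]; exact haζ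
    have h3 := (abs_le.1 h2).2
    rw [h1]
    linarith
  have hbranch : branch e σ y = m := branch_eq he hσ hm0 (by linarith)
  have hspm : ‖space (frame e (m, y))‖ ≤ 8 * N := by
    refine abs_le_of_sq_le_sq' ?_ (by positivity) |>.2
    have h1 := norm_space_frame_sq he (m, y)
    have h2 := norm_space_frame_sq he (ξ, y)
    have h3 := abs_fst_le_norm_space he (ξ, y)
    simp only at h1 h2 h3
    have h4 : |m| ≤ 3 * N := by
      have h5 : |m| ≤ |ξ| + |ξ - m| := by
        have := abs_sub ξ (ξ - m); rwa [sub_sub_cancel] at this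
      linarith
    have h6 : m ^ 2 ≤ (3 * N) ^ 2 := sq_le_sq' (by linarith [abs_le.1 h4]) (by linarith [abs_le.1 h4])
    have h7 : ‖space (frame e (ξ, y))‖ ^ 2 ≤ (2 * N) ^ 2 := by gcongr
    nlinarith [sq_nonneg ξ, sq_nonneg N]
  have hamp : amp η₀ k e e' σ y =
      ((chi η₀ k 30 (slope e' (frame e (m, y))) / (2 * sm) : ℝ) : ℂ) := by
    unfold amp
    rw [Set.indicator_of_mem]
    · rw [hbranch]
    · simp only [Set.mem_ofPred_eq, hbranch]
      exact ⟨hm0, hσsm, hspm⟩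
  set ζ := ξ - m with hζdef
  have hPexp : P = 2 * sm * ζ + cosTwo e * ζ ^ 2 := by
    rw [hPdef, symbolP_frame_sub e ξ m y, hm0, zero_add]
  have hsmabs : |sm| = |σ * sm| := by rw [abs_mul, hσ, one_mul]
  have hsmlow : N / 8 ≤ |sm| := by rw [hsmabs]; exact hσsm.trans (le_abs_self _)
  have hsmup : |sm| ≤ 8 * N := (abs_slope_le he _).trans hspm
  have hPζ : N * |ζ| ≤ 8 * |P| := by
    have h1 : P = ζ * (2 * sm + cosTwo e * ζ) := by rw [hPexp]; ring
    have h2 : N / 8 ≤ |2 * sm + cosTwo e * ζ| := by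
      have h3 := abs_sub_abs_le_abs_sub (2 * sm) (-(cosTwo e * ζ))
      rw [abs_neg, sub_neg_eq_add, abs_mul 2, abs_two] at h3
      linarith
    rw [h1, abs_mul]
    have h4 := mul_le_mul_of_nonneg_left h2 (abs_nonneg ζ)
    linarith
  set χ := chi η₀ k 30 (slope e' (frame e (ξ, y))) with hχ
  set χm := chi η₀ k 30 (slope e' (frame e (m, y))) with hχm
  have hsm0 : (sm : ℂ) ≠ 0 := by
    intro h
    have : sm = 0 := by exact_mod_cast h
    rw [this, abs_zero] at hsmlow; linarith
  have hdec : (χ : ℂ) / ((P : ℂ) + Complex.I) -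
      mainMult e (amp η₀ k e e' σ) (branch e σ) (1 / N) (frame e (ξ, y)) =
      ((χ - χm : ℝ) : ℂ) / ((P : ℂ) + Complex.I) + (χm : ℂ) *
        (1 / ((P : ℂ) + Complex.I) - 1 / (2 * sm * ((ζ : ℂ) + (1 / N : ℝ) * Complex.I))) := by
    rw [mainMult_frame he, hamp, hbranch, ← hζdef]
    push_cast
    have : (χm : ℂ) * (1 / (2 * sm * ((ζ : ℂ) + (1 / N : ℂ) * Complex.I))) =
      (χm : ℂ) / (2 * sm) * (1 / ((ζ : ℂ) + (1 / N : ℂ) * Complex.I)) := by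
        rw [div_mul_div_comm, mul_one, mul_one_div]
    rw [mul_sub, this]
    ring
  rw [hdec]
  have hslopediff := abs_slope_frame_sub_le he he' ξ m y
  rw [← hζdef] at hslopediff
  have hX1 := one_le_norm_add_I P
  have hXP := abs_le_norm_add_I P
  have hfirst : ‖((χ - χm : ℝ) : ℂ) / ((P : ℂ) + Complex.I)‖ ≤ 2 ^ 33 * K / N ^ 2 := by
    rw [norm_div, Complex.norm_real, Real.norm_eq_abs, div_le_iff₀ (by linarith)]
    calc |χ - χm| ≤ K * 2 ^ 30 / N * |slope e' (frame e (ξ, y)) - slope e' (frame e (m, y))| :=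
          abs_chi_sub_le hk hK _ _
      _ ≤ K * 2 ^ 30 / N * |ζ| := by gcongr
      _ = K * 2 ^ 30 / N ^ 2 * (N * |ζ|) := by field_simp
      _ ≤ K * 2 ^ 30 / N ^ 2 * (8 * ‖(P : ℂ) + Complex.I‖) :=
          mul_le_mul_of_nonneg_left (by linarith) (by positivity)
      _ = _ := by ring
  have hχm1 : |χm| ≤ 1 := hη.abs_chi_le _ _ _
  have hres := norm_resolvent_sub_le hN hPexp ha hsmlow hsmup (by linarith) hPζ
  have hsecond : ‖(χm : ℂ) *
        (1 / ((P : ℂ) + Complex.I) - 1 / (2 * sm * ((ζ : ℂ) + (1 / N : ℝ) * Complex.I)))‖ ≤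
      32 / N ^ 2 + {z | N / 2 ^ 32 ≤ |slope e' z|}.indicator
        (fun z => 4352 / (1 + symbolP z ^ 2)) (frame e (ξ, y)) := by
    by_cases hχ0 : χm = 0
    · rw [hχ0, Complex.ofReal_zero, zero_mul, norm_zero]
      exact add_nonneg (by positivity) (Set.indicator_nonneg (fun z _ => by positivity) _)
    · have h1 := hη.lt_of_chi_ne_zero hk hχ0
      rw [← hNdef] at h1
      -- The cutoff gives `N/2^31` at the root; moving to `ξ` changes the slope by at most `N/2^78`,
      -- so half of the bound survives.
      have h2 : N / 2 ^ 32 ≤ |slope e' (frame e (ξ, y))| := by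
        have h3 := abs_sub_abs_le_abs_sub (slope e' (frame e (m, y))) (slope e' (frame e (ξ, y)))
        rw [abs_sub_comm] at h3
        have h4 : N / 2 ^ (30 + 1) - N / 2 ^ 78 - N / 2 ^ 32 = N * (1 / 2 ^ 31 - 1 / 2 ^ 78 - 1 / 2 ^ 32) := by
          ring
        have h5 : 0 ≤ N * ((1 : ℝ) / 2 ^ 31 - 1 / 2 ^ 78 - 1 / 2 ^ 32) :=
          mul_nonneg hN.le (by norm_num)
        linarith
      rw [Set.indicator_of_mem (show frame e (ξ, y) ∈ {z | N / 2 ^ 32 ≤ |slope e' z|} from h2),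
        norm_mul, Complex.norm_real, Real.norm_eq_abs]
      exact (mul_le_of_le_one_left (norm_nonneg _) hχm1).trans hres
  refine (norm_add_le _ _).trans ((add_le_add hfirst hsecond).trans (le_of_eq ?_))
  rw [add_div]; ring

theorem mem_setDInfDir_bounds (hk : 100 ≤ k) {z : SpaceTime} (hz : z ∈ setDInfDir k e) :
    ‖space z‖ ≤ 2 * 2 ^ k ∧ 2 ^ k / 4 ≤ |slope e z| := by
  obtain ⟨h1, h2⟩ := hz
  refine ⟨(norm_space_le_of_mem_setDInf h1).trans (le_of_eq (by ring)), le_trans ?_ h2⟩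
  obtain ⟨j, hj⟩ := Set.mem_iUnion.1 h1
  obtain ⟨n, rfl⟩ : ∃ n, k = n + 1 := ⟨k - 1, by omega⟩
  have h3 := hj.1.1
  rw [pow_succ]; linarith

/-- The difference between the multiplier `χ / (P + i)` and its principal part. -/
theorem norm_sub_principal_le (hη : IsCutoff η₀) (hk : 100 ≤ k)
    (he : e ∈ Metric.sphere (0 : Plane) 1) (he' : e' ∈ Metric.sphere (0 : Plane) 1)
    {K : ℝ} (hK0 : 0 ≤ K) (hK : ∀ x y, |η₀ x - η₀ y| ≤ K * |x - y|) {z : SpaceTime}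
    (hz : z ∈ setDInfDir k e) :
    ‖(chi η₀ k 30 (slope e' z) : ℂ) / ((symbolP z : ℂ) + Complex.I) - principal η₀ k e e' z‖ ≤
      (2 ^ 90 + 2 ^ 33 * K) / (2 ^ k) ^ 2 + {z | 2 ^ k / 2 ^ 32 ≤ |slope e' z|}.indicator
        (fun z => 4352 / (1 + symbolP z ^ 2)) z := by
  obtain ⟨hz1, hz2⟩ := mem_setDInfDir_bounds hk hz
  have hN : (0 : ℝ) < 2 ^ k := by positivity
  obtain ⟨⟨ξ, y⟩, rfl⟩ : ∃ p, frame e p = z := ⟨_, frame_coords he z⟩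
  have h1 : |(1 : ℝ)| = 1 := abs_one
  have h1' : |(-1 : ℝ)| = 1 := by simp
  have hind : 0 ≤ {z | 2 ^ k / 2 ^ 32 ≤ |slope e' z|}.indicator
      (fun z => 4352 / (1 + symbolP z ^ 2)) (frame e (ξ, y)) :=
    Set.indicator_nonneg (fun z _ => by positivity) _
  rcases le_or_gt |symbolP (frame e (ξ, y))| ((2 ^ k) ^ 2 / 2 ^ 80) with hP | hP
  · have hopp : ∀ τ : ℝ, |τ| = 1 → 2 ^ k / 4 ≤ -(τ * slope e (frame e (ξ, y))) →
        ‖mainMult e (amp η₀ k e e' τ) (branch e τ) (1 / 2 ^ k) (frame e (ξ, y))‖ ≤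
          16 / (2 ^ k) ^ 2 := by
      intro τ hτ hs
      refine (norm_mainMult_amp_le hη he hτ (d := 2 ^ k / 4) (by positivity) fun h => ?_).trans
        (le_of_eq (by field_simp; norm_num))
      have h2 := (amp_ne_zero h).1.2.1
      have h3 := slope_frame_sub e ξ (branch e τ y) y
      have h4 : 2 ^ k / 4 ≤ |τ * (cosTwo e * (ξ - branch e τ y))| := by
        refine le_trans ?_ (neg_le_abs _)
        rw [h3] at hs
        linarith
      rw [abs_mul, hτ, one_mul, abs_mul] at h4
      exact h4.trans (mul_le_of_le_one_left (abs_nonneg _) (abs_cosTwo_le he))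
    have hfin : ∀ τ : ℝ, |τ| = 1 → 2 ^ k / 4 ≤ τ * slope e (frame e (ξ, y)) →
        ‖(chi η₀ k 30 (slope e' (frame e (ξ, y))) : ℂ) /
            ((symbolP (frame e (ξ, y)) : ℂ) + Complex.I) -
          mainMult e (amp η₀ k e e' τ) (branch e τ) (1 / 2 ^ k) (frame e (ξ, y)) -
          mainMult e (amp η₀ k e e' (-τ)) (branch e (-τ)) (1 / 2 ^ k) (frame e (ξ, y))‖ ≤
        (2 ^ 90 + 2 ^ 33 * K) / (2 ^ k) ^ 2 + {z | 2 ^ k / 2 ^ 32 ≤ |slope e' z|}.indicator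
          (fun z => 4352 / (1 + symbolP z ^ 2)) (frame e (ξ, y)) := by
      intro τ hτ hs
      have h2 := norm_sub_mainMult_le hη hk he he' hK0 hK hτ hz1 hs hP
      have h3 := hopp (-τ) (by rwa [abs_neg]) (by linarith)
      refine (norm_sub_le _ _).trans ((add_le_add h2 h3).trans ?_)
      have h4 : (32 + 2 ^ 33 * K) / (2 ^ k) ^ 2 + 16 / (2 ^ k) ^ 2 ≤
          (2 ^ 90 + 2 ^ 33 * K) / ((2 : ℝ) ^ k) ^ 2 := by
        rw [← add_div]
        exact div_le_div_of_nonneg_right (by linarith) (by positivity)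
      linarith
    unfold principal
    rcases le_abs.1 hz2 with hs | hs
    · have := hfin 1 h1 (by linarith)
      rwa [sub_sub] at this
    · have := hfin (-1) h1' (by linarith)
      rwa [neg_neg, sub_sub, add_comm (mainMult e (amp η₀ k e e' (-1)) _ _ _)] at this
  -- Far from the surface nothing cancels: the three terms sum to at most `257/|P|`, and `|P| >
  -- 4^k/2^80`.
  · have hPpos : 0 < |symbolP (frame e (ξ, y))| := lt_of_le_of_lt (by positivity) hP
    have h2 := norm_mainMult_amp_le_symbolP (e' := e') hη he h1 hz1 hPpos
    have h3 := norm_mainMult_amp_le_symbolP (e' := e') hη he h1' hz1 hPpos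
    have h4 : ‖(chi η₀ k 30 (slope e' (frame e (ξ, y))) : ℂ) /
        ((symbolP (frame e (ξ, y)) : ℂ) + Complex.I)‖ ≤ 1 / |symbolP (frame e (ξ, y))| := by
      rw [norm_div, Complex.norm_real, Real.norm_eq_abs]
      exact div_le_div₀ zero_le_one (hη.abs_chi_le _ _ _) hPpos (abs_le_norm_add_I _)
    have h5 : 257 / |symbolP (frame e (ξ, y))| ≤ (2 ^ 90 + 2 ^ 33 * K) / (2 ^ k) ^ 2 := by
      rw [div_le_div_iff₀ hPpos (by positivity)]
      have h6 : ((2 : ℝ) ^ k) ^ 2 ≤ 2 ^ 80 * |symbolP (frame e (ξ, y))| := by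
        rw [div_lt_iff₀ (by positivity)] at hP
        linarith
      have h7 : 0 ≤ 2 ^ 33 * K * |symbolP (frame e (ξ, y))| := by positivity
      nlinarith
    unfold principal
    refine (norm_sub_le _ _).trans ?_
    have h8 := norm_add_le
      (mainMult e (amp η₀ k e e' 1) (branch e 1) (1 / 2 ^ k) (frame e (ξ, y)))
      (mainMult e (amp η₀ k e e' (-1)) (branch e (-1)) (1 / 2 ^ k) (frame e (ξ, y)))
    have h9 : 1 / |symbolP (frame e (ξ, y))| + (128 / |symbolP (frame e (ξ, y))| +
        128 / |symbolP (frame e (ξ, y))|) = 257 / |symbolP (frame e (ξ, y))| := by ring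
    linarith

end ErrorTerm

end LocalSmoothing

namespace LocalSmoothing

/-! ### The bilinear estimate for the error. -/

section ErrorEstimate

variable {η₀ : ℝ → ℝ} {k : ℕ} {e e' : Plane} {F Ψ : SpaceTime → ℂ}

theorem measurableSet_setDInf (k : ℕ) : MeasurableSet (setDInf k) := by
  refine MeasurableSet.iUnion fun j => ?_
  refine MeasurableSet.inter ?_ (measurableSet_le continuous_symbolP.abs.measurable measurable_const)
  refine continuous_space.measurable ?_
  cases k with
  | zero => exact measurableSet_le measurable_norm measurable_const
  | succ k => exact measurable_norm measurableSet_Icc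

theorem measurableSet_setDInfDir (k : ℕ) (e : Plane) : MeasurableSet (setDInfDir k e) :=
  (measurableSet_setDInf k).inter (measurableSet_le
    (continuous_space.norm.measurable.div_const 2) (continuous_slope e).abs.measurable)

/-- The square of the weight is `1/(1+P²)`, whose integral over the values of `P` is `π`. -/
theorem eLpNorm_weight_fourier_le (he : e ∈ Metric.sphere (0 : Plane) 1) {l : ℝ} (hl : 0 < l)
    (hΨ : IsNice Ψ) :
    eLpNorm ({z | l ≤ |slope e z|}.indicator
      (fun z => ENNReal.ofReal (1 / √(1 + symbolP z ^ 2)) * ‖𝓕 Ψ z‖ₑ)) 2 volume ≤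
      ENNReal.ofReal (√(Real.pi / l)) * mixedNorm 1 2 e Ψ := by
  refine eLpNorm_le_of_lintegral_sq_le (Real.sqrt_nonneg _) ?_
  have hw : Measurable (fun x : ℝ => ENNReal.ofReal ((1 + x ^ 2)⁻¹)) := by fun_prop
  have h := lintegral_symbolP_fourier_le he hl hΨ hw
  have h2 : ∫⁻ x : ℝ, ENNReal.ofReal ((1 + x ^ 2)⁻¹) = ENNReal.ofReal Real.pi := by
    rw [← ofReal_integral_eq_lintegral_ofReal integrable_inv_one_add_sq
      (Filter.Eventually.of_forall fun x => by positivity), integral_univ_inv_one_add_sq]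
  rw [h2, ← ENNReal.ofReal_mul (by positivity)] at h
  refine le_trans (le_of_eq (lintegral_congr fun z => ?_)) (h.trans (le_of_eq ?_))
  · rw [enorm_eq_self, indicator_sq]
    congr 1
    ext z
    rw [mul_pow, ← ENNReal.ofReal_pow (by positivity), div_pow, one_pow,
      Real.sq_sqrt (by positivity), one_div]
  · rw [Real.sq_sqrt (by positivity)]
    congr 2
    ring

theorem measurable_weight_fourier (e : Plane) (l : ℝ) (hΨ : IsNice Ψ) :
    Measurable ({z | l ≤ |slope e z|}.indicator
      (fun z => ENNReal.ofReal (1 / √(1 + symbolP z ^ 2)) * ‖𝓕 Ψ z‖ₑ)) := by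
  refine Measurable.indicator (Measurable.mul ?_ (measurable_enorm_fourier hΨ.int))
    (measurableSet_le measurable_const (continuous_slope e).abs.measurable)
  have := continuous_symbolP.measurable
  fun_prop

/-- The error of the principal part, on the support of functions in `Y_k^e`. -/
noncomputable def errorMult (η₀ : ℝ → ℝ) (k : ℕ) (e e' : Plane) : SpaceTime → ℂ :=
  (setDInfDir k e).indicator (fun z => (chi η₀ k 30 (slope e' z) : ℂ) /
    ((symbolP z : ℂ) + Complex.I) - principal η₀ k e e' z)

/-- The `O(4^(-k))` part is paired over the ball `|ξ| ≤ 2 · 2^k`, where each factor costs `2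
√(2^k)`. In the other part `1/(1+P²)` is split evenly: `F` uses the lower bound for the slope of
`e`, valid on `D_k^e`, and `Ψ` the one for the slope of `e'`. Each half gains `2^(-k/2)`. -/
theorem lintegral_errorMult_le (hη : IsCutoff η₀) (hk : 100 ≤ k)
    (he : e ∈ Metric.sphere (0 : Plane) 1) (he' : e' ∈ Metric.sphere (0 : Plane) 1)
    {K : ℝ} (hK0 : 0 ≤ K) (hK : ∀ x y, |η₀ x - η₀ y| ≤ K * |x - y|)
    (hF : IsNice F) (hΨ : IsNice Ψ) :
    ∫⁻ z, ‖errorMult η₀ k e e' z * (𝓕 F z * (starRingEnd ℂ) (𝓕 Ψ z))‖ₑ ≤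
      ENNReal.ofReal ((2 ^ 92 + 2 ^ 35 * K + 2 ^ 32 * Real.pi) / 2 ^ k) * mixedNorm 1 2 e F *
        mixedNorm 1 2 e' Ψ := by
  have hN : (0 : ℝ) < 2 ^ k := by positivity
  set B : Set SpaceTime := {z | ‖space z‖ ≤ (2 * √(2 ^ k)) ^ 2 / 2} with hB
  have hBm : MeasurableSet B := measurableSet_le continuous_space.norm.measurable measurable_const
  have hBval : (2 * √((2 : ℝ) ^ k)) ^ 2 / 2 = 2 * 2 ^ k := by
    rw [mul_pow, Real.sq_sqrt hN.le]; ring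
  set W : (Plane) → ℝ → (SpaceTime → ℂ) → SpaceTime → ℝ≥0∞ := fun d l Φ =>
    {z | l ≤ |slope d z|}.indicator
      (fun z => ENNReal.ofReal (1 / √(1 + symbolP z ^ 2)) * ‖𝓕 Φ z‖ₑ) with hW
  have hBF := (measurable_enorm_fourier hF.int).indicator hBm
  have hBΨ := (measurable_enorm_fourier hΨ.int).indicator hBm
  have hpt : ∀ z, ‖errorMult η₀ k e e' z * (𝓕 F z * (starRingEnd ℂ) (𝓕 Ψ z))‖ₑ ≤
      ENNReal.ofReal ((2 ^ 90 + 2 ^ 33 * K) / (2 ^ k) ^ 2) *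
        (B.indicator (fun z => ‖𝓕 F z‖ₑ) z * B.indicator (fun z => ‖𝓕 Ψ z‖ₑ) z) +
      ENNReal.ofReal 4352 * (W e (2 ^ k / 4) F z * W e' (2 ^ k / 2 ^ 32) Ψ z) := by
    intro z
    by_cases hz : z ∈ setDInfDir k e
    · obtain ⟨hz1, hz2⟩ := mem_setDInfDir_bounds hk hz
      have hzB : z ∈ B := by simp only [hB, Set.mem_ofPred_eq, hBval]; exact hz1
      have h1 := norm_sub_principal_le hη hk he he' hK0 hK hz
      have hcj : ‖(starRingEnd ℂ) (𝓕 Ψ z)‖ₑ = ‖𝓕 Ψ z‖ₑ := by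
        rw [← ofReal_norm, ← ofReal_norm, RCLike.norm_conj]
      rw [errorMult, Set.indicator_of_mem hz, enorm_mul, enorm_mul, hcj, Set.indicator_of_mem hzB,
        Set.indicator_of_mem hzB]
      simp only [hW]
      rw [Set.indicator_of_mem (show z ∈ {z | 2 ^ k / 4 ≤ |slope e z|} from hz2)]
      have h2 : ‖(chi η₀ k 30 (slope e' z) : ℂ) / ((symbolP z : ℂ) + Complex.I) -
          principal η₀ k e e' z‖ₑ ≤ ENNReal.ofReal ((2 ^ 90 + 2 ^ 33 * K) / (2 ^ k) ^ 2) +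
          ENNReal.ofReal ({z | 2 ^ k / 2 ^ 32 ≤ |slope e' z|}.indicator
            (fun z => 4352 / (1 + symbolP z ^ 2)) z) := by
        rw [← ofReal_norm, ← ENNReal.ofReal_add (by positivity)
          (Set.indicator_nonneg (fun z _ => by positivity) _)]
        exact ENNReal.ofReal_le_ofReal h1
      refine (mul_le_mul_left h2 _).trans ?_
      rw [add_mul]
      refine add_le_add le_rfl ?_
      by_cases hs : 2 ^ k / 2 ^ 32 ≤ |slope e' z|
      · rw [Set.indicator_of_mem (show z ∈ {z | 2 ^ k / 2 ^ 32 ≤ |slope e' z|} from hs),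
          Set.indicator_of_mem (show z ∈ {z | 2 ^ k / 2 ^ 32 ≤ |slope e' z|} from hs)]
        have h3 : (4352 : ℝ) / (1 + symbolP z ^ 2) = 4352 * ((1 / √(1 + symbolP z ^ 2)) *
            (1 / √(1 + symbolP z ^ 2))) := by
          rw [← sq, div_pow, one_pow, Real.sq_sqrt (by positivity)]; ring
        rw [h3, ENNReal.ofReal_mul (by norm_num), ENNReal.ofReal_mul (by positivity)]
        refine le_of_eq ?_
        ring
      · rw [Set.indicator_of_notMem (show z ∉ {z | 2 ^ k / 2 ^ 32 ≤ |slope e' z|} from hs)]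
        simp
    · rw [errorMult, Set.indicator_of_notMem hz]; simp
  refine (lintegral_mono hpt).trans ?_
  have hm1 : Measurable (fun z => ENNReal.ofReal ((2 ^ 90 + 2 ^ 33 * K) / (2 ^ k) ^ 2) *
      (B.indicator (fun z => ‖𝓕 F z‖ₑ) z * B.indicator (fun z => ‖𝓕 Ψ z‖ₑ) z)) :=
    (hBF.mul hBΨ).const_mul _
  rw [lintegral_add_left hm1, lintegral_const_mul' _ _ ENNReal.ofReal_ne_top,
    lintegral_const_mul' _ _ ENNReal.ofReal_ne_top]
  have h1 : ∫⁻ z, B.indicator (fun z => ‖𝓕 F z‖ₑ) z * B.indicator (fun z => ‖𝓕 Ψ z‖ₑ) z ≤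
      (ENNReal.ofReal (2 * √(2 ^ k)) * mixedNorm 1 2 e F) *
        (ENNReal.ofReal (2 * √(2 ^ k)) * mixedNorm 1 2 e' Ψ) :=
    (lintegral_mul_le_eLpNorm_mul_eLpNorm hBF.aemeasurable hBΨ.aemeasurable).trans
      (mul_le_mul' (eLpNorm_ball_fourier_le he (by positivity) hF)
        (eLpNorm_ball_fourier_le he' (by positivity) hΨ))
  have h2 : ∫⁻ z, W e (2 ^ k / 4) F z * W e' (2 ^ k / 2 ^ 32) Ψ z ≤
      (ENNReal.ofReal (√(Real.pi / (2 ^ k / 4))) * mixedNorm 1 2 e F) *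
        (ENNReal.ofReal (√(Real.pi / (2 ^ k / 2 ^ 32))) * mixedNorm 1 2 e' Ψ) :=
    (lintegral_mul_le_eLpNorm_mul_eLpNorm (measurable_weight_fourier e _ hF).aemeasurable
      (measurable_weight_fourier e' _ hΨ).aemeasurable).trans
      (mul_le_mul' (eLpNorm_weight_fourier_le he (by positivity) hF)
        (eLpNorm_weight_fourier_le he' (by positivity) hΨ))
  refine (add_le_add (mul_le_mul_right h1 _) (mul_le_mul_right h2 _)).trans ?_
  have h3 : ENNReal.ofReal (2 * √(2 ^ k)) * ENNReal.ofReal (2 * √(2 ^ k)) =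
      ENNReal.ofReal (4 * 2 ^ k) := by
    rw [← ENNReal.ofReal_mul (by positivity)]
    congr 1
    rw [mul_mul_mul_comm, Real.mul_self_sqrt hN.le]; norm_num
  have h4 : ENNReal.ofReal (√(Real.pi / (2 ^ k / 4))) *
      ENNReal.ofReal (√(Real.pi / (2 ^ k / 2 ^ 32))) = ENNReal.ofReal (2 ^ 17 * Real.pi / 2 ^ k) := by
    rw [← ENNReal.ofReal_mul (by positivity), ← Real.sqrt_mul (by positivity)]
    congr 1
    rw [Real.sqrt_eq_iff_mul_self_eq (by positivity) (by positivity)]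
    field_simp
    norm_num
  calc _ = (ENNReal.ofReal ((2 ^ 90 + 2 ^ 33 * K) / (2 ^ k) ^ 2) *
          (ENNReal.ofReal (2 * √(2 ^ k)) * ENNReal.ofReal (2 * √(2 ^ k))) +
        ENNReal.ofReal 4352 * (ENNReal.ofReal (√(Real.pi / (2 ^ k / 4))) *
          ENNReal.ofReal (√(Real.pi / (2 ^ k / 2 ^ 32))))) *
        mixedNorm 1 2 e F * mixedNorm 1 2 e' Ψ := by ring
    _ ≤ _ := by
      rw [h3, h4, ← ENNReal.ofReal_mul (by positivity), ← ENNReal.ofReal_mul (by positivity),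
        ← ENNReal.ofReal_add (by positivity) (by positivity)]
      gcongr ENNReal.ofReal ?_ * _ * _
      have hpi := Real.pi_pos
      rw [div_mul_eq_mul_div, mul_div_assoc', div_add_div _ _ (by positivity) (by positivity),
        div_le_div_iff₀ (by positivity) (by positivity)]
      have : 0 ≤ Real.pi * (2 ^ k) ^ 4 := by positivity
      nlinarith

end ErrorEstimate

/-! ### The estimate for `Y_k^e`. -/

section FullMultiplier

variable {η₀ : ℝ → ℝ} {k : ℕ} {e e' : Plane} {F Ψ h : SpaceTime → ℂ}

theorem measurable_principal (hη : IsCutoff η₀) : Measurable (principal η₀ k e e') :=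
  (measurable_mainMult (measurable_amp hη) (measurable_branch e 1) _).add
    (measurable_mainMult (measurable_amp hη) (measurable_branch e (-1)) _)

/-- A bound without decay, used only for integrability and for passing to the limit in `L²`. -/
theorem norm_principal_le (hη : IsCutoff η₀) (z : SpaceTime) : ‖principal η₀ k e e' z‖ ≤ 8 := by
  have hN : (0 : ℝ) < 2 ^ k := by positivity
  have h : ∀ σ : ℝ, |σ| = 1 →
      ‖mainMult e (amp η₀ k e e' σ) (branch e σ) (1 / 2 ^ k) z‖ ≤ 4 := by
    intro σ hσ
    refine (norm_mainMult_le (by positivity) (norm_amp_le hη hσ) z).trans (le_of_eq ?_)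
    field_simp
    norm_num
  refine (norm_add_le _ _).trans ?_
  linarith [h 1 abs_one, h (-1) (by simp)]

theorem measurable_errorMult (hη : IsCutoff η₀) : Measurable (errorMult η₀ k e e') := by
  refine Measurable.indicator (Measurable.sub (Measurable.div ?_ ?_) (measurable_principal hη))
    (measurableSet_setDInfDir k e)
  · exact (Complex.continuous_ofReal.comp ((hη.continuous_chi k 30).comp
      (continuous_slope e'))).measurable
  · exact ((Complex.continuous_ofReal.comp continuous_symbolP).add continuous_const).measurable

theorem norm_errorMult_le (hη : IsCutoff η₀) (z : SpaceTime) : ‖errorMult η₀ k e e' z‖ ≤ 9 := by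
  unfold errorMult
  by_cases hz : z ∈ setDInfDir k e
  · rw [Set.indicator_of_mem hz]
    refine (norm_sub_le _ _).trans ?_
    have h1 : ‖(chi η₀ k 30 (slope e' z) : ℂ) / ((symbolP z : ℂ) + Complex.I)‖ ≤ 1 := by
      rw [norm_div, Complex.norm_real, Real.norm_eq_abs, div_le_one (by
        linarith [one_le_norm_add_I (symbolP z)])]
      exact (hη.abs_chi_le _ _ _).trans (one_le_norm_add_I _)
    linarith [norm_principal_le (k := k) (e := e) (e' := e') hη z]
  · rw [Set.indicator_of_notMem hz, norm_zero]; norm_num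

/-- The bilinear estimate for the multiplier `χ / (P + i)`, modified off `D_k^e`. -/
theorem enorm_integral_multiplier_le (hη : IsCutoff η₀) (hk : 100 ≤ k)
    (he : e ∈ Metric.sphere (0 : Plane) 1) (he' : e' ∈ Metric.sphere (0 : Plane) 1)
    {K : ℝ} (hK0 : 0 ≤ K) (hK : ∀ x y, |η₀ x - η₀ y| ≤ K * |x - y|)
    (hF : IsNice F) (hΨ : IsNice Ψ) :
    ‖∫ z, (errorMult η₀ k e e' z + principal η₀ k e e' z) *
        (𝓕 F z * (starRingEnd ℂ) (𝓕 Ψ z))‖ₑ ≤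
      ENNReal.ofReal ((2 ^ 92 + 2 ^ 35 * K + 2 ^ 33 * Real.pi) / 2 ^ k) * mixedNorm 1 2 e F *
        mixedNorm 1 2 e' Ψ := by
  have hFΨ : Integrable (fun z => 𝓕 F z * (starRingEnd ℂ) (𝓕 Ψ z)) :=
    (memLp_fourier hF.int hF.memLp).integrable_mul (memLp_fourier hΨ.int hΨ.memLp).star
  have hint1 : Integrable (fun z => errorMult η₀ k e e' z *
      (𝓕 F z * (starRingEnd ℂ) (𝓕 Ψ z))) :=
    hFΨ.bdd_mul (measurable_errorMult hη).aestronglyMeasurable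
      (Filter.Eventually.of_forall (norm_errorMult_le hη))
  have hint2 : ∀ σ : ℝ, |σ| = 1 → Integrable (fun z =>
      mainMult e (amp η₀ k e e' σ) (branch e σ) (1 / 2 ^ k) z *
        (𝓕 F z * (starRingEnd ℂ) (𝓕 Ψ z))) := fun σ hσ =>
    hFΨ.bdd_mul (measurable_mainMult (measurable_amp hη) (measurable_branch e σ)
      _).aestronglyMeasurable (Filter.Eventually.of_forall
        (norm_mainMult_le (by positivity) (norm_amp_le hη hσ)))
  have h1 : |(1 : ℝ)| = 1 := abs_one
  have h1' : |(-1 : ℝ)| = 1 := by simp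
  have hsplit : ∫ z, (errorMult η₀ k e e' z + principal η₀ k e e' z) *
        (𝓕 F z * (starRingEnd ℂ) (𝓕 Ψ z)) =
      (∫ z, errorMult η₀ k e e' z * (𝓕 F z * (starRingEnd ℂ) (𝓕 Ψ z))) +
      ((∫ z, mainMult e (amp η₀ k e e' 1) (branch e 1) (1 / 2 ^ k) z *
        (𝓕 F z * (starRingEnd ℂ) (𝓕 Ψ z))) +
      ∫ z, mainMult e (amp η₀ k e e' (-1)) (branch e (-1)) (1 / 2 ^ k) z *
        (𝓕 F z * (starRingEnd ℂ) (𝓕 Ψ z))) := by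
    have hadd : Integrable (fun z => mainMult e (amp η₀ k e e' 1) (branch e 1) (1 / 2 ^ k) z *
          (𝓕 F z * (starRingEnd ℂ) (𝓕 Ψ z)) +
        mainMult e (amp η₀ k e e' (-1)) (branch e (-1)) (1 / 2 ^ k) z *
          (𝓕 F z * (starRingEnd ℂ) (𝓕 Ψ z))) := (hint2 1 h1).add (hint2 (-1) h1')
    rw [← integral_add (hint2 1 h1) (hint2 (-1) h1'), ← integral_add hint1 hadd]
    refine integral_congr_ae (Filter.Eventually.of_forall fun z => ?_)
    simp only [principal]; ring
  rw [hsplit]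
  refine (enorm_add_le _ _).trans ((add_le_add ((enorm_integral_le_lintegral_enorm _).trans
    (lintegral_errorMult_le hη hk he he' hK0 hK hF hΨ)) ((enorm_add_le _ _).trans
    (add_le_add (enorm_integral_amp_le hη hk he he' h1 hF hΨ)
      (enorm_integral_amp_le hη hk he he' h1' hF hΨ)))).trans ?_)
  rw [← add_mul, ← add_mul, ← add_mul, ← add_mul]
  have hpi := Real.pi_pos
  rw [← ENNReal.ofReal_add (by positivity) (by positivity),
    ← ENNReal.ofReal_add (by positivity) (by positivity)]
  gcongr ENNReal.ofReal ?_ * _ * _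
  rw [mul_div_assoc', ← add_div, ← add_div]
  exact div_le_div_of_nonneg_right (by linarith) (by positivity)

theorem IsNice.indicator_closedBall {G : SpaceTime → ℂ} (hG : StronglyMeasurable G)
    (hG2 : MemLp G 2 volume) (n : ℕ) :
    IsNice ((Metric.closedBall (0 : SpaceTime) n).indicator G) := by
  have hb : MeasurableSet (Metric.closedBall (0 : SpaceTime) n) :=
    Metric.isClosed_closedBall.measurableSet
  have : IsFiniteMeasure (volume.restrict (Metric.closedBall (0 : SpaceTime) n)) :=
    ⟨by rw [Measure.restrict_apply_univ]; exact measure_closedBall_lt_top⟩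
  exact ⟨hG.indicator hb, (integrable_indicator_iff hb).2
    ((hG2.restrict _).integrable (by norm_num)), hG2.indicator hb⟩

theorem tendsto_eLpNorm_indicator_closedBall {G : SpaceTime → ℂ} (hG : StronglyMeasurable G)
    (hG2 : MemLp G 2 volume) :
    Filter.Tendsto (fun n : ℕ => eLpNorm ((Metric.closedBall (0 : SpaceTime) n).indicator G - G) 2
      volume) Filter.atTop (nhds 0) := by
  have hb : ∀ n : ℕ, MeasurableSet (Metric.closedBall (0 : SpaceTime) n) := fun n =>
    Metric.isClosed_closedBall.measurableSet
  have h1 : Filter.Tendsto (fun n : ℕ => ∫⁻ z,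
      ‖((Metric.closedBall (0 : SpaceTime) n).indicator G - G) z‖ₑ ^ 2) Filter.atTop
      (nhds (∫⁻ _ : SpaceTime, 0)) := by
    refine tendsto_lintegral_of_dominated_convergence (fun z => ‖G z‖ₑ ^ 2) (fun n => ?_)
      (fun n => Filter.Eventually.of_forall fun z => ?_) ?_ (Filter.Eventually.of_forall fun z => ?_)
    · exact ((hG.indicator (hb n)).sub hG).enorm.pow_const 2
    · by_cases hz : z ∈ Metric.closedBall (0 : SpaceTime) n
      · simp [hz]
      · simp [hz]
    · rw [← eLpNorm_two_sq]; exact ENNReal.pow_ne_top hG2.2.ne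
    · refine tendsto_const_nhds.congr' ?_
      obtain ⟨m, hm⟩ := exists_nat_ge ‖z‖
      filter_upwards [Filter.eventually_ge_atTop m] with n hn
      have hz : z ∈ Metric.closedBall (0 : SpaceTime) n := by
        rw [mem_closedBall_zero_iff]; exact hm.trans (by exact_mod_cast hn)
      simp [hz]
  rw [lintegral_zero] at h1
  simp_rw [← eLpNorm_two_sq] at h1
  have h2 := (ENNReal.continuous_rpow_const (y := 1 / 2)).tendsto 0 |>.comp h1
  rw [ENNReal.zero_rpow_of_pos (by norm_num)] at h2
  refine h2.congr fun n => ?_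
  simp only [Function.comp]
  rw [← ENNReal.rpow_natCast, ← ENNReal.rpow_mul]
  norm_num

/-- Local smoothing for `Y_k^e`, in dual form. -/
theorem enorm_integral_memY_le (hη : IsCutoff η₀) (hk : 100 ≤ k)
    (he : e ∈ Metric.sphere (0 : Plane) 1) (he' : e' ∈ Metric.sphere (0 : Plane) 1)
    {K : ℝ} (hK0 : 0 ≤ K) (hK : ∀ x y, |η₀ x - η₀ y| ≤ K * |x - y|)
    (hh : MemY k e h) (hΨ : IsNice Ψ) :
    ‖∫ z, h z * (chi η₀ k 30 (slope e' z) : ℂ) * (starRingEnd ℂ) (𝓕 Ψ z)‖ₑ ≤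
      ENNReal.ofReal ((2 ^ 92 + 2 ^ 35 * K + 2 ^ 33 * Real.pi) / 2 ^ k) *
        mixedNorm 1 2 e (⇑(𝓕⁻ (hh.memLp_mulP.toLp (mulP h)) : Lp ℂ 2 (volume : Measure SpaceTime))) *
        mixedNorm 1 2 e' Ψ := by
  set G : Lp ℂ 2 (volume : Measure SpaceTime) := 𝓕⁻ (hh.memLp_mulP.toLp (mulP h)) with hG
  have hGm : StronglyMeasurable G := Lp.stronglyMeasurable G
  have hG2 : MemLp G 2 volume := Lp.memLp G
  have hFn : ∀ n : ℕ, IsNice ((Metric.closedBall (0 : SpaceTime) n).indicator G) :=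
    IsNice.indicator_closedBall hGm hG2
  -- On `D_k^e` this is exactly `χ/(P+i)`. Elsewhere only the principal part is left, which is not
  -- seen because `h` vanishes there.
  set m : SpaceTime → ℂ := fun z => errorMult η₀ k e e' z + principal η₀ k e e' z with hm
  have hmm : Measurable m := (measurable_errorMult hη).add (measurable_principal hη)
  have hmb : ∀ z, ‖m z‖ ≤ 17 := fun z => (norm_add_le _ _).trans (by
    linarith [norm_errorMult_le (k := k) (e := e) (e' := e') hη z,
      norm_principal_le (k := k) (e := e) (e' := e') hη z])
  have hq : MemLp (fun z => (starRingEnd ℂ) (m z) * 𝓕 Ψ z) 2 volume := by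
    refine ((memLp_fourier hΨ.int hΨ.memLp).const_mul (17 : ℂ)).mono ?_ ?_
    · exact (Complex.continuous_conj.measurable.comp hmm).aestronglyMeasurable.mul
        (memLp_fourier hΨ.int hΨ.memLp).1
    · refine Filter.Eventually.of_forall fun z => ?_
      rw [norm_mul, norm_mul, RCLike.norm_conj]
      gcongr
      simpa using hmb z
  have hinner : ∀ g : Lp ℂ 2 (volume : Measure SpaceTime), inner ℂ (hq.toLp _) g =
      ∫ z, m z * (g z * (starRingEnd ℂ) (𝓕 Ψ z)) := by
    intro g
    rw [L2.inner_def]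
    refine integral_congr_ae ?_
    filter_upwards [hq.coeFn_toLp] with z hz
    rw [hz]
    simp only [RCLike.inner_apply, map_mul, Complex.conj_conj]
    ring
  -- `G` need not be integrable, so it is truncated to balls. Truncation does not increase the norm
  -- of `L^{1,2}_e`, and the form is `L²`-continuous in `G` because `m` is bounded and `𝓕 Ψ ∈ L²`.
  have hlim : Filter.Tendsto (fun n : ℕ => (hFn n).memLp.toLp _) Filter.atTop (nhds G) := by
    have := Lp.tendsto_Lp_iff_tendsto_eLpNorm'' (fun n : ℕ =>
      (Metric.closedBall (0 : SpaceTime) n).indicator G) (fun n => (hFn n).memLp) G hG2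
      (fi := Filter.atTop)
    rw [Lp.toLp_coeFn] at this
    exact this.2 (tendsto_eLpNorm_indicator_closedBall hGm hG2)
  have hlim2 : Filter.Tendsto (fun n : ℕ => inner ℂ (hq.toLp _)
      (𝓕 ((hFn n).memLp.toLp _) : Lp ℂ 2 (volume : Measure SpaceTime))) Filter.atTop
      (nhds (inner ℂ (hq.toLp _) (𝓕 G : Lp ℂ 2 (volume : Measure SpaceTime)))) :=
    (Filter.Tendsto.inner tendsto_const_nhds
      (((Lp.fourierTransformₗᵢ SpaceTime ℂ).continuous.tendsto G).comp hlim))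
  have hlimval : inner ℂ (hq.toLp _) (𝓕 G : Lp ℂ 2 (volume : Measure SpaceTime)) =
      ∫ z, h z * (chi η₀ k 30 (slope e' z) : ℂ) * (starRingEnd ℂ) (𝓕 Ψ z) := by
    rw [hinner, hG, FourierTransform.fourier_fourierInv_eq]
    refine integral_congr_ae ?_
    filter_upwards [hh.memLp_mulP.coeFn_toLp, hh.supp] with z hz hz'
    rw [hz]
    by_cases hzD : z ∈ setDInfDir k e
    · have hX : (symbolP z : ℂ) + Complex.I ≠ 0 := fun h0 => by
        have := one_le_norm_add_I (symbolP z)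
        rw [h0, norm_zero] at this; linarith
      simp only [hm, errorMult, Set.indicator_of_mem hzD, mulP, sub_add_cancel]
      field_simp
    · simp [mulP, hz' hzD]
  rw [← hlimval]
  refine le_of_tendsto' hlim2.enorm fun n => ?_
  rw [hinner]
  have h1 := enorm_integral_multiplier_le hη hk he he' hK0 hK (hFn n) hΨ
  have h2 : ∫ z, m z * ((𝓕 ((hFn n).memLp.toLp _) : Lp ℂ 2 (volume : Measure SpaceTime)) z *
      (starRingEnd ℂ) (𝓕 Ψ z)) = ∫ z, (errorMult η₀ k e e' z + principal η₀ k e e' z) *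
        (𝓕 ((Metric.closedBall (0 : SpaceTime) n).indicator G) z * (starRingEnd ℂ) (𝓕 Ψ z)) := by
    refine integral_congr_ae ?_
    filter_upwards [coeFn_fourier_toLp (hFn n).int (hFn n).memLp] with z hz
    rw [hz]
  rw [h2]
  refine h1.trans ?_
  gcongr
  refine mixedNorm_mono e fun z => ?_
  by_cases hz : z ∈ Metric.closedBall (0 : SpaceTime) n
  · rw [Set.indicator_of_mem hz]
  · rw [Set.indicator_of_notMem hz]; simp

end FullMultiplier

end LocalSmoothing

namespace LocalSmoothing

/-! ### Assembly of the local smoothing estimate. -/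

section UpperBound

variable {η₀ : ℝ → ℝ} {k : ℕ} {e e' : Plane} {f g h Ψ : SpaceTime → ℂ}

/-- The constant in the local smoothing estimate for `Y_k^e`, for a `K`-Lipschitz cutoff. -/
noncomputable def smoothingConst (K : ℝ) : ℝ := 2 ^ 92 + 2 ^ 35 * K + 2 ^ 33 * Real.pi

theorem smoothingConst_pos {K : ℝ} (hK0 : 0 ≤ K) : 0 < smoothingConst K := by
  have := Real.pi_pos
  unfold smoothingConst
  positivity

theorem memLp_mul_chi (hη : IsCutoff η₀) (k : ℕ) (e' : Plane) (hf : MemLp f 2 volume) :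
    MemLp (fun z => f z * (chi η₀ k 30 (slope e' z) : ℂ)) 2 volume := by
  refine hf.mono (hf.1.mul (Complex.continuous_ofReal.comp ((hη.continuous_chi k 30).comp
    (continuous_slope e'))).aestronglyMeasurable) (Filter.Eventually.of_forall fun z => ?_)
  rw [norm_mul, Complex.norm_real, Real.norm_eq_abs]
  exact mul_le_of_le_one_right (norm_nonneg _) (hη.abs_chi_le _ _ _)

theorem integrable_mul_chi_mul_fourier (hη : IsCutoff η₀) (k : ℕ) (e' : Plane)
    (hf : MemLp f 2 volume) (hΨ : IsNice Ψ) :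
    Integrable (fun z => f z * (chi η₀ k 30 (slope e' z) : ℂ) * (starRingEnd ℂ) (𝓕 Ψ z)) :=
  (memLp_mul_chi hη k e' hf).integrable_mul (memLp_fourier hΨ.int hΨ.memLp).star

theorem enorm_integral_memX_le (hη : IsCutoff η₀) (he' : e' ∈ Metric.sphere (0 : Plane) 1)
    (hg : MemX η₀ k g) (hΨ : IsNice Ψ) :
    ‖∫ z, g z * (chi η₀ k 30 (slope e' z) : ℂ) * (starRingEnd ℂ) (𝓕 Ψ z)‖ₑ ≤
      ENNReal.ofReal (2 ^ 101 * 2 ^ (-(k : ℝ) / 2)) * xNorm η₀ g * mixedNorm 1 2 e' Ψ := by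
  refine (enorm_integral_le_lintegral_enorm _).trans (le_trans (le_of_eq ?_)
    (lintegral_memX_le hη he' hg hΨ))
  refine lintegral_congr fun z => ?_
  rw [enorm_mul, ← ofReal_norm ((starRingEnd ℂ) (𝓕 Ψ z)), RCLike.norm_conj, ofReal_norm]

/-- The norm of `Y_k^e` is itself defined through `invFourier`, so `scaleConst` appears on both
sides and the surplus `2π ≥ 1` is dropped. The bound `1/2^k` splits into the wanted `2^(-k/2)` and
the one inside `yNorm`. -/
theorem scaleConst_mul_enorm_integral_memY_le (hη : IsCutoff η₀)
    (he : e ∈ Metric.sphere (0 : Plane) 1) (he' : e' ∈ Metric.sphere (0 : Plane) 1)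
    {K : ℝ} (hK0 : 0 ≤ K) (hK : ∀ x y, |η₀ x - η₀ y| ≤ K * |x - y|)
    (hh : MemY k e h) (hΨ : IsNice Ψ) :
    scaleConst * ‖∫ z, h z * (chi η₀ k 30 (slope e' z) : ℂ) * (starRingEnd ℂ) (𝓕 Ψ z)‖ₑ ≤
      ENNReal.ofReal (smoothingConst K * 2 ^ (-(k : ℝ) / 2)) * yNorm k e h *
        mixedNorm 1 2 e' Ψ := by
  rcases lt_or_ge k 100 with hk | hk
  · have h0 : ∫ z, h z * (chi η₀ k 30 (slope e' z) : ℂ) * (starRingEnd ℂ) (𝓕 Ψ z) = 0 := by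
      refine integral_eq_zero_of_ae ?_
      filter_upwards [hh.eq_zero hk] with z hz
      simp [hz]
    simp [h0]
  · have hC := smoothingConst_pos hK0
    refine (mul_le_mul_right (enorm_integral_memY_le hη hk he he' hK0 hK hh hΨ) _).trans ?_
    rw [yNorm, mixedNorm_one_invFourier e hh.memLp_mulP]
    set M := mixedNorm 1 2 e
      (⇑(𝓕⁻ (hh.memLp_mulP.toLp (mulP h)) : Lp ℂ 2 (volume : Measure SpaceTime)))
    have h1 : ENNReal.ofReal (smoothingConst K / 2 ^ k) =
        ENNReal.ofReal (smoothingConst K * 2 ^ (-(k : ℝ) / 2)) *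
          ENNReal.ofReal ((2 : ℝ) ^ (-(k : ℝ) / 2)) := by
      rw [← ENNReal.ofReal_mul (by positivity), mul_assoc, ← sq, rpow_neg_half_sq, div_eq_mul_inv]
    have h2 : (1 : ℝ≥0∞) ≤ ENNReal.ofReal (2 * Real.pi) := by
      rw [ENNReal.one_le_ofReal]; linarith [Real.pi_gt_three]
    calc _ = ENNReal.ofReal (smoothingConst K * 2 ^ (-(k : ℝ) / 2)) *
          (ENNReal.ofReal ((2 : ℝ) ^ (-(k : ℝ) / 2)) * (scaleConst * (1 * M))) *
          mixedNorm 1 2 e' Ψ := by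
          change scaleConst * (ENNReal.ofReal (smoothingConst K / 2 ^ k) * M * _) = _
          rw [h1]; ring
      _ ≤ _ := by gcongr

theorem IsDecomp.memLp {L : ℕ} {d : Fin L → Plane} {h : Fin L → SpaceTime → ℂ}
    (hd : IsDecomp η₀ d k f g h) : MemLp f 2 volume :=
  (memLp_congr_ae hd.eq).2
    (hd.memX.memLp.add (memLp_finsetSum _ fun l _ => (hd.memY l).memLp))

/-- The local smoothing estimate for one decomposition. -/
theorem IsDecomp.mixedNorm_top_le {L : ℕ} {d : Fin L → Plane} {h : Fin L → SpaceTime → ℂ}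
    (hη : IsCutoff η₀) (hdir : ∀ l, d l ∈ Metric.sphere (0 : Plane) 1)
    (he' : e' ∈ Metric.sphere (0 : Plane) 1)
    {K : ℝ} (hK0 : 0 ≤ K) (hK : ∀ x y, |η₀ x - η₀ y| ≤ K * |x - y|)
    (hd : IsDecomp η₀ d k f g h) :
    mixedNorm ⊤ 2 e' (invFourier (fun z => f z * (chi η₀ k 30 (slope e' z) : ℂ))) ≤
      ENNReal.ofReal ((scaleConst.toReal * 2 ^ 101 + smoothingConst K) * 2 ^ (-(k : ℝ) / 2)) *
        (xNorm η₀ g + ∑ l, yNorm k (d l) (h l)) := by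
  have hC := smoothingConst_pos hK0
  have hfχ := memLp_mul_chi hη k e' hd.memLp
  have hs : scaleConst = ENNReal.ofReal scaleConst.toReal :=
    (ENNReal.ofReal_toReal scaleConst_ne_top).symm
  set A : ℝ≥0∞ := ENNReal.ofReal ((scaleConst.toReal * 2 ^ 101 + smoothingConst K) *
    2 ^ (-(k : ℝ) / 2)) with hA
  have hA1 : scaleConst * ENNReal.ofReal (2 ^ 101 * 2 ^ (-(k : ℝ) / 2)) ≤ A := by
    rw [hs, ← ENNReal.ofReal_mul ENNReal.toReal_nonneg, ← mul_assoc]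
    exact ENNReal.ofReal_le_ofReal (by gcongr; linarith)
  have hA2 : ENNReal.ofReal (smoothingConst K * 2 ^ (-(k : ℝ) / 2)) ≤ A := by
    refine ENNReal.ofReal_le_ofReal ?_
    gcongr
    have : 0 ≤ scaleConst.toReal := ENNReal.toReal_nonneg
    linarith [mul_nonneg this (by positivity : (0 : ℝ) ≤ 2 ^ 101)]
  rw [mixedNorm_top_invFourier e' hfχ]
  have hmain : mixedNorm ⊤ 2 e' (⇑(𝓕⁻ (hfχ.toLp _) : Lp ℂ 2 (volume : Measure SpaceTime))) ≤
      scaleConst⁻¹ * (A * (xNorm η₀ g + ∑ l, yNorm k (d l) (h l))) := by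
    refine mixedNorm_top_le_of_pairing he' (Lp.stronglyMeasurable _) (Lp.memLp _) fun Ψ hΨ => ?_
    rw [integral_fourierInv_mul_conj hfχ hΨ.int hΨ.memLp]
    have hsplit : ∫ z, f z * (chi η₀ k 30 (slope e' z) : ℂ) * (starRingEnd ℂ) (𝓕 Ψ z) =
        (∫ z, g z * (chi η₀ k 30 (slope e' z) : ℂ) * (starRingEnd ℂ) (𝓕 Ψ z)) +
        ∑ l, ∫ z, h l z * (chi η₀ k 30 (slope e' z) : ℂ) * (starRingEnd ℂ) (𝓕 Ψ z) := by
      have hhi := fun l => integrable_mul_chi_mul_fourier hη k e' (hd.memY l).memLp hΨ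
      rw [← integral_finsetSum _ fun l _ => hhi l, ← integral_add
        (integrable_mul_chi_mul_fourier hη k e' hd.memX.memLp hΨ)
        (integrable_finsetSum _ fun l _ => hhi l)]
      refine integral_congr_ae ?_
      filter_upwards [hd.eq] with z hz
      rw [hz, ← Finset.sum_mul, ← Finset.sum_mul]
      ring
    rw [hsplit, mul_assoc, ← ENNReal.inv_mul_le_iff
      (ENNReal.inv_ne_zero.2 scaleConst_ne_top) (ENNReal.inv_ne_top.2 scaleConst_ne_zero), inv_inv]
    calc _ ≤ scaleConst * (‖∫ z, g z * (chi η₀ k 30 (slope e' z) : ℂ) *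
            (starRingEnd ℂ) (𝓕 Ψ z)‖ₑ +
          ∑ l, ‖∫ z, h l z * (chi η₀ k 30 (slope e' z) : ℂ) * (starRingEnd ℂ) (𝓕 Ψ z)‖ₑ) := by
          gcongr
          exact (enorm_add_le _ _).trans (add_le_add le_rfl (enorm_sum_le _ _))
      _ ≤ scaleConst * (ENNReal.ofReal (2 ^ 101 * 2 ^ (-(k : ℝ) / 2)) * xNorm η₀ g *
            mixedNorm 1 2 e' Ψ) +
          ∑ l, A * yNorm k (d l) (h l) * mixedNorm 1 2 e' Ψ := by
          rw [mul_add, Finset.mul_sum]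
          refine add_le_add (mul_le_mul_right (enorm_integral_memX_le hη he' hd.memX hΨ) _)
            (Finset.sum_le_sum fun l _ => (scaleConst_mul_enorm_integral_memY_le hη (hdir l) he'
              hK0 hK (hd.memY l) hΨ).trans ?_)
          gcongr
      _ ≤ A * xNorm η₀ g * mixedNorm 1 2 e' Ψ +
          ∑ l, A * yNorm k (d l) (h l) * mixedNorm 1 2 e' Ψ := by
          rw [← mul_assoc, ← mul_assoc]
          gcongr
      _ = _ := by
          rw [← Finset.sum_mul, ← Finset.mul_sum]; ring
  refine (mul_le_mul_right hmain _).trans (le_of_eq ?_)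
  rw [← mul_assoc, ENNReal.mul_inv_cancel scaleConst_ne_zero scaleConst_ne_top, one_mul]

/-- The local smoothing estimate. -/
theorem exists_mixedNorm_top_le_zNorm {L : ℕ} {d : Fin L → Plane} (hη : IsCutoff η₀)
    (hdir : ∀ l, d l ∈ Metric.sphere (0 : Plane) 1) :
    ∃ C : ℝ, 0 < C ∧ ∀ (k : ℕ), ∀ e' ∈ Metric.sphere (0 : Plane) 1, ∀ f : SpaceTime → ℂ,
      mixedNorm ⊤ 2 e' (invFourier (fun z => f z * (chi η₀ k 30 (slope e' z) : ℂ))) ≤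
        ENNReal.ofReal (C * (2 : ℝ) ^ (-(k : ℝ) / 2)) * zNorm η₀ d k f := by
  obtain ⟨K, hK0, hK⟩ := hη.exists_lipschitz
  have hC := smoothingConst_pos hK0
  have hs : 0 ≤ scaleConst.toReal := ENNReal.toReal_nonneg
  refine ⟨scaleConst.toReal * 2 ^ 101 + smoothingConst K, by positivity, fun k e' he' f => ?_⟩
  -- A nonzero finite constant can be moved to the left, after which the infimum is treated one
  -- decomposition at a time.
  have h0 : ENNReal.ofReal ((scaleConst.toReal * 2 ^ 101 + smoothingConst K) *
      (2 : ℝ) ^ (-(k : ℝ) / 2)) ≠ 0 := by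
    rw [Ne, ENNReal.ofReal_eq_zero, not_le]; positivity
  rw [← ENNReal.inv_mul_le_iff h0 ENNReal.ofReal_ne_top, zNorm]
  refine le_iInf fun g => le_iInf fun h => le_iInf fun hd => ?_
  rw [ENNReal.inv_mul_le_iff h0 ENNReal.ofReal_ne_top]
  exact hd.mixedNorm_top_le hη hdir he' hK0 hK

end UpperBound

end LocalSmoothing

namespace LocalSmoothing

/-! ### Inverse transforms of tensor products and the inclusion of `X_k` in `Z_k`. -/

section InverseTransform

variable {V : Type*} [NormedAddCommGroup V] [InnerProductSpace ℝ V] [FiniteDimensional ℝ V]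
  [MeasurableSpace V] [BorelSpace V]

/-- On `L¹ ∩ L²` the `L²` inverse Fourier transform is given by the Fourier integral. -/
theorem coeFn_fourierInv_toLp {f : V → ℂ} (hf : Integrable f) (hf2 : MemLp f 2 volume) :
    (𝓕⁻ (hf2.toLp f) : Lp ℂ 2 (volume : Measure V)) =ᵐ[volume] 𝓕⁻ f := by
  have hfn : Integrable (fun x => f (-x)) := hf.comp_neg
  have hinv : 𝓕⁻ f = 𝓕 (fun x => f (-x)) := by
    ext x
    rw [Real.fourierInv_eq_fourier_comp_neg]
  refine ae_eq_of_integral_contDiff_smul_eq (μ := volume) ?_ ?_ ?_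
  · exact (Lp.memLp _).locallyIntegrable (by norm_num)
  · rw [hinv]; exact (continuous_fourier_of_integrable hfn).locallyIntegrable
  intro g hg hgc
  have hgc' : HasCompactSupport (fun x => (g x : ℂ)) := hgc.comp_left (g := Complex.ofReal) rfl
  have hg' : ContDiff ℝ ∞ (fun x => (g x : ℂ)) := Complex.ofRealCLM.contDiff.comp hg
  set φ := hgc'.toSchwartzMap hg' with hφ
  have hφx : ∀ x, φ x = g x := fun x => rfl
  have h1 := congrArg (fun T => T φ) (Lp.fourierInv_toTemperedDistribution_eq (hf2.toLp f))
  simp only [TemperedDistribution.fourierInv_apply, Lp.toTemperedDistribution_apply] at h1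
  have h2 : ∫ x, g x • (𝓕⁻ f) x = ∫ x, (𝓕⁻ φ) x • f x := by
    have := VectorFourier.integral_fourierIntegral_smul_eq_flip (L := innerₗ V)
      (μ := volume) (ν := volume) (f := fun x => φ x) (g := fun x => f (-x))
      Real.continuous_fourierChar continuous_inner φ.integrable hfn
    rw [flip_innerₗ] at this
    have h3 : ∀ x, (𝓕⁻ φ) x = VectorFourier.fourierIntegral Real.fourierChar volume (innerₗ V)
        (fun x => φ x) (-x) := fun x => by
      rw [SchwartzMap.fourierInv_coe, Real.fourierInv_eq_fourier_neg]; rfl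
    rw [← integral_neg_eq_self] at this
    simp only [neg_neg, ← h3] at this
    rw [this, hinv]
    simp [Real.fourier_eq, VectorFourier.fourierIntegral, hφx]
  have h4 : ∫ x, (𝓕⁻ φ) x • (hf2.toLp f) x = ∫ x, (𝓕⁻ φ) x • f x :=
    integral_congr_ae (by filter_upwards [hf2.coeFn_toLp] with x hx; rw [hx])
  rw [h2, ← h4, h1]
  simp [hφx]

theorem eLpNorm_fourierInv {f : V → ℂ} (hf : Integrable f) (hf2 : MemLp f 2 volume) :
    eLpNorm (𝓕⁻ f) 2 volume = eLpNorm f 2 volume := by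
  have h := Lp.norm_fourier_eq (𝓕⁻ (hf2.toLp f))
  rw [FourierTransform.fourier_fourierInv_eq] at h
  rw [← eLpNorm_congr_ae (coeFn_fourierInv_toLp hf hf2), ← eLpNorm_congr_ae hf2.coeFn_toLp]
  rw [Lp.norm_def, Lp.norm_def] at h
  exact (ENNReal.toReal_eq_toReal_iff' (Lp.eLpNorm_ne_top _) (Lp.eLpNorm_ne_top _)).1 h.symm

end InverseTransform

section Tensor

variable {e : Plane}

/-- The `L²` transform is defined only up to null sets; by Fubini a null set is null on almost every
slice. -/
theorem mixedNorm_congr_ae {p : ℝ≥0∞} {F G : SpaceTime → ℂ}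
    (he : e ∈ Metric.sphere (0 : Plane) 1) (h : F =ᵐ[volume] G) :
    mixedNorm p 2 e F = mixedNorm p 2 e G := by
  have h1 : ∀ᵐ q : ℝ × Plane, F (frame e q) = G (frame e q) :=
    (measurePreserving_frame he).quasiMeasurePreserving.ae h
  rw [Measure.volume_eq_prod] at h1
  simp only [mixedNorm, eLpNorm_framePoint]
  refine eLpNorm_congr_ae ?_
  filter_upwards [Measure.ae_ae_of_ae_prod h1] with r hr
  exact eLpNorm_congr_ae hr

/-- The inverse transform of a function that is a tensor product in the frame of `e`. -/
theorem fourierInv_frame_tensor (he : e ∈ Metric.sphere (0 : Plane) 1) {f : SpaceTime → ℂ}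
    {a : ℝ → ℂ} {b : Plane → ℂ} (hf : ∀ s y, f (frame e (s, y)) = a s * b y) (r : ℝ) (y : Plane) :
    𝓕⁻ f (frame e (r, y)) = 𝓕⁻ a r * 𝓕⁻ b y := by
  rw [Real.fourierInv_eq, Real.fourierInv_eq, Real.fourierInv_eq, ← integral_prod_mul,
    ← (measurePreserving_frame he).integral_comp (measurableEmbedding_frame he),
    Measure.volume_eq_prod]
  refine integral_congr_ae (Filter.Eventually.of_forall fun p => ?_)
  simp only [inner_frame_frame he, hf, Circle.smul_def, smul_eq_mul, AddChar.map_add_eq_mul,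
    Circle.coe_mul]
  simp [mul_comm]
  ring

theorem mixedNorm_top_fourierInv_tensor (he : e ∈ Metric.sphere (0 : Plane) 1) {f : SpaceTime → ℂ}
    {a : ℝ → ℂ} {b : Plane → ℂ} (hf : ∀ s y, f (frame e (s, y)) = a s * b y)
    (hb : Integrable b) (hb2 : MemLp b 2 volume) :
    mixedNorm ⊤ 2 e (𝓕⁻ f) = eLpNorm (𝓕⁻ a) ⊤ volume * eLpNorm b 2 volume := by
  have h : ∀ r, eLpNorm (slice e (𝓕⁻ f) r) 2 volume = eLpNorm b 2 volume * ‖𝓕⁻ a r‖ₑ := by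
    intro r
    have : slice e (𝓕⁻ f) r = 𝓕⁻ a r • 𝓕⁻ b := by
      ext y
      simp [slice, fourierInv_frame_tensor he hf]
    rw [this, eLpNorm_const_smul, eLpNorm_fourierInv hb hb2, mul_comm]
  simp_rw [mixedNorm_top, h]
  rw [ENNReal.essSup_const_mul, eLpNorm_exponent_top, eLpNormEssSup_eq_essSup_enorm, mul_comm]

end Tensor

section Zero

variable {e : Plane} {k : ℕ}

theorem yNorm_zero (he : e ∈ Metric.sphere (0 : Plane) 1) : yNorm k e 0 = 0 := by
  have h0 : mulP 0 = 0 := by ext z; simp [mulP]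
  rw [yNorm, h0, mixedNorm_one_invFourier e (MemLp.zero (ε := ℂ))]
  have h1 : (𝓕⁻ ((MemLp.zero (ε := ℂ) : MemLp (0 : SpaceTime → ℂ) 2 volume).toLp 0) :
      Lp ℂ 2 (volume : Measure SpaceTime)) = 0 := by
    rw [MemLp.toLp_zero]
    exact (Lp.fourierTransformₗᵢ SpaceTime ℂ).symm.map_zero
  rw [h1, mixedNorm_congr_ae he (Lp.coeFn_zero ℂ 2 volume)]
  simp [mixedNorm]

theorem memY_zero (he : e ∈ Metric.sphere (0 : Plane) 1) : MemY k e 0 where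
  memLp := MemLp.zero
  supp := Filter.Eventually.of_forall fun _ _ => rfl
  memLp_mulP := by
    have h0 : mulP 0 = 0 := by ext z; simp [mulP]
    rw [h0]; exact MemLp.zero
  norm_lt_top := by rw [yNorm_zero he]; exact ENNReal.zero_lt_top
  eq_zero := fun _ => Filter.EventuallyEq.rfl

theorem MemX.isDecomp {η₀ : ℝ → ℝ} {L : ℕ} {d : Fin L → Plane} {f : SpaceTime → ℂ}
    (hdir : ∀ l, d l ∈ Metric.sphere (0 : Plane) 1) (hf : MemX η₀ k f) :
    IsDecomp η₀ d k f f (fun _ => 0) where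
  memX := hf
  memY l := memY_zero (hdir l)
  eq := Filter.Eventually.of_forall fun z => by simp

theorem MemX.zNorm_le {η₀ : ℝ → ℝ} {L : ℕ} {d : Fin L → Plane} {f : SpaceTime → ℂ}
    (hdir : ∀ l, d l ∈ Metric.sphere (0 : Plane) 1) (hf : MemX η₀ k f) :
    zNorm η₀ d k f ≤ xNorm η₀ f := by
  have h : zNorm η₀ d k f ≤ xNorm η₀ f + ∑ l, yNorm k (d l) 0 :=
    iInf_le_of_le f (iInf_le_of_le (fun _ => 0) (iInf_le_of_le (hf.isDecomp hdir) le_rfl))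
  simpa [yNorm_zero (hdir _)] using h

end Zero
end LocalSmoothing

namespace LocalSmoothing

/-! ### Failure of the estimate without the cutoff. -/

section Sharpness

variable {η₀ : ℝ → ℝ} {k : ℕ}

/-- The first coordinate direction. -/
noncomputable def firstDir : Plane := !₂[1, 0]

theorem firstDir_mem : firstDir ∈ Metric.sphere (0 : Plane) 1 := by
  simp [firstDir, EuclideanSpace.norm_eq]

/-- The indicator function of the interval `|ξ₁| ≤ 1/2`. -/
noncomputable def intervalBump : ℝ → ℂ := (Set.Icc (-(1 / 2) : ℝ) (1 / 2)).indicator 1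

/-- The disc of radius `2^(-k)/64` around the point `(2^k, 4^k)` of the parabola `τ = ξ₂²`. -/
def parabolaDisc (k : ℕ) : Set Plane :=
  Metric.closedBall (!₂[(2 : ℝ) ^ k, (2 ^ k) ^ 2]) ((2 ^ k)⁻¹ / 64)

/-- The indicator function of the disc on the parabola. -/
noncomputable def discBump (k : ℕ) : Plane → ℂ := (parabolaDisc k).indicator 1

/-- A function concentrated at frequencies with `ξ · e = O(1)`, near the characteristic surface. -/
noncomputable def flatBump (k : ℕ) (z : SpaceTime) : ℂ := intervalBump (z 0) * discBump k !₂[z 1, z 2]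

theorem flatBump_frame (k : ℕ) (s : ℝ) (y : Plane) :
    flatBump k (frame firstDir (s, y)) = intervalBump s * discBump k y := by
  have : (!₂[y 0, y 1] : Plane) = y := by ext i; fin_cases i <;> rfl
  simp [flatBump, frame, framePoint, firstDir, this]

theorem eLpNorm_intervalBump : eLpNorm intervalBump 2 volume = 1 := by
  have h : intervalBump = (Set.Icc (-(1 / 2) : ℝ) (1 / 2)).indicator (fun _ => (1 : ℂ)) := rfl
  rw [h, eLpNorm_indicator_const measurableSet_Icc (by norm_num) (by norm_num)]
  norm_num

theorem memLp_intervalBump (p : ℝ≥0∞) : MemLp intervalBump p volume :=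
  memLp_indicator_const p measurableSet_Icc (1 : ℂ) (Or.inr (by simp))

theorem measurableSet_parabolaDisc (k : ℕ) : MeasurableSet (parabolaDisc k) :=
  Metric.isClosed_closedBall.measurableSet

theorem memLp_discBump (k : ℕ) (p : ℝ≥0∞) : MemLp (discBump k) p volume :=
  memLp_indicator_const p (measurableSet_parabolaDisc k) (1 : ℂ)
    (Or.inr measure_closedBall_lt_top.ne)

theorem eLpNorm_discBump_ne_zero (k : ℕ) : eLpNorm (discBump k) 2 volume ≠ 0 := by
  have h : discBump k = (parabolaDisc k).indicator (fun _ => (1 : ℂ)) := rfl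
  have hpos : 0 < volume (parabolaDisc k) := Metric.measure_closedBall_pos _ _ (by positivity)
  rw [h, eLpNorm_indicator_const (measurableSet_parabolaDisc k) (by norm_num) (by norm_num)]
  simp only [enorm_one, one_mul]
  rw [Ne, ENNReal.rpow_eq_zero_iff]
  simp [hpos.ne']

theorem stronglyMeasurable_flatBump (k : ℕ) : StronglyMeasurable (flatBump k) := by
  refine StronglyMeasurable.mul ?_ ?_
  · exact (stronglyMeasurable_one.indicator measurableSet_Icc).comp_measurable
      (by fun_prop : Measurable fun z : SpaceTime => z 0)
  · exact (stronglyMeasurable_one.indicator (measurableSet_parabolaDisc k)).comp_measurable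
      (by fun_prop : Continuous fun z : SpaceTime => (!₂[z 1, z 2] : Plane)).measurable

theorem eLpNorm_flatBump (k : ℕ) :
    eLpNorm (flatBump k) 2 volume = eLpNorm (discBump k) 2 volume := by
  have hs : ∀ r, eLpNorm (slice firstDir (flatBump k) r) 2 volume =
      ‖intervalBump r‖ₑ * eLpNorm (discBump k) 2 volume := by
    intro r
    have : slice firstDir (flatBump k) r = intervalBump r • discBump k := by
      ext y; simp [slice, flatBump_frame]
    rw [this, eLpNorm_const_smul]
  have h := eLpNorm_sq_eq_lintegral_slice firstDir_mem (stronglyMeasurable_flatBump k)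
  simp_rw [hs, mul_pow] at h
  rw [lintegral_mul_const' _ _ (ENNReal.pow_ne_top (memLp_discBump k 2).2.ne), ← eLpNorm_two_sq,
    eLpNorm_intervalBump, one_pow, one_mul] at h
  exact (ENNReal.pow_right_strictMono two_ne_zero).injective h

theorem integrable_flatBump (k : ℕ) : Integrable (flatBump k) := by
  rw [← (measurePreserving_frame firstDir_mem).integrable_comp_emb
    (measurableEmbedding_frame firstDir_mem)]
  have h : Integrable (fun p : ℝ × Plane => intervalBump p.1 * discBump k p.2) :=
    (memLp_one_iff_integrable.1 (memLp_intervalBump 1)).mul_prod (memLp_one_iff_integrable.1 (memLp_discBump k 1))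
  exact h.congr (Filter.Eventually.of_forall fun p => (flatBump_frame k p.1 p.2).symm)

theorem memLp_flatBump (k : ℕ) : MemLp (flatBump k) 2 volume :=
  ⟨(stronglyMeasurable_flatBump k).aestronglyMeasurable, by
    rw [eLpNorm_flatBump]; exact (memLp_discBump k 2).2⟩

theorem flatBump_support {z : SpaceTime} (hz : flatBump k z ≠ 0) :
    |z 0| ≤ 1 / 2 ∧ |z 1 - 2 ^ k| ≤ (2 ^ k)⁻¹ / 64 ∧ |z 2 - (2 ^ k) ^ 2| ≤ (2 ^ k)⁻¹ / 64 := by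
  have h0 : z 0 ∈ Set.Icc (-(1 / 2) : ℝ) (1 / 2) := by
    by_contra h
    exact hz (by rw [flatBump, intervalBump, Set.indicator_of_notMem h, zero_mul])
  have h1 : (!₂[z 1, z 2] : Plane) ∈ parabolaDisc k := by
    by_contra h
    exact hz (by rw [flatBump, discBump, Set.indicator_of_notMem h, mul_zero])
  rw [parabolaDisc, mem_closedBall_iff_norm] at h1
  have hc := fun i => (PiLp.norm_apply_le _ i).trans h1
  exact ⟨abs_le.2 h0, by simpa using hc 0, by simpa using hc 1⟩

/-- The radius `2^(-k)/64` compensates the growth of `ξ₂²`, whose derivative is of size `2^k`: the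
three terms contribute at most `1/4 + 1/16 + 1/64`. -/
theorem abs_symbolP_le_of_flatBump_ne_zero {z : SpaceTime} (hz : flatBump k z ≠ 0) :
    |symbolP z| ≤ 1 / 2 := by
  obtain ⟨h0, h1, h2⟩ := flatBump_support hz
  have hN : (1 : ℝ) ≤ 2 ^ k := one_le_pow₀ (by norm_num)
  have hinv : ((2 : ℝ) ^ k)⁻¹ ≤ 1 := inv_le_one_of_one_le₀ hN
  have hsq : |z 1 ^ 2 - (2 ^ k) ^ 2| ≤ 1 / 16 := by
    have h3 : |z 1 + 2 ^ k| ≤ 4 * 2 ^ k := by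
      rw [abs_le] at h1 ⊢; constructor <;> linarith [h1.1, h1.2]
    have h4 : z 1 ^ 2 - (2 ^ k) ^ 2 = (z 1 - 2 ^ k) * (z 1 + 2 ^ k) := by ring
    rw [h4, abs_mul]
    calc _ ≤ ((2 : ℝ) ^ k)⁻¹ / 64 * (4 * 2 ^ k) := by gcongr
      _ = 1 / 16 := by field_simp; norm_num
  have h00 : z 0 ^ 2 ≤ 1 / 4 := by
    rw [← sq_abs]; nlinarith [abs_nonneg (z 0)]
  rw [symbolP]
  rw [abs_le] at hsq h2 ⊢
  constructor <;> nlinarith [sq_nonneg (z 0), hsq.1, hsq.2, h2.1, h2.2]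

theorem mem_setDInf_of_flatBump_ne_zero {z : SpaceTime} (hz : flatBump (k + 1) z ≠ 0) :
    z ∈ setDInf (k + 1) := by
  obtain ⟨h0, h1, h2⟩ := flatBump_support hz
  have hN : (1 : ℝ) ≤ 2 ^ k := one_le_pow₀ (by norm_num)
  have hN' : (2 : ℝ) ^ (k + 1) = 2 * 2 ^ k := pow_succ' _ _
  have hinv : ((2 : ℝ) ^ (k + 1))⁻¹ ≤ 1 := inv_le_one_of_one_le₀ (by rw [hN']; linarith)
  have hz1 : |z 1| ≤ 2 * 2 ^ k + 1 / 64 := by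
    rw [abs_le] at h1 ⊢; constructor <;> linarith [h1.1, h1.2]
  have hz1' : 2 * 2 ^ k - 1 / 64 ≤ z 1 := by rw [abs_le] at h1; linarith [h1.1]
  have hnorm : ‖space z‖ ^ 2 = z 0 ^ 2 + z 1 ^ 2 := norm_space_sq z
  refine Set.mem_iUnion.2 ⟨0, ⟨?_, ?_⟩, (abs_symbolP_le_of_flatBump_ne_zero hz).trans (by norm_num)⟩
  · refine le_of_sq_le_sq ?_ (norm_nonneg _)
    rw [hnorm]
    nlinarith [sq_nonneg (z 0)]
  · refine le_of_sq_le_sq ?_ (by positivity)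
    rw [hnorm, ← sq_abs (z 0), ← sq_abs (z 1), pow_succ (2 : ℝ) (k + 1), hN']
    nlinarith [abs_nonneg (z 0), abs_nonneg (z 1)]

/-- On `|P| ≤ 1/2` every `η₀(P/2^n)` equals `1`, so only the piece `j = 0` survives. -/
theorem xNorm_flatBump (hη : IsCutoff η₀) (k : ℕ) :
    xNorm η₀ (flatBump k) = eLpNorm (discBump k) 2 volume := by
  have h0 : (fun z => (eta η₀ 0 (symbolP z) : ℂ) * flatBump k z) = flatBump k := by
    ext z
    by_cases hz : flatBump k z = 0
    · simp [hz]
    · rw [eta, hη.eq_one _ (abs_symbolP_le_of_flatBump_ne_zero hz)]; simp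
  have hj : ∀ j : ℕ, j ≠ 0 → ENNReal.ofReal ((2 : ℝ) ^ ((j : ℝ) / 2)) *
      eLpNorm (fun z => (eta η₀ j (symbolP z) : ℂ) * flatBump k z) 2 volume = 0 := by
    intro j hj
    obtain ⟨i, rfl⟩ := Nat.exists_eq_succ_of_ne_zero hj
    have hd : ∀ (n : ℕ) {x : ℝ}, |x| ≤ 1 / 2 → η₀ (x / 2 ^ n) = 1 := by
      intro n x hx
      refine hη.eq_one _ ?_
      rw [abs_div, abs_of_pos (by positivity : (0 : ℝ) < 2 ^ n)]
      exact (div_le_self (abs_nonneg x) (one_le_pow₀ (by norm_num))).trans hx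
    have : (fun z => (eta η₀ (i + 1) (symbolP z) : ℂ) * flatBump k z) = 0 := by
      ext z
      by_cases hz : flatBump k z = 0
      · simp [hz]
      · have := abs_symbolP_le_of_flatBump_ne_zero hz
        simp [eta, hd _ this]
    rw [Nat.succ_eq_add_one, this]
    simp
  rw [xNorm, tsum_eq_single 0 hj, h0, eLpNorm_flatBump]
  simp

theorem memX_flatBump (hη : IsCutoff η₀) (k : ℕ) : MemX η₀ (k + 1) (flatBump (k + 1)) where
  memLp := memLp_flatBump _
  supp := Filter.Eventually.of_forall fun _ hz => by
    by_contra h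
    exact hz (mem_setDInf_of_flatBump_ne_zero h)
  norm_lt_top := by rw [xNorm_flatBump hη]; exact (memLp_discBump _ 2).2

/-- By Plancherel the inverse transform has `L²` norm one, so it cannot vanish almost everywhere. -/
theorem eLpNorm_top_fourierInv_intervalBump_ne_zero :
    eLpNorm (𝓕⁻ intervalBump) ⊤ volume ≠ 0 := by
  have hint : Integrable intervalBump := memLp_one_iff_integrable.1 (memLp_intervalBump 1)
  have hm : AEStronglyMeasurable (𝓕⁻ intervalBump) volume :=
    (Lp.aestronglyMeasurable _).congr (coeFn_fourierInv_toLp hint (memLp_intervalBump 2))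
  intro h
  rw [eLpNorm_eq_zero_iff hm (by simp)] at h
  have h2 := eLpNorm_fourierInv hint (memLp_intervalBump 2)
  rw [eLpNorm_congr_ae h, eLpNorm_intervalBump] at h2
  simp at h2

/-- Without the cutoff the local smoothing estimate fails in the first coordinate direction. -/
theorem exists_zNorm_lt_mixedNorm_top {L : ℕ} {d : Fin L → Plane} (hη : IsCutoff η₀)
    (hdir : ∀ l, d l ∈ Metric.sphere (0 : Plane) 1) (C : ℝ) :
    ∃ (k : ℕ) (f : SpaceTime → ℂ), MemZ η₀ d k f ∧
      ENNReal.ofReal (C * (2 : ℝ) ^ (-(k : ℝ) / 2)) * zNorm η₀ d k f <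
        mixedNorm ⊤ 2 firstDir (invFourier f) := by
  set c : ℝ≥0∞ := scaleConst * eLpNorm (𝓕⁻ intervalBump) ⊤ volume with hc
  have hc0 : 0 < c :=
    pos_iff_ne_zero.2 (mul_ne_zero scaleConst_ne_zero eLpNorm_top_fourierInv_intervalBump_ne_zero)
  have hlim : Filter.Tendsto (fun k : ℕ => ENNReal.ofReal (C * (2 : ℝ) ^ (-((k + 1 : ℕ) : ℝ) / 2)))
      Filter.atTop (nhds 0) := by
    have h1 : Filter.Tendsto (fun k : ℕ => (2 : ℝ) ^ (-((k + 1 : ℕ) : ℝ) / 2)) Filter.atTop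
        (nhds 0) := by
      have h2 : Filter.Tendsto (fun k : ℕ => -((k + 1 : ℕ) : ℝ) / 2) Filter.atTop Filter.atBot :=
        (Filter.tendsto_neg_atTop_atBot.comp (tendsto_natCast_atTop_atTop.comp
          (Filter.tendsto_add_atTop_nat 1))).atBot_div_const (by norm_num)
      exact (tendsto_rpow_atBot_of_base_gt_one 2 (by norm_num)).comp h2
    have h3 := ENNReal.tendsto_ofReal (h1.const_mul C)
    simpa using h3
  -- The ratio of the two norms is at least `c`, independently of `k`, while `C 2^(-(k+1)/2)` tends
  -- to zero.
  obtain ⟨k, hk⟩ := (hlim.eventually_lt_const hc0).exists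
  have hX := memX_flatBump hη k
  refine ⟨k + 1, flatBump (k + 1), ⟨_, _, hX.isDecomp hdir⟩, ?_⟩
  have hfin := (memLp_discBump (k + 1) 2).2.ne
  rw [mixedNorm_top_invFourier _ hX.memLp, mixedNorm_congr_ae firstDir_mem
    (coeFn_fourierInv_toLp (integrable_flatBump _) hX.memLp), mixedNorm_top_fourierInv_tensor
    firstDir_mem (flatBump_frame (k + 1)) (memLp_one_iff_integrable.1 (memLp_discBump _ 1))
    (memLp_discBump _ 2), ← mul_assoc]
  refine lt_of_le_of_lt (mul_le_mul_right ((hX.zNorm_le hdir).trans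
    (xNorm_flatBump hη (k + 1)).le) _) ?_
  exact ENNReal.mul_lt_mul_left (eLpNorm_discBump_ne_zero _) hfin hk

end Sharpness

end LocalSmoothing

theorem lemma3p5 (η₀ : ℝ → ℝ) (hη₀ : LocalSmoothing.IsCutoff η₀)
    (L : ℕ) (e : Fin L → LocalSmoothing.Plane) (he : LocalSmoothing.IsDirectionFamily e) :
    (∃ C : ℝ, 0 < C ∧
      ∀ (k : ℕ), ∀ e' ∈ Metric.sphere (0 : LocalSmoothing.Plane) 1,
        ∀ f : LocalSmoothing.SpaceTime → ℂ, LocalSmoothing.MemZ η₀ e k f →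
          LocalSmoothing.mixedNorm ⊤ 2 e' (LocalSmoothing.invFourier (fun z =>
              f z * (LocalSmoothing.chi η₀ k 30
                (inner ℝ (LocalSmoothing.space z) (LocalSmoothing.conjVec e')) : ℂ)))
            ≤ ENNReal.ofReal (C * (2 : ℝ) ^ (-(k : ℝ) / 2)) * LocalSmoothing.zNorm η₀ e k f) ∧
    (∃ e' ∈ Metric.sphere (0 : LocalSmoothing.Plane) 1, ∀ C : ℝ,
      ∃ (k : ℕ) (f : LocalSmoothing.SpaceTime → ℂ), LocalSmoothing.MemZ η₀ e k f ∧
        ENNReal.ofReal (C * (2 : ℝ) ^ (-(k : ℝ) / 2)) * LocalSmoothing.zNorm η₀ e k f <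
          LocalSmoothing.mixedNorm ⊤ 2 e' (LocalSmoothing.invFourier f)) := by
  exact ⟨(LocalSmoothing.exists_mixedNorm_top_le_zNorm hη₀ he.unit).imp fun C hC =>
      ⟨hC.1, fun k e' he' f _ => hC.2 k e' he' f⟩,
    LocalSmoothing.firstDir, LocalSmoothing.firstDir_mem,
    LocalSmoothing.exists_zNorm_lt_mixedNorm_top hη₀ he.unit⟩
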